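/- Conventions. For a connected undirected unweighted graph $G=(V,E)$ let $n=|V|$ and $m=|E|$, and let $\mathrm{dist}_G$ be the shortest-path distance. $G$ is called $\delta$-hyperbolic if for all nodes $u,v,w$ and all shortest paths $P$ from $u$ to $v$, $Q$ from $u$ to $w$ and $R$ from $v$ to $w$, every node of $P$ is within distance $\delta$ of a node of $Q\cup R$. For a nonempty set $S\subseteq V$ the node expansion is $h_G(S)=|\partial_G(S)|/|S|$, where $\partial_G(S)$ is the set of nodes outside $S$ that are adjacent to a node of $S$. We write $\log=\log_2$. **Theorem.** Let $0<\mu<1$ be a constant. Then for all sufficiently large $n$ (depending only on $\mu$) the following holds for every connected graph $G$ on $n$ nodes, every integer $d>2$ such that all degrees of $G$ are at most $d$, every real $\delta\ge\frac12$ such that $G$ is $\delta$-hyperbolic, and any two distinct nodes $p,q$ of $G$ at distance $\Delta=\mathrm{dist}_G(p,q)$. There are an integer $$t\ \ge\ \max\left\{\frac{\Delta^{\mu}}{56\log d},\,1\right\}$$ and node subsets $\emptyset\subset S_1\subset S_2\subset\dots\subset S_t\subset V$ (all inclusions strict), each with at most $n/2$ nodes, such that 1. for every $j\in\{1,\dots,t\}$,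 $$h_G(S_j)\ \le\ \min\left\{\frac{8\ln(n/2)}{\Delta},\ \max\left\{\left(\frac1\Delta\right)^{1-\mu},\ \frac{500\ln n}{\Delta\,2^{\,\Delta^{\mu}/(28\,\delta\,\log(2d))}}\right\}\right\};$$ 2. all the subsets $S_1,\dots,S_t$ are found, for the given $G$, $p$ and $q$, in a total of $O(n^3\log n+mn^2)$ time, by one algorithm whose program and implied constant depend only on $\mu$. Time is counted on a unit-cost word RAM (words of $O(\log n)$ bits; input by adjacency matrix; output by characteristic vectors) in which $x\mapsto\lceil x^{\mu}\rceil$, for the fixed exponent $\mu$, is one of the arithmetic operations on words; 3. either all of $S_1,\dots,S_t$ contain $p$, or all of them contain $q$. -/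

import Mathlib

/-! ## Graph notions -/

/-- `G` is `δ`-hyperbolic (thin geodesic triangles): for all nodes `u, v, w` and all shortest paths
`P` from `u` to `v`, `Q` from `u` to `w`, `R` from `v` to `w`, every node of `P` is at distance
at most `δ` from a node of `Q` or of `R`. -/
def IsHyperbolic {V : Type*} (G : SimpleGraph V) (δ : ℝ) : Prop :=
  ∀ (u v w : V) (P : G.Walk u v) (Q : G.Walk u w) (R : G.Walk v w),
    P.length = G.dist u v → Q.length = G.dist u w → R.length = G.dist v w →
    ∀ x ∈ P.support, ∃ y, (y ∈ Q.support ∨ y ∈ R.support) ∧ (G.dist x y : ℝ) ≤ δ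

/-- The boundary of `S`: the nodes outside `S` that are adjacent to at least one node of `S`. -/
def nodeBoundary {n : ℕ} (G : SimpleGraph (Fin n)) [DecidableRel G.Adj] (S : Finset (Fin n)) :
    Finset (Fin n) :=
  Finset.univ.filter (fun u => u ∉ S ∧ ∃ v ∈ S, G.Adj u v)

/-- The node expansion ratio of `S`. -/
noncomputable def nodeExpansion {n : ℕ} (G : SimpleGraph (Fin n)) [DecidableRel G.Adj]
    (S : Finset (Fin n)) : ℝ :=
  ((nodeBoundary G S).card : ℝ) / (S.card : ℝ)

/-! ## A word RAM with a step count

A machine has registers `reg 0, reg 1, …` and arrays `arr 0, arr 1, …` of natural numbers. A program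
is a fixed finite structured text, so it uses only finitely many registers and arrays. -/

namespace RAM

/-- Contents of the registers and of the arrays. -/
structure State where
  reg : ℕ → ℕ
  arr : ℕ → ℕ → ℕ

/-- Arithmetic expressions. The operation `pow e` is exponentiation with the real constant `μ` as
exponent, rounded up; it is the only access of the machine to `μ`. -/
inductive Expr where
  | const (c : ℕ)
  | reg (i : ℕ)
  | get (a : ℕ) (idx : Expr)
  | add (e₁ e₂ : Expr)
  | sub (e₁ e₂ : Expr)
  | mul (e₁ e₂ : Expr)
  | div (e₁ e₂ : Expr)
  | lt (e₁ e₂ : Expr)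
  | pow (e : Expr)

/-- The value of an expression. Subtraction is truncated at `0`, division rounds down, and a
comparison has the value `1` if it is true and `0` otherwise. -/
noncomputable def Expr.eval (μ : ℝ) (s : State) : Expr → ℕ
  | .const c => c
  | .reg i => s.reg i
  | .get a idx => s.arr a (idx.eval μ s)
  | .add e₁ e₂ => e₁.eval μ s + e₂.eval μ s
  | .sub e₁ e₂ => e₁.eval μ s - e₂.eval μ s
  | .mul e₁ e₂ => e₁.eval μ s * e₂.eval μ s
  | .div e₁ e₂ => e₁.eval μ s / e₂.eval μ s
  | .lt e₁ e₂ => if e₁.eval μ s < e₂.eval μ s then 1 else 0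
  | .pow e => ⌈((e.eval μ s : ℕ) : ℝ) ^ μ⌉₊

/-- The number of steps that evaluating an expression takes: one for each node of the expression. -/
def Expr.cost : Expr → ℕ
  | .const _ => 1
  | .reg _ => 1
  | .get _ idx => idx.cost + 1
  | .add e₁ e₂ => e₁.cost + e₂.cost + 1
  | .sub e₁ e₂ => e₁.cost + e₂.cost + 1
  | .mul e₁ e₂ => e₁.cost + e₂.cost + 1
  | .div e₁ e₂ => e₁.cost + e₂.cost + 1
  | .lt e₁ e₂ => e₁.cost + e₂.cost + 1
  | .pow e => e.cost + 1

/-- Programs. In `cond e c₁ c₂` and `loop e c` the test succeeds if the value of `e` is not `0`. -/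
inductive Prog where
  | skip
  | assign (i : ℕ) (e : Expr)
  | put (a : ℕ) (idx e : Expr)
  | seq (c₁ c₂ : Prog)
  | cond (e : Expr) (c₁ c₂ : Prog)
  | loop (e : Expr) (c : Prog)

/-- The state after writing `x` into register `i`. -/
def State.setReg (s : State) (i x : ℕ) : State :=
  { s with reg := Function.update s.reg i x }

/-- The state after writing `x` into cell `j` of array `a`. -/
def State.setArr (s : State) (a j x : ℕ) : State :=
  { s with arr := Function.update s.arr a (Function.update (s.arr a) j x) }

/-- `Exec μ W c s s' k`: started in state `s`, the program `c` halts in state `s'` after `k` steps,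
and every number written during the run and every address written to is at most `W`. -/
inductive Exec (μ : ℝ) (W : ℕ) : Prog → State → State → ℕ → Prop
  | skip (s : State) : Exec μ W .skip s s 1
  | assign (s : State) (i : ℕ) (e : Expr) (he : e.eval μ s ≤ W) :
      Exec μ W (.assign i e) s (s.setReg i (e.eval μ s)) (e.cost + 1)
  | put (s : State) (a : ℕ) (idx e : Expr) (hidx : idx.eval μ s ≤ W) (he : e.eval μ s ≤ W) :
      Exec μ W (.put a idx e) s (s.setArr a (idx.eval μ s) (e.eval μ s)) (idx.cost + e.cost + 1)
  | seq (c₁ c₂ : Prog) (s₁ s₂ s₃ : State) (k₁ k₂ : ℕ)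
      (h₁ : Exec μ W c₁ s₁ s₂ k₁) (h₂ : Exec μ W c₂ s₂ s₃ k₂) :
      Exec μ W (.seq c₁ c₂) s₁ s₃ (k₁ + k₂)
  | condTrue (e : Expr) (c₁ c₂ : Prog) (s₁ s₂ : State) (k : ℕ) (he : e.eval μ s₁ ≠ 0)
      (h : Exec μ W c₁ s₁ s₂ k) : Exec μ W (.cond e c₁ c₂) s₁ s₂ (e.cost + 1 + k)
  | condFalse (e : Expr) (c₁ c₂ : Prog) (s₁ s₂ : State) (k : ℕ) (he : e.eval μ s₁ = 0)
      (h : Exec μ W c₂ s₁ s₂ k) : Exec μ W (.cond e c₁ c₂) s₁ s₂ (e.cost + 1 + k)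
  | loopDone (e : Expr) (c : Prog) (s : State) (he : e.eval μ s = 0) :
      Exec μ W (.loop e c) s s (e.cost + 1)
  | loopStep (e : Expr) (c : Prog) (s₁ s₂ s₃ : State) (k₁ k₂ : ℕ) (he : e.eval μ s₁ ≠ 0)
      (h₁ : Exec μ W c s₁ s₂ k₁) (h₂ : Exec μ W (.loop e c) s₂ s₃ k₂) :
      Exec μ W (.loop e c) s₁ s₃ (e.cost + 1 + k₁ + k₂)

/-- The input `(G, p, q)`: register `0` holds `n`, registers `1` and `2` hold `p` and `q`, array `0`
holds the adjacency matrix row by row, and everything else is `0`. -/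
def input {n : ℕ} (G : SimpleGraph (Fin n)) [DecidableRel G.Adj] (p q : Fin n) : State where
  reg i := if i = 0 then n else if i = 1 then (p : ℕ) else if i = 2 then (q : ℕ) else 0
  arr a j :=
    if a = 0 ∧ ∃ u v : Fin n, j = (u : ℕ) * n + (v : ℕ) ∧ G.Adj u v then 1 else 0

/-- The state `s` holds the output `S`: register `0` holds the number of sets, and array `1` holds
their characteristic vectors, one after the other. -/
def Outputs {n t : ℕ} (s : State) (S : Fin t → Finset (Fin n)) : Prop :=
  s.reg 0 = t ∧
    ∀ (j : Fin t) (v : Fin n), s.arr 1 ((j : ℕ) * n + (v : ℕ)) = if v ∈ S j then 1 else 0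

end RAM

/-! Write Δ for the distance of p and q, and T for the claimed bound on the expansion. Breadth-first
search from a source x in {p, q}, in G without a removed set D, lists vertices in such an order that
every ball around x in G − D is an initial segment (`avoidBall_eq_bfsPrefix`). Initial segments are
nested and contain x; their boundaries are taken in all of G. So it suffices to find one search with
t initial segments of at most n/2 vertices and expansion at most T.

Growth: take D empty. The balls of radius less than Δ/2 around p and q are disjoint, so around one
of the two they stay within n/2 vertices. A ball of expansion above T is followed by a ball 1 + T
times as large. If fewer than t radii were good, the balls would outgrow n/2 when T = 8 ln(n/2)/Δ
(`exists_goodPrefixes_of_log_le`).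

Hyperbolicity: for the other bound the usable radius has to become exponentially larger. Let D
consist of the vertices u with dist(p,u) + dist(q,u) < Δ + ρ that are farther than Δ/4 from p and
from q. Walks from p to q outside D are longer than Δ·2^N/40 with N about ρ/(2δ)
(`lt_length_of_notMem_removedSet`), so the balls in G − D stay disjoint up to a radius L of about
Δ·2^N/80. Moreover D lies close to a shortest path, hence has at most (Δ+1)·d^(k+1) vertices with k
about ρ/2 + 2δ (`card_removedSet_le`). Up to radius Δ/4 the search does not notice D, and without t
good radii the ball reaches a size that dwarfs |D|/T. From then on D spoils only a fraction of the
growth, and the balls would outgrow n before radius L. If they stop growing instead, their boundary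
lies in D, and the last t initial segments are good (`exists_goodPrefixes_of_removedSet`).

If T ≥ 2, sets of nearly n/2 vertices already have small enough expansion. `exists_goodPrefixes`
combines the three cases.

The algorithm knows none of d, δ and T. It tries both sources with every ρ < n, and chooses the
least ratio attained at least t times within a single search, where t (`requiredCount`) depends only
on Δ and μ. That ratio is at most T as soon as some search has t good segments (`exists_output`).
Each search and its ranking take O(n²) steps, so O(n³) in total. -/

namespace RAM

/-! ## A program logic for the word RAM -/

@[simp] theorem State.setReg_reg (s : State) (i x j : ℕ) :
    (s.setReg i x).reg j = if j = i then x else s.reg j := by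
  simp [State.setReg, Function.update_apply]

@[simp] theorem State.setReg_arr (s : State) (i x : ℕ) : (s.setReg i x).arr = s.arr := rfl

@[simp] theorem State.setArr_reg (s : State) (a j x : ℕ) : (s.setArr a j x).reg = s.reg := rfl

@[simp] theorem State.setArr_arr (s : State) (a j x b : ℕ) :
    (s.setArr a j x).arr b = if b = a then Function.update (s.arr a) j x else s.arr b := by
  simp [State.setArr, Function.update_apply]

/-- `c.writesReg i` says whether the program text of `c` contains an assignment to register `i`. -/
def Prog.writesReg (i : ℕ) : Prog → Bool
  | .skip => false
  | .assign j _ => i == j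
  | .put _ _ _ => false
  | .seq c₁ c₂ => c₁.writesReg i || c₂.writesReg i
  | .cond _ c₁ c₂ => c₁.writesReg i || c₂.writesReg i
  | .loop _ c => c.writesReg i

/-- `c.writesArr a` says whether the program text of `c` contains a write to array `a`. -/
def Prog.writesArr (a : ℕ) : Prog → Bool
  | .skip => false
  | .assign _ _ => false
  | .put b _ _ => a == b
  | .seq c₁ c₂ => c₁.writesArr a || c₂.writesArr a
  | .cond _ c₁ c₂ => c₁.writesArr a || c₂.writesArr a
  | .loop _ c => c.writesArr a

/-- The states agree on everything that `c` does not write. -/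
def Frame (c : Prog) (s s' : State) : Prop :=
  (∀ i, c.writesReg i = false → s'.reg i = s.reg i) ∧
    ∀ a, c.writesArr a = false → s'.arr a = s.arr a

theorem Frame.refl (c : Prog) (s : State) : Frame c s s := ⟨fun _ _ => rfl, fun _ _ => rfl⟩

theorem Frame.trans {c : Prog} {s₁ s₂ s₃ : State} (h₁ : Frame c s₁ s₂) (h₂ : Frame c s₂ s₃) :
    Frame c s₁ s₃ :=
  ⟨fun i h => (h₂.1 i h).trans (h₁.1 i h), fun a h => (h₂.2 a h).trans (h₁.2 a h)⟩

theorem Frame.mono {c c' : Prog} {s s' : State} (h : Frame c s s')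
    (hr : ∀ i, c'.writesReg i = false → c.writesReg i = false)
    (ha : ∀ a, c'.writesArr a = false → c.writesArr a = false) : Frame c' s s' :=
  ⟨fun i hi => h.1 i (hr i hi), fun a hi => h.2 a (ha a hi)⟩

/-- Written cells are read off from the program text by a Boolean function, so for a concrete
program `decide` settles which registers and arrays survive. -/
theorem Exec.frame {μ : ℝ} {W : ℕ} {c : Prog} {s s' : State} {k : ℕ} (h : Exec μ W c s s' k) :
    Frame c s s' := by
  induction h with
  | skip s => exact Frame.refl _ _
  | assign s i e he =>
    refine ⟨fun j hj => ?_, fun _ _ => rfl⟩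
    have : j ≠ i := by simpa [Prog.writesReg] using hj
    simp [this]
  | put s a idx e h₁ h₂ =>
    refine ⟨fun _ _ => rfl, fun b hb => ?_⟩
    have : b ≠ a := by simpa [Prog.writesArr] using hb
    simp [this]
  | seq c₁ c₂ s₁ s₂ s₃ k₁ k₂ h₁ h₂ ih₁ ih₂ =>
    refine (ih₁.mono ?_ ?_).trans (ih₂.mono ?_ ?_) <;> intro i hi <;>
      simp [Prog.writesReg, Prog.writesArr] at hi <;> simp [hi]
  | condTrue e c₁ c₂ s₁ s₂ k he h ih =>
    refine ih.mono ?_ ?_ <;> intro i hi <;>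
      simp [Prog.writesReg, Prog.writesArr] at hi <;> simp [hi]
  | condFalse e c₁ c₂ s₁ s₂ k he h ih =>
    refine ih.mono ?_ ?_ <;> intro i hi <;>
      simp [Prog.writesReg, Prog.writesArr] at hi <;> simp [hi]
  | loopDone e c s he => exact Frame.refl _ _
  | loopStep e c s₁ s₂ s₃ k₁ k₂ he h₁ h₂ ih₁ ih₂ =>
    exact (ih₁.mono (fun i hi => hi) (fun i hi => hi)).trans ih₂

/-- Started in `s`, the program halts within `T` steps in a state that satisfies `Q`, writing only
numbers up to `W`. -/
def Runs (μ : ℝ) (W : ℕ) (c : Prog) (s : State) (T : ℕ) (Q : State → Prop) : Prop :=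
  ∃ s' k, Exec μ W c s s' k ∧ k ≤ T ∧ Q s'

variable {μ : ℝ} {W : ℕ}

theorem Runs.mono {c : Prog} {s : State} {T T' : ℕ} {Q Q' : State → Prop}
    (h : Runs μ W c s T Q) (hT : T ≤ T') (hQ : ∀ s', Q s' → Q' s') : Runs μ W c s T' Q' := by
  obtain ⟨s', k, h₁, h₂, h₃⟩ := h
  exact ⟨s', k, h₁, h₂.trans hT, hQ _ h₃⟩

theorem Runs.of_frame {c : Prog} {s : State} {T : ℕ} {Q Q' : State → Prop}
    (h : Runs μ W c s T Q) (hQ : ∀ s', Frame c s s' → Q s' → Q' s') : Runs μ W c s T Q' := by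
  obtain ⟨s', k, h₁, h₂, h₃⟩ := h
  exact ⟨s', k, h₁, h₂, hQ _ h₁.frame h₃⟩

theorem Runs.skip {s : State} {Q : State → Prop} {T : ℕ} (hQ : Q s) (hT : 1 ≤ T) :
    Runs μ W .skip s T Q :=
  ⟨s, 1, .skip s, hT, hQ⟩

theorem Runs.assign {i : ℕ} {e : Expr} {s : State} {Q : State → Prop} {T : ℕ}
    (he : e.eval μ s ≤ W) (hQ : Q (s.setReg i (e.eval μ s))) (hT : e.cost + 1 ≤ T) :
    Runs μ W (.assign i e) s T Q :=
  ⟨_, _, .assign s i e he, hT, hQ⟩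

theorem Runs.put {a : ℕ} {idx e : Expr} {s : State} {Q : State → Prop} {T : ℕ}
    (hidx : idx.eval μ s ≤ W) (he : e.eval μ s ≤ W)
    (hQ : Q (s.setArr a (idx.eval μ s) (e.eval μ s))) (hT : idx.cost + e.cost + 1 ≤ T) :
    Runs μ W (.put a idx e) s T Q :=
  ⟨_, _, .put s a idx e hidx he, hT, hQ⟩

/-- The postcondition of the first program is that the second one runs, so a proof steps through the
program from front to back without naming intermediate assertions. -/
theorem Runs.seq {c₁ c₂ : Prog} {s : State} {Q : State → Prop} {T₁ T₂ T : ℕ}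
    (h : Runs μ W c₁ s T₁ (fun s' => Runs μ W c₂ s' T₂ Q)) (hT : T₁ + T₂ ≤ T) :
    Runs μ W (.seq c₁ c₂) s T Q := by
  obtain ⟨s', k, h₁, h₂, s'', k', h₁', h₂', h₃⟩ := h
  exact ⟨s'', k + k', .seq _ _ _ _ _ _ _ h₁ h₁', by omega, h₃⟩

theorem Runs.cond {e : Expr} {c₁ c₂ : Prog} {s : State} {Q : State → Prop} {T T' : ℕ}
    (h₁ : e.eval μ s ≠ 0 → Runs μ W c₁ s T Q) (h₂ : e.eval μ s = 0 → Runs μ W c₂ s T Q)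
    (hT : e.cost + 1 + T ≤ T') : Runs μ W (.cond e c₁ c₂) s T' Q := by
  by_cases he : e.eval μ s = 0
  · obtain ⟨s', k, h₁, h₂, h₃⟩ := h₂ he
    exact ⟨s', _, .condFalse _ _ _ _ _ _ he h₁, by omega, h₃⟩
  · obtain ⟨s', k, h₁, h₂, h₃⟩ := h₁ he
    exact ⟨s', _, .condTrue _ _ _ _ _ _ he h₁, by omega, h₃⟩

/-- `for i < reg b do body`. -/
def forLoop (i b : ℕ) (body : Prog) : Prog :=
  .seq (.assign i (.const 0))
    (.loop (.lt (.reg i) (.reg b)) (.seq body (.assign i (.add (.reg i) (.const 1)))))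

@[simp] theorem writesReg_forLoop (j i b : ℕ) (body : Prog) :
    (forLoop i b body).writesReg j = (j == i || body.writesReg j) := by
  simp only [forLoop, Prog.writesReg]
  cases j == i <;> simp

@[simp] theorem writesArr_forLoop (a i b : ℕ) (body : Prog) :
    (forLoop i b body).writesArr a = body.writesArr a := by
  simp [forLoop, Prog.writesArr]

/-- Besides the body, a round costs 4 steps for the test and 4 for the increment; initialisation and
the last test cost 6. The frame hypotheses hand the caller all cells that the loop leaves alone, so
the invariant `I` mentions only what changes. -/
theorem Runs.forLoop {i b : ℕ} {body : Prog} {s : State} {m Tb T : ℕ} (I : ℕ → State → Prop)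
    {Q : State → Prop} (hm : s.reg b = m) (hmW : m ≤ W) (hib : b ≠ i)
    (hi : body.writesReg i = false) (hb : body.writesReg b = false)
    (h0 : I 0 (s.setReg i 0))
    (hstep : ∀ k < m, ∀ s', s'.reg i = k → Frame (forLoop i b body) s s' → I k s' →
      Runs μ W body s' Tb (fun s'' => I (k + 1) (s''.setReg i (k + 1))))
    (hend : ∀ s', s'.reg i = m → Frame (RAM.forLoop i b body) s s' → I m s' → Q s')
    (hT : m * (Tb + 8) + 6 ≤ T) : Runs μ W (RAM.forLoop i b body) s T Q := by
  -- Induction on the number j of remaining rounds.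
  have key : ∀ j k, j + k = m → ∀ s', s'.reg i = k → Frame (RAM.forLoop i b body) s s' → I k s' →
      Runs μ W (.loop (.lt (.reg i) (.reg b)) (.seq body (.assign i (.add (.reg i) (.const 1)))))
        s' (j * (Tb + 8) + 4) Q := by
    intro j
    induction j with
    | zero =>
      intro k hk s' hs' hf hI
      obtain rfl : k = m := by omega
      have hb' : s'.reg b = k := by rw [hf.1 b (by simp [hib, hb]), hm]
      refine ⟨s', _, .loopDone _ _ _ ?_, ?_, hend s' hs' hf hI⟩
      · simp [Expr.eval, hs', hb']
      · simp [Expr.cost]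
    | succ j ih =>
      intro k hk s' hs' hf hI
      have hb' : s'.reg b = m := by rw [hf.1 b (by simp [hib, hb]), hm]
      obtain ⟨s'', k₁, h₁, h₂, h₃⟩ := hstep k (by omega) s' hs' hf hI
      have hf₁ := h₁.frame
      have hr : s''.reg i = k := by rw [hf₁.1 i hi, hs']
      obtain ⟨s₃, k₂, h₄, h₅, h₆⟩ := ih (k + 1) (by omega) (s''.setReg i (k + 1)) (by simp)
        (hf.trans ((hf₁.mono (by simp) (by simp)).trans
          ⟨fun j hj => by simp at hj; simp [hj.1], fun _ _ => rfl⟩)) h₃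
      refine ⟨s₃, _, .loopStep _ _ _ (s''.setReg i (k + 1)) _ (k₁ + 4) k₂ ?_
        (.seq _ _ _ s'' _ _ _ h₁ ?_) h₄, ?_, h₆⟩
      · have hkm : k < m := by omega
        simp [Expr.eval, hs', hb', hkm]
      · have := Exec.assign (μ := μ) (W := W) s'' i (.add (.reg i) (.const 1))
          (by simp [Expr.eval, hr]; omega)
        simpa [Expr.eval, Expr.cost, hr] using this
      · simp only [Expr.cost]
        nlinarith
  refine Runs.seq (T₁ := 2) (T₂ := m * (Tb + 8) + 4) (Runs.assign (by simp [Expr.eval]) ?_ (by simp [Expr.cost])) (by omega)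
  refine key m 0 (by omega) _ (by simp [Expr.eval]) ?_ (by simpa [Expr.eval] using h0)
  exact ⟨fun j hj => by simp at hj; simp [hj.1], fun _ _ => rfl⟩

end RAM

namespace RAM

/-! ## Computing distances -/

/-- Condition: vertex `reg 12` is adjacent to vertex `reg 11`, has distance exactly `reg 8`, and
vertex `reg 11` has not been reached. -/
def distTest (a : ℕ) : Expr :=
  .mul (.mul (.mul (.get 0 (.add (.mul (.reg 12) (.reg 0)) (.reg 11)))
    (.lt (.get a (.reg 12)) (.add (.reg 8) (.const 2)))) (.lt (.reg 8) (.get a (.reg 12))))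
    (.lt (.get a (.reg 11)) (.const 1))

/-- Store in array `a` the numbers `dist x v + 1`, where `x` is the vertex in register `sr`. -/
def distProg (a sr : ℕ) : Prog :=
  .seq (.put a (.reg sr) (.const 1))
    (forLoop 8 0 (forLoop 11 0 (forLoop 12 0
      (.cond (distTest a) (.put a (.reg 11) (.add (.reg 8) (.const 2))) .skip))))

/-- The registers and arrays of `s` hold the graph `G`. -/
def HoldsGraph {n : ℕ} (G : SimpleGraph (Fin n)) (s : State) : Prop :=
  s.reg 0 = n ∧ ∀ u v : Fin n, s.arr 0 ((u : ℕ) * n + v) ≠ 0 ↔ G.Adj u v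

variable {μ : ℝ} {W n : ℕ} {G : SimpleGraph (Fin n)}

theorem HoldsGraph.of_eq {s s' : State} (h : HoldsGraph G s) (h₁ : s'.reg 0 = s.reg 0)
    (h₂ : s'.arr 0 = s.arr 0) : HoldsGraph G s' := by
  simpa [HoldsGraph, h₁, h₂] using h

theorem dist_lt_of_connected (hG : G.Connected) (u v : Fin n) : G.dist u v < n := by
  obtain ⟨w, hp, hw⟩ := hG.exists_path_of_dist u v
  rw [← hw]
  simpa using hp.length_lt

theorem exists_adj_of_dist_eq_succ {V : Type*} {G : SimpleGraph V} (hG : G.Connected) {x w : V}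
    {r : ℕ} (h : G.dist x w = r + 1) : ∃ v, G.Adj v w ∧ G.dist x v = r := by
  obtain ⟨p, hp⟩ := hG.exists_walk_length_eq_dist x w
  have hlen : p.length = r + 1 := by omega
  have hadj : G.Adj (p.getVert r) w := by
    have := p.adj_getVert_succ (i := r) (by omega)
    rwa [← hlen, p.getVert_length] at this
  refine ⟨p.getVert r, hadj, ?_⟩
  have h₁ : G.dist x (p.getVert r) ≤ r := by
    have := SimpleGraph.dist_le (p.take r)
    rw [SimpleGraph.Walk.take_length] at this
    omega
  have h₂ := hG.dist_triangle (u := x) (v := p.getVert r) (w := w)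
  rw [(SimpleGraph.dist_eq_one_iff_adj).2 hadj] at h₂
  omega

/-- Array contents during the computation of distances from `x`. -/
def DistInv (G : SimpleGraph (Fin n)) (x : Fin n) (r u : ℕ) (A : ℕ → ℕ) : Prop :=
  ∀ w : Fin n, A w = if G.dist x w ≤ r ∨ (G.dist x w = r + 1 ∧ (w : ℕ) < u)
    then G.dist x w + 1 else 0

open Classical in
-- Cell u is filled at the first neighbour of distance r, and the test that u is unreached blocks
-- later ones. The scan finds every u of distance r + 1, since the last vertex before u on a
-- shortest path has distance r.
theorem distProg_inner {a : ℕ} (ha : a ≠ 0) (hW : n + 1 ≤ W)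
    (hG : G.Connected) (x : Fin n) {r : ℕ} (u : Fin n) (hr : r < n) {s : State}
    (hs : HoldsGraph G s) (h8 : s.reg 8 = r) (h11 : s.reg 11 = u)
    (hI : DistInv G x r u (s.arr a)) :
    Runs μ W (forLoop 12 0
      (.cond (distTest a) (.put a (.reg 11) (.add (.reg 8) (.const 2))) .skip)) s
      (n * (40 + 8) + 6) (fun s' => DistInv G x r (u + 1) (s'.arr a)) := by
  let I : ℕ → State → Prop := fun k s' =>
    (∀ w : Fin n, w ≠ u → s'.arr a w = s.arr a w) ∧
    s'.arr a u = if G.dist x u ≤ r ∨ (G.dist x u = r + 1 ∧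
      ∃ v : Fin n, (v : ℕ) < k ∧ G.Adj v u ∧ G.dist x v = r) then G.dist x u + 1 else 0
  refine Runs.forLoop (m := n) (Tb := 40) I hs.1 (by omega) (by simp) (by simp [Prog.writesReg])
    (by simp [Prog.writesReg]) ?_ ?_ ?_ le_rfl
  · refine ⟨fun w _ => rfl, ?_⟩
    simpa using hI u
  · rintro k hk s' hk' hf ⟨hI₁, hI₂⟩
    have h0' : s'.reg 0 = n := by rw [hf.1 0 (by simp [Prog.writesReg])]; exact hs.1
    have ha0 : s'.arr 0 = s.arr 0 := hf.2 0 (by simp [Prog.writesArr, ha.symm])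
    have h8' : s'.reg 8 = r := by rw [hf.1 8 (by simp [Prog.writesReg]), h8]
    have h11' : s'.reg 11 = u := by rw [hf.1 11 (by simp [Prog.writesReg]), h11]
    obtain ⟨v, rfl⟩ : ∃ v : Fin n, (v : ℕ) = k := ⟨⟨k, hk⟩, rfl⟩
    have hadj : s'.arr 0 ((v : ℕ) * n + u) ≠ 0 ↔ G.Adj v u := by
      rw [ha0]; exact hs.2 v u
    -- Entries r + 2 written earlier in this round do no harm, as the test asks for exactly r + 1.
    -- Adjacency excludes v = u, the only cell that may have changed during the scan.
    have hAv : G.Adj v u → (s'.arr a v = r + 1 ↔ G.dist x v = r) := by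
      intro h
      rw [hI₁ v h.ne, hI v]
      split_ifs with h'
      · omega
      · rw [not_or] at h'
        exact ⟨fun h'' => h''.elim, fun h'' => (h'.1 h''.le).elim⟩
    have htest : (distTest a).eval μ s' ≠ 0 ↔
        G.Adj v u ∧ G.dist x v = r ∧ s'.arr a u = 0 := by
      simp only [distTest, Expr.eval, h0', h8', h11', hk', mul_ne_zero_iff, hadj]
      constructor
      · rintro ⟨⟨⟨h₁, h₂⟩, h₃⟩, h₄⟩
        simp at h₂ h₃ h₄
        exact ⟨h₁, (hAv h₁).1 (by omega), by omega⟩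
      · rintro ⟨h₁, h₂, h₃⟩
        have := (hAv h₁).2 h₂
        simp [h₁, this, h₃]
    refine Runs.cond (T := 8) ?_ ?_ (by simp [distTest, Expr.cost])
    · intro h
      obtain ⟨h₁, h₂, h₃⟩ := htest.1 h
      refine Runs.put (by simp [Expr.eval, h11']; omega) (by simp [Expr.eval, h8']; omega) ?_
        (by simp [Expr.cost])
      have hle : G.dist x u ≤ r + 1 := by
        have := hG.dist_triangle (u := x) (v := v) (w := u)
        rw [(SimpleGraph.dist_eq_one_iff_adj).2 h₁] at this
        omega
      have hgt : ¬ G.dist x u ≤ r := by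
        intro hle'
        rw [hI₂, if_pos (Or.inl hle')] at h₃
        omega
      refine ⟨fun w hw => ?_, ?_⟩
      · have : (w : ℕ) ≠ u := fun h => hw (Fin.ext h)
        simp [Expr.eval, h11', this, hI₁ w hw]
      · simp only [State.setReg_arr, State.setArr_arr, Expr.eval, h11', h8', if_true,
          Function.update_self]
        rw [if_pos]
        · omega
        · exact Or.inr ⟨by omega, v, by simp, h₁, h₂⟩
    · intro h
      refine Runs.skip ?_ (by simp)
      have hn : ¬ (G.Adj v u ∧ G.dist x v = r ∧ s'.arr a u = 0) := fun h' => htest.2 h' h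
      refine ⟨fun w hw => by simpa using hI₁ w hw, ?_⟩
      simp only [State.setReg_arr]
      rw [hI₂]
      by_cases hd : G.dist x u ≤ r
      · simp [hd]
      by_cases hd' : ∃ w : Fin n, (w : ℕ) < v ∧ G.Adj w u ∧ G.dist x w = r
      · obtain ⟨v', hv', h'⟩ := hd'
        have e₁ : ∃ w : Fin n, (w : ℕ) < v ∧ G.Adj w u ∧ G.dist x w = r := ⟨v', hv', h'⟩
        have e₂ : ∃ w : Fin n, (w : ℕ) < (v : ℕ) + 1 ∧ G.Adj w u ∧ G.dist x w = r :=
          ⟨v', by omega, h'⟩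
        simp only [e₁, e₂]
      · have hd₁ : ¬ (G.dist x u ≤ r ∨ G.dist x u = r + 1 ∧
            ∃ w : Fin n, (w : ℕ) < v ∧ G.Adj w u ∧ G.dist x w = r) :=
          fun h => h.elim hd fun h => hd' h.2
        rw [if_neg hd₁] at hI₂
        rw [if_neg hd₁, if_neg]
        rintro (h' | ⟨h', v', hv', h₁, h₂⟩)
        · exact hd h'
        · by_cases hvk : (v' : ℕ) = v
          · obtain rfl : v' = v := Fin.ext hvk
            exact hn ⟨h₁, h₂, hI₂⟩
          · exact hd' ⟨v', by omega, h₁, h₂⟩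
  · rintro s' - - ⟨hI₁, hI₂⟩ w
    by_cases hw : w = u
    · rw [hw, hI₂]
      refine if_congr (or_congr_right (and_congr_right fun h => ?_)) rfl rfl
      obtain ⟨v, hv⟩ := exists_adj_of_dist_eq_succ hG h
      exact ⟨fun _ => by omega, fun _ => ⟨v, v.2, hv⟩⟩
    · have : (w : ℕ) ≠ u := fun h => hw (Fin.ext h)
      rw [hI₁ w hw, hI w]
      have h' : (w : ℕ) < u ↔ (w : ℕ) < u + 1 := by omega
      simp only [h']

/-- Round r fills the layer of distance r + 1; n rounds suffice because distances in a connected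
graph are below n. -/
theorem distProg_runs {a sr : ℕ} (ha : a ≠ 0) (hW : n + 1 ≤ W)
    (hG : G.Connected) (x : Fin n) {s : State} (hs : HoldsGraph G s) (hx : s.reg sr = x)
    (hzero : ∀ j, s.arr a j = 0) :
    Runs μ W (distProg a sr) s (100 * n ^ 3 + 9)
      (fun s' => ∀ w : Fin n, s'.arr a w = G.dist x w + 1) := by
  have hn : 0 < n := x.pos
  refine Runs.seq (T₁ := 3) (T₂ := n * (n * (n * (40 + 8) + 6 + 8) + 6 + 8) + 6)
    (Runs.put (by simp [Expr.eval, hx]; omega) (by simp [Expr.eval]; omega) ?_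
      (by simp [Expr.cost])) ?_
  · refine Runs.forLoop (m := n) (fun r s' => DistInv G x r 0 (s'.arr a)) (by simpa using hs.1)
      (by omega) (by simp) (by simp [Prog.writesReg]) (by simp [Prog.writesReg]) ?_ ?_ ?_ le_rfl
    · intro w
      simp only [Expr.eval, State.setReg_arr, State.setArr_arr, if_true, hx, not_lt_zero,
        and_false, or_false, Nat.le_zero, hG.dist_eq_zero_iff, Function.update_apply, hzero]
      by_cases hw : w = x
      · simp [hw]
      · have : (w : ℕ) ≠ x := fun h => hw (Fin.ext h)
        simp [this, Ne.symm hw]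
    · intro r hr s' hr' hf hI
      have hs' : HoldsGraph G s' := by
        refine hs.of_eq ?_ ?_
        · rw [hf.1 0 (by simp [Prog.writesReg])]; simp
        · rw [hf.2 0 (by simp [Prog.writesArr, ha.symm])]; simp [ha.symm]
      refine Runs.forLoop (m := n) (fun u s' => DistInv G x r u (s'.arr a)) hs'.1
        (by omega) (by simp) (by simp [Prog.writesReg]) (by simp [Prog.writesReg]) ?_ ?_ ?_ le_rfl
      · simpa using hI
      · intro u hu s'' hu' hf' hI'
        refine (distProg_inner ha hW hG x ⟨u, hu⟩ hr (hs'.of_eq ?_ ?_) ?_ hu' hI').mono le_rfl ?_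
        · exact hf'.1 0 (by simp [Prog.writesReg])
        · exact hf'.2 0 (by simp [Prog.writesArr, ha.symm])
        · rw [hf'.1 8 (by simp [Prog.writesReg]), hr']
        · intro s₃ h; simpa using h
      · intro s'' _ _ h w
        simp only [State.setReg_arr]
        rw [h w]
        -- Once u has run up to n, the restriction on w is void, and the invariant of round r is the
        -- initial one of round r + 1.
        have h' : (G.dist x w ≤ r ∨ G.dist x w = r + 1 ∧ (w : ℕ) < n) ↔
          (G.dist x w ≤ r + 1 ∨ G.dist x w = r + 1 + 1 ∧ (w : ℕ) < 0) := by
          have := w.2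
          omega
        simp only [h']
    · intro s' _ _ h w
      rw [h w, if_pos]
      left
      exact (dist_lt_of_connected hG x w).le
  · have h₁ : n ≤ n ^ 3 := Nat.le_self_pow (by simp) n
    have h₂ : n ^ 2 ≤ n ^ 3 := Nat.pow_le_pow_right hn (by simp)
    ring_nf
    omega

end RAM

/-! ### Breadth-first search outside a removed set, and its program -/

open Classical in
/-- One step of breadth-first search in `G` outside `D`: given the queue and the set of marked
vertices, mark the neighbours of `v` and append those that are new and not in `D` to the queue. -/
noncomputable def bfsStep {n : ℕ} (G : SimpleGraph (Fin n)) (D : Finset (Fin n)) (v : Fin n)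
    (q : List (Fin n) × Finset (Fin n)) : List (Fin n) × Finset (Fin n) :=
  (q.1 ++ (List.finRange n).filter (fun u => G.Adj v u ∧ u ∉ q.2 ∧ u ∉ D),
    q.2 ∪ Finset.univ.filter (fun u => G.Adj v u))

/-- Queue and marked set of breadth-first search from `x` in `G` outside `D`, after processing the
first `h` elements of the queue. -/
noncomputable def bfs {n : ℕ} (G : SimpleGraph (Fin n)) (D : Finset (Fin n)) (x : Fin n) :
    ℕ → List (Fin n) × Finset (Fin n)
  | 0 => ([x], {x})
  | h + 1 => match (bfs G D x h).1[h]? with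
    | none => bfs G D x h
    | some v => bfsStep G D v (bfs G D x h)

namespace RAM

variable {μ : ℝ} {W n : ℕ} {G : SimpleGraph (Fin n)}

/-- Condition: the vertex in register `11` belongs to the removed set. -/
def removedTest : Expr :=
  .mul (.mul (.lt (.add (.get 4 (.reg 11)) (.get 5 (.reg 11)))
      (.add (.add (.reg 4) (.reg 5)) (.const 2)))
    (.lt (.reg 4) (.mul (.const 4) (.sub (.get 4 (.reg 11)) (.const 1)))))
    (.lt (.reg 4) (.mul (.const 4) (.sub (.get 5 (.reg 11)) (.const 1))))

/-- Process vertex `reg 11` as a possible neighbour of vertex `reg 12`. -/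
def scanBody : Prog :=
  .cond (.mul (.get 0 (.add (.mul (.reg 12) (.reg 0)) (.reg 11))) (.lt (.get 3 (.reg 11)) (.const 1)))
    (.seq (.put 3 (.reg 11) (.const 1)) (.seq (.assign 10 (.add (.reg 10) (.const 1)))
      (.cond removedTest .skip
        (.seq (.put 2 (.reg 9) (.reg 11)) (.assign 9 (.add (.reg 9) (.const 1)))))))
    .skip

/-- Breadth-first search from the vertex in register `3`. -/
def bfsProg : Prog :=
  .seq (forLoop 11 0 (.put 3 (.reg 11) (.const 0)))
  (.seq (.put 2 (.const 0) (.reg 3))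
  (.seq (.put 3 (.reg 3) (.const 1))
  (.seq (.assign 9 (.const 1))
  (.seq (.assign 10 (.const 1))
  (forLoop 8 0 (.cond (.lt (.reg 8) (.reg 9))
    (.seq (.assign 12 (.get 2 (.reg 8)))
    (.seq (forLoop 11 0 scanBody)
    (.put 6 (.reg 8) (.sub (.reg 10) (.add (.reg 8) (.const 1))))))
    .skip))))))

/-- The set removed from the graph is given by the arrays `4`, `5` and the registers `4`, `5`. -/
def HoldsRemoved (D : Finset (Fin n)) (s : State) : Prop :=
  ∀ u : Fin n, u ∈ D ↔ s.arr 4 u + s.arr 5 u < s.reg 4 + s.reg 5 + 2 ∧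
    s.reg 4 < 4 * (s.arr 4 u - 1) ∧ s.reg 4 < 4 * (s.arr 5 u - 1)

theorem HoldsRemoved.of_eq {D : Finset (Fin n)} {s s' : State} (h : HoldsRemoved D s)
    (h₁ : s'.reg 4 = s.reg 4) (h₂ : s'.reg 5 = s.reg 5) (h₃ : s'.arr 4 = s.arr 4)
    (h₄ : s'.arr 5 = s.arr 5) : HoldsRemoved D s' := by
  simpa [HoldsRemoved, h₁, h₂, h₃, h₄] using h

theorem HoldsRemoved.eval_removedTest {D : Finset (Fin n)} {s : State} (h : HoldsRemoved D s)
    {u : Fin n} (hu : s.reg 11 = u) : removedTest.eval μ s ≠ 0 ↔ u ∈ D := by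
  rw [h u]
  simp [removedTest, Expr.eval, hu]
  tauto

/-- The state holds the queue `q.1` and the marked set `q.2`. -/
def HoldsQueue (q : List (Fin n) × Finset (Fin n)) (s : State) : Prop :=
  (∀ (i : ℕ) (u : Fin n), q.1[i]? = some u → s.arr 2 i = u) ∧ s.reg 9 = q.1.length ∧
    (∀ u : Fin n, s.arr 3 u = if u ∈ q.2 then 1 else 0) ∧ s.reg 10 = q.2.card ∧
    q.1.Nodup ∧ ∀ u ∈ q.1, u ∈ q.2

theorem HoldsQueue.of_eq {q : List (Fin n) × Finset (Fin n)} {s s' : State} (h : HoldsQueue q s)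
    (h₁ : s'.reg 9 = s.reg 9) (h₂ : s'.reg 10 = s.reg 10) (h₃ : s'.arr 2 = s.arr 2)
    (h₄ : s'.arr 3 = s.arr 3) : HoldsQueue q s' := by
  simpa [HoldsQueue, h₁, h₂, h₃, h₄] using h

open Classical in
-- A new vertex of the removed set is marked and counted but not queued. Thus register 10 also
-- counts the boundary vertices inside D.
theorem scanBody_runs (hW : n ≤ W) {D : Finset (Fin n)} {l : List (Fin n)}
    {M : Finset (Fin n)} {s : State} {u v : Fin n} (hs : HoldsGraph G s) (hD : HoldsRemoved D s)
    (hq : HoldsQueue (l, M) s) (hu : s.reg 11 = u) (hv : s.reg 12 = v) :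
    Runs μ W scanBody s 70
      (HoldsQueue (l ++ if G.Adj v u ∧ u ∉ M ∧ u ∉ D then [u] else [],
        if G.Adj v u then insert u M else M)) := by
  obtain ⟨h₁, h₂, h₃, h₄, h₅, h₆⟩ := hq
  have hadj := hs.2 v u
  -- Queued vertices are distinct and marked, so an unmarked vertex leaves room: counter and queue
  -- end remain at most n.
  have hcard : l.length ≤ M.card := by
    rw [← List.toFinset_card_of_nodup h₅]
    exact Finset.card_le_card fun w hw => h₆ w (by simpa using hw)
  have hlt : u ∉ M → M.card < n := fun h => by
    have := Finset.card_lt_univ_of_notMem h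
    simpa using this
  have hnul : u ∉ M → u ∉ l := fun h h' => h (h₆ _ h')
  have hun := u.2
  refine Runs.cond (T := 55) ?_ ?_ (by simp [Expr.cost])
  · intro h
    simp [Expr.eval, hs.1, hu, hv, hadj] at h
    obtain ⟨hm, ha⟩ := h
    have hM : u ∉ M := by
      intro h'
      rw [h₃, if_pos h'] at hm
      omega
    rw [if_pos ha]
    refine Runs.seq (T₁ := 3) (T₂ := 50) (Runs.put (by simp [Expr.eval, hu]; omega)
      (by simp [Expr.eval]; omega) ?_ (by simp [Expr.cost])) (by simp)
    refine Runs.seq (T₁ := 4) (T₂ := 45) (Runs.assign (by simp [Expr.eval, h₄]; have := hlt hM; omega) ?_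
      (by simp [Expr.cost])) (by simp)
    refine Runs.cond (T := 10) ?_ ?_ (by simp [removedTest, Expr.cost])
    · intro h
      rw [HoldsRemoved.eval_removedTest (u := u) (hD.of_eq (by simp) (by simp) (by simp) (by simp))
        (by simp [hu])] at h
      refine Runs.skip ?_ (by simp)
      rw [if_neg (by tauto)]
      refine ⟨by simpa [Expr.eval] using h₁, by simpa [Expr.eval] using h₂, ?_, ?_, by simpa, ?_⟩
      · intro w
        by_cases hw : w = u
        · simp [Expr.eval, hu, hw]
        · have : (w : ℕ) ≠ u := fun h => hw (Fin.ext h)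
          simp [Expr.eval, hu, this, hw, h₃]
      · simp [Expr.eval, Finset.card_insert_of_notMem hM, h₄]
      · intro w hw
        simp at hw
        simp [h₆ w hw]
    · intro h
      have hd : u ∉ D := fun h' => absurd h ((HoldsRemoved.eval_removedTest (u := u)
        (hD.of_eq (by simp) (by simp) (by simp) (by simp)) (by simp [hu])).2 h')
      have hl := hlt hM
      refine Runs.seq (T₁ := 3) (T₂ := 4) (Runs.put (by simp [Expr.eval, h₂]; omega)
        (by simp [Expr.eval, hu]; omega) ?_ (by simp [Expr.cost])) (by simp)
      refine Runs.assign (by simp [Expr.eval, h₂]; omega) ?_ (by simp [Expr.cost])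
      rw [if_pos ⟨ha, hM, hd⟩]
      refine ⟨?_, by simp [Expr.eval, h₂], ?_, ?_, ?_, ?_⟩
      · intro i w hw
        simp only [Expr.eval, State.setReg_arr, State.setArr_arr, if_true, State.setReg_reg,
          State.setArr_reg, Function.update_apply]
        rw [List.getElem?_append] at hw
        by_cases hi : i < l.length
        · rw [if_pos hi] at hw
          simpa [hi.ne, h₂] using h₁ i w hw
        · rw [if_neg hi, List.getElem?_singleton] at hw
          split_ifs at hw with h0
          simp only [Option.some.injEq] at hw
          have : i = l.length := by omega
          simp [this, h₂, hu, hw]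
      · intro w
        by_cases hw : w = u
        · simp [Expr.eval, hu, hw]
        · have : (w : ℕ) ≠ u := fun h => hw (Fin.ext h)
          simp [Expr.eval, hu, this, hw, h₃]
      · simp [Expr.eval, Finset.card_insert_of_notMem hM, h₄]
      · exact List.nodup_append.2 ⟨h₅, by simp, by
          intro a ha b hb
          simp at hb
          rintro rfl
          exact hnul hM (hb ▸ ha)⟩
      · intro w hw
        simp at hw
        rcases hw with hw | hw
        · simp [h₆ w hw]
        · simp [hw]
  · intro h
    simp only [Expr.eval, hs.1, hu, hv] at h
    have hor : ¬ G.Adj v u ∨ u ∈ M := by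
      by_contra hcon
      push Not at hcon
      have h3 := h₃ u
      rw [if_neg hcon.2] at h3
      simp [h3] at h
      exact hadj.2 hcon.1 h
    refine Runs.skip ?_ (by simp)
    rw [if_neg (by tauto), List.append_nil]
    rcases hor with h' | h'
    · rw [if_neg h']
      exact ⟨h₁, h₂, h₃, h₄, h₅, h₆⟩
    · rw [Finset.insert_eq_of_mem h', ite_self]
      exact ⟨h₁, h₂, h₃, h₄, h₅, h₆⟩

open Classical in
theorem scan_runs (hW : n ≤ W) {D : Finset (Fin n)} {q : List (Fin n) × Finset (Fin n)}
    {s : State} {v : Fin n} (hs : HoldsGraph G s) (hD : HoldsRemoved D s)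
    (hq : HoldsQueue q s) (hv : s.reg 12 = v) :
    Runs μ W (forLoop 11 0 scanBody) s (n * (70 + 8) + 6) (HoldsQueue (bfsStep G D v q)) := by
  obtain ⟨l, M⟩ := q
  let L : ℕ → List (Fin n) := fun k =>
    l ++ ((List.finRange n).take k).filter (fun u => G.Adj v u ∧ u ∉ M ∧ u ∉ D)
  let N : ℕ → Finset (Fin n) := fun k =>
    M ∪ Finset.univ.filter (fun u => G.Adj v u ∧ (u : ℕ) < k)
  refine Runs.forLoop (m := n) (fun k s' => HoldsQueue (L k, N k) s') hs.1 hW (by simp)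
    (by decide) (by decide) ?_ ?_ ?_ le_rfl
  · have h1 : L 0 = l := by simp [L]
    have h2 : N 0 = M := by simp [N]
    rw [h1, h2]
    exact hq.of_eq (by simp) (by simp) (by simp) (by simp)
  · intro k hk s' hk' hf hI
    obtain ⟨u, rfl⟩ : ∃ u : Fin n, (u : ℕ) = k := ⟨⟨k, hk⟩, rfl⟩
    refine (scanBody_runs hW (hs.of_eq (hf.1 0 (by decide)) (hf.2 0 (by decide)))
      (hD.of_eq (hf.1 4 (by decide)) (hf.1 5 (by decide)) (hf.2 4 (by decide)) (hf.2 5 (by decide)))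
      hI hk' ((hf.1 12 (by decide)).trans hv)).mono le_rfl ?_
    intro s'' h
    -- The machine tests against the current marks, `bfsStep` against those before the scan. They
    -- agree at u, because the scan touches each vertex once.
    have hu : u ∉ N u ↔ u ∉ M := by simp [N]
    have h1 : L (u + 1) = L u ++ if G.Adj v u ∧ u ∉ M ∧ u ∉ D then [u] else [] := by
      simp only [L, List.append_assoc]
      rw [List.take_add_one, List.filter_append]
      congr 2
      have : (List.finRange n)[(u : ℕ)]? = some u := by simp
      rw [this]
      simp [List.filter_cons]
    have h2 : N (u + 1) = if G.Adj v u then insert u (N u) else N u := by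
      ext w
      have : (w : ℕ) < u + 1 ↔ w = u ∨ (w : ℕ) < u := by
        rw [Fin.ext_iff]; omega
      split_ifs with ha
      · simp only [N, Finset.mem_union, Finset.mem_filter, Finset.mem_univ, true_and, this,
          Finset.mem_insert]
        by_cases hw : w = u
        · simp [hw, ha]
        · simp [hw]
      · simp only [N, Finset.mem_union, Finset.mem_filter, Finset.mem_univ, true_and, this]
        by_cases hw : w = u
        · simp [hw, ha]
        · simp [hw]
    simp only [hu] at h
    rw [h1, h2]
    exact h.of_eq (by simp) (by simp) (by simp) (by simp)
  · intro s' _ _ hI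
    have : (L n, N n) = bfsStep G D v (l, M) := by
      simp [L, N, bfsStep, List.take_of_length_le]
    rwa [this] at hI

/-- Each of the n rounds scans one row of the matrix, or does nothing once the queue is exhausted.
Array 6 records marked minus processed vertices, which is the boundary size of the processed prefix
(`card_nodeBoundary_bfsPrefix`). -/
theorem bfsProg_runs (hW : n ≤ W) {D : Finset (Fin n)} {s : State} {x : Fin n}
    (hs : HoldsGraph G s) (hD : HoldsRemoved D s) (hx : s.reg 3 = x) :
    Runs μ W bfsProg s (200 * n ^ 2 + 20) (fun s' => HoldsQueue (bfs G D x n) s' ∧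
      ∀ i < n, i < (bfs G D x i).1.length →
        s'.arr 6 i = (bfs G D x (i + 1)).2.card - (i + 1)) := by
  have hn := x.pos
  have hxn := x.2
  refine Runs.seq (T₁ := n * (3 + 8) + 6) (T₂ := n * ((n * (70 + 8) + 6 + 22) + 8) + 6 + 11) (Runs.forLoop (m := n)
    (fun k s' => ∀ i < k, s'.arr 3 i = 0) hs.1 hW (by simp) (by decide) (by decide) (by simp)
    ?_ ?_ le_rfl) ?_
  · intro k hk s' hk' hf hI
    refine Runs.put (by simp [Expr.eval]; omega) (by simp [Expr.eval]) ?_ (by simp [Expr.cost])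
    intro i hi
    by_cases h : i = k
    · simp [Expr.eval, hk', h]
    · simp [Expr.eval, hk', h, hI i (by omega)]
  · intro s₁ h11 hf h0
    have hs₁ := hs.of_eq (hf.1 0 (by decide)) (hf.2 0 (by decide))
    have hD₁ := hD.of_eq (hf.1 4 (by decide)) (hf.1 5 (by decide)) (hf.2 4 (by decide))
      (hf.2 5 (by decide))
    have hx₁ : s₁.reg 3 = x := (hf.1 3 (by decide)).trans hx
    refine Runs.seq (T₁ := 3) (T₂ := n * ((n * (70 + 8) + 6 + 22) + 8) + 6 + 8) (Runs.put (by simp [Expr.eval])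
      (by simp [Expr.eval, hx₁]; omega) ?_ (by simp [Expr.cost])) (by omega)
    refine Runs.seq (T₁ := 3) (T₂ := n * ((n * (70 + 8) + 6 + 22) + 8) + 6 + 4) (Runs.put (by simp [Expr.eval, hx₁]; omega)
      (by simp [Expr.eval]; omega) ?_ (by simp [Expr.cost])) (by omega)
    refine Runs.seq (T₁ := 2) (T₂ := n * ((n * (70 + 8) + 6 + 22) + 8) + 6 + 2) (Runs.assign
      (by simp [Expr.eval]; omega) ?_ (by simp [Expr.cost])) (by omega)
    refine Runs.seq (T₁ := 2) (T₂ := n * ((n * (70 + 8) + 6 + 22) + 8) + 6) (Runs.assign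
      (by simp [Expr.eval]; omega) ?_ (by simp [Expr.cost])) (by omega)
    refine Runs.forLoop (m := n) (fun h s' => HoldsQueue (bfs G D x h) s' ∧
      ∀ i < h, i < (bfs G D x i).1.length →
        s'.arr 6 i = (bfs G D x (i + 1)).2.card - (i + 1)) (by simpa using hs₁.1) hW (by simp)
      (by decide) (by decide) ?_ ?_ (fun s' _ _ h => h) le_rfl
    · refine ⟨⟨?_, by simp [bfs, Expr.eval], ?_, by simp [bfs, Expr.eval], by simp [bfs],
        by simp [bfs]⟩, by simp⟩
      · intro i u hu
        simp only [bfs, List.getElem?_singleton] at hu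
        split_ifs at hu with h
        simp only [Option.some.injEq] at hu
        simp [Expr.eval, h, hx₁, hu]
      · intro u
        by_cases hu : u = x
        · simp [Expr.eval, hx₁, hu, bfs]
        · have : (u : ℕ) ≠ x := fun h => hu (Fin.ext h)
          simp [Expr.eval, hx₁, this, hu, bfs, h0 u u.2]
    · rintro h hh s' hk' hf' ⟨hq, hb⟩
      have hs' : HoldsGraph G s' := hs₁.of_eq (by rw [hf'.1 0 (by decide)]; simp)
        (by rw [hf'.2 0 (by decide)]; simp)
      have hD' : HoldsRemoved D s' := hD₁.of_eq (by rw [hf'.1 4 (by decide)]; simp)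
        (by rw [hf'.1 5 (by decide)]; simp) (by rw [hf'.2 4 (by decide)]; simp)
        (by rw [hf'.2 5 (by decide)]; simp)
      refine Runs.cond (T := n * (70 + 8) + 6 + 16) ?_ ?_ (by simp [Expr.cost]; omega)
      · intro hc
        simp [Expr.eval, hk', hq.2.1] at hc
        set v := (bfs G D x h).1[h] with hv
        have hget : (bfs G D x h).1[h]? = some v := by simp [hv]
        have hqv := hq.1 h v hget
        have hvn := v.2
        have hstep : bfs G D x (h + 1) = bfsStep G D v (bfs G D x h) := by
          simp only [bfs, hget]
        refine Runs.seq (T₁ := 3) (T₂ := n * (70 + 8) + 6 + 9) (Runs.assign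
          (by simp [Expr.eval, hk', hqv]; omega) ?_ (by simp [Expr.cost])) (by omega)
        refine Runs.seq (T₁ := n * (70 + 8) + 6) (T₂ := 9) (Runs.mono (Runs.of_frame
          (Q' := fun s'' => HoldsQueue (bfsStep G D v (bfs G D x h)) s'' ∧ s''.reg 8 = h ∧
            s''.arr 6 = s'.arr 6)
          (scan_runs (v := v) hW (hs'.of_eq (by simp) (by simp))
          (hD'.of_eq (by simp) (by simp) (by simp) (by simp))
          (hq.of_eq (by simp) (by simp) (by simp) (by simp))
          (by simp [Expr.eval, hk', hqv])) ?_) le_rfl ?_) (by omega)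
        · intro s'' hf'' hq''
          refine ⟨hq'', ?_, ?_⟩
          · rw [hf''.1 8 (by decide)]; simp [hk']
          · rw [hf''.2 6 (by decide)]; simp
        · rintro s'' ⟨hq'', h8, h6⟩
          have hc1 : (bfsStep G D v (bfs G D x h)).2.card ≤ n := by
            simpa using Finset.card_le_univ (bfsStep G D v (bfs G D x h)).2
          refine Runs.put (by simp [Expr.eval, h8]; omega)
            (by simp [Expr.eval, hq''.2.2.2.1]; omega) ?_ (by simp [Expr.cost])
          refine ⟨?_, ?_⟩
          · rw [hstep]
            exact hq''.of_eq (by simp) (by simp) (by simp) (by simp)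
          · intro i hi hi'
            by_cases hih : i = h
            · subst hih
              simp [Expr.eval, h8, hq''.2.2.2.1, hstep]
            · simpa [Expr.eval, h8, hih, h6] using hb i (by omega) hi'
      · intro hc
        simp [Expr.eval, hk', hq.2.1] at hc
        have hstep : bfs G D x (h + 1) = bfs G D x h := by
          have : (bfs G D x h).1[h]? = none := by simpa using hc
          simp only [bfs, this]
        refine Runs.skip ⟨?_, ?_⟩ (by omega)
        · rw [hstep]
          exact hq.of_eq (by simp) (by simp) (by simp) (by simp)
        · intro i hi hi'
          by_cases hih : i = h
          · subst hih
            omega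
          · simpa using hb i (by omega) hi'
  · have h₁ : n ≤ n ^ 2 := Nat.le_self_pow (by simp) n
    ring_nf
    omega

end RAM

/-! ### Prefixes of the search order and their boundaries -/

section BreadthFirst

variable {n : ℕ} {G : SimpleGraph (Fin n)} {D : Finset (Fin n)} {x : Fin n}

/-- The vertices reached by breadth-first search from `x` in `G` outside `D`, in order. -/
noncomputable def bfsOrder (G : SimpleGraph (Fin n)) (D : Finset (Fin n)) (x : Fin n) :
    List (Fin n) :=
  (bfs G D x n).1

/-- The set of the first `k` vertices reached by breadth-first search. -/
noncomputable def bfsPrefix (G : SimpleGraph (Fin n)) (D : Finset (Fin n)) (x : Fin n) (k : ℕ) :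
    Finset (Fin n) :=
  ((bfsOrder G D x).take k).toFinset

theorem bfs_succ_of_none {h : ℕ} (hl : (bfs G D x h).1.length ≤ h) :
    bfs G D x (h + 1) = bfs G D x h := by
  have : (bfs G D x h).1[h]? = none := by simpa using hl
  simp only [bfs, this]

theorem bfs_succ_of_some {h : ℕ} {v : Fin n} (hv : (bfs G D x h).1[h]? = some v) :
    bfs G D x (h + 1) = bfsStep G D v (bfs G D x h) := by
  simp only [bfs, hv]

theorem bfs_prefix_succ (h : ℕ) : (bfs G D x h).1 <+: (bfs G D x (h + 1)).1 := by
  rcases hv : (bfs G D x h).1[h]? with _ | v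
  · rw [bfs_succ_of_none (by simpa using hv)]
  · rw [bfs_succ_of_some hv]
    simp [bfsStep]

theorem bfs_prefix {h k : ℕ} (hk : h ≤ k) : (bfs G D x h).1 <+: (bfs G D x k).1 := by
  induction k, hk using Nat.le_induction with
  | base => exact List.prefix_refl _
  | succ k _ ih => exact ih.trans (bfs_prefix_succ k)

theorem bfs_nodup_subset (h : ℕ) :
    (bfs G D x h).1.Nodup ∧ ∀ u ∈ (bfs G D x h).1, u ∈ (bfs G D x h).2 := by
  induction h with
  | zero => simp [bfs]
  | succ h ih =>
    rcases hv : (bfs G D x h).1[h]? with _ | v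
    · rwa [bfs_succ_of_none (by simpa using hv)]
    · rw [bfs_succ_of_some hv]
      constructor
      · refine List.nodup_append.2 ⟨ih.1, (List.nodup_finRange n).filter _, ?_⟩
        rintro a ha b hb rfl
        simp only [List.mem_filter, decide_eq_true_eq] at hb
        exact hb.2.2.1 (ih.2 a ha)
      · intro u hu
        simp only [bfsStep, List.mem_append, List.mem_filter, decide_eq_true_eq] at hu
        simp only [bfsStep, Finset.mem_union, Finset.mem_filter, Finset.mem_univ, true_and]
        rcases hu with hu | hu
        · exact Or.inl (ih.2 u hu)
        · exact Or.inr hu.2.1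

theorem mem_bfs_iff (hx : x ∉ D) (h : ℕ) (u : Fin n) :
    u ∈ (bfs G D x h).1 ↔ u ∈ (bfs G D x h).2 ∧ u ∉ D := by
  induction h with
  | zero =>
    simp only [bfs, List.mem_singleton, Finset.mem_singleton]
    exact ⟨fun h => ⟨h, h ▸ hx⟩, fun h => h.1⟩
  | succ h ih =>
    rcases hv : (bfs G D x h).1[h]? with _ | v
    · rwa [bfs_succ_of_none (by simpa using hv)]
    · rw [bfs_succ_of_some hv]
      simp only [bfsStep, List.mem_append, List.mem_filter, decide_eq_true_eq, ih,
        Finset.mem_union, Finset.mem_filter, Finset.mem_univ, true_and, List.mem_finRange]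
      tauto

theorem mem_bfs_marked_iff (h : ℕ) (u : Fin n) :
    u ∈ (bfs G D x h).2 ↔ u = x ∨ ∃ v ∈ (bfs G D x h).1.take h, G.Adj v u := by
  induction h with
  | zero => simp [bfs]
  | succ h ih =>
    rcases hv : (bfs G D x h).1[h]? with _ | v
    · have hl : (bfs G D x h).1.length ≤ h := by simpa using hv
      rw [bfs_succ_of_none hl, ih, List.take_of_length_le hl, List.take_of_length_le (by omega)]
    · have hl : h < (bfs G D x h).1.length := by
        by_contra hcon
        simp [List.getElem?_eq_none (not_lt.1 hcon)] at hv
      rw [bfs_succ_of_some hv]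
      have : (bfsStep G D v (bfs G D x h)).1.take (h + 1) = (bfs G D x h).1.take h ++ [v] := by
        rw [bfsStep, List.take_append_of_le_length (by omega), List.take_add_one, hv]
        rfl
      rw [this]
      simp only [bfsStep, Finset.mem_union, Finset.mem_filter, Finset.mem_univ, true_and, ih,
        List.mem_append, List.mem_singleton]
      constructor
      · rintro ((h | ⟨w, hw, hwu⟩) | h)
        · exact Or.inl h
        · exact Or.inr ⟨w, Or.inl hw, hwu⟩
        · exact Or.inr ⟨v, Or.inr rfl, h⟩
      · rintro (h | ⟨w, hw | rfl, hwu⟩)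
        · exact Or.inl (Or.inl h)
        · exact Or.inl (Or.inr ⟨w, hw, hwu⟩)
        · exact Or.inr hwu

theorem bfs_length_le (h : ℕ) : (bfs G D x h).1.length ≤ n := by
  simpa using (bfs_nodup_subset (G := G) (D := D) (x := x) h).1.length_le_card

theorem bfs_eq_of_length_le {h : ℕ} (hl : (bfs G D x h).1.length ≤ h) {k : ℕ} (hk : h ≤ k) :
    bfs G D x k = bfs G D x h := by
  induction k, hk using Nat.le_induction with
  | base => rfl
  | succ k hk ih => rw [bfs_succ_of_none (by rw [ih]; omega), ih]

theorem bfsOrder_nodup : (bfsOrder G D x).Nodup := (bfs_nodup_subset n).1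

theorem bfsOrder_length_le : (bfsOrder G D x).length ≤ n := bfs_length_le n

theorem lt_length_bfs {h : ℕ} (hh : h < (bfsOrder G D x).length) :
    h < (bfs G D x h).1.length := by
  by_contra hcon
  have hn := bfsOrder_length_le (G := G) (D := D) (x := x)
  have hhn : h ≤ n := by omega
  rw [bfsOrder, bfs_eq_of_length_le (not_lt.1 hcon) hhn] at hh
  exact hcon hh

/-- Later steps only append to the queue, so its first h elements are final by stage h; if the queue
is shorter, the search has already ended. -/
theorem take_bfs {h : ℕ} (hh : h ≤ n) :
    (bfs G D x h).1.take h = (bfsOrder G D x).take h := by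
  by_cases hl : (bfs G D x h).1.length ≤ h
  · rw [bfsOrder, bfs_eq_of_length_le hl hh]
  · obtain ⟨t, ht⟩ := bfs_prefix (G := G) (D := D) (x := x) hh
    rw [bfsOrder, ← ht, List.take_append_of_le_length (by omega)]

theorem card_bfsPrefix {k : ℕ} (hk : k ≤ (bfsOrder G D x).length) :
    (bfsPrefix G D x k).card = k := by
  rw [bfsPrefix, List.toFinset_card_of_nodup (bfsOrder_nodup.take), List.length_take,
    min_eq_left hk]

theorem bfsPrefix_mono {k l : ℕ} (hkl : k ≤ l) : bfsPrefix G D x k ⊆ bfsPrefix G D x l := by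
  intro u hu
  simp only [bfsPrefix, List.mem_toFinset] at hu ⊢
  exact List.take_subset_take_left _ hkl hu

theorem head_bfsOrder : ∃ t, bfsOrder G D x = x :: t := by
  obtain ⟨t, ht⟩ := bfs_prefix (G := G) (D := D) (x := x) (Nat.zero_le n)
  exact ⟨t, by rw [bfsOrder, ← ht]; simp [bfs]⟩

theorem mem_bfsPrefix {k : ℕ} (hk : 0 < k) : x ∈ bfsPrefix G D x k := by
  obtain ⟨t, ht⟩ := head_bfsOrder (G := G) (D := D) (x := x)
  obtain ⟨k, rfl⟩ : ∃ j, k = j + 1 := ⟨k - 1, by omega⟩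
  simp [bfsPrefix, ht]

theorem bfsPrefix_one : bfsPrefix G D x 1 = {x} := by
  obtain ⟨t, ht⟩ := head_bfsOrder (G := G) (D := D) (x := x)
  simp [bfsPrefix, ht]

/-- The neighbourhood of a prefix of the search order is a prefix of the search order. -/
theorem exists_bfsPrefix_eq_neighbors (hx : x ∉ D) {k : ℕ} (hk : k ≤ n) :
    ∃ l ≤ (bfsOrder G D x).length, ∀ u, u ∈ bfsPrefix G D x l ↔
      (u = x ∨ ∃ v ∈ bfsPrefix G D x k, G.Adj v u) ∧ u ∉ D := by
  obtain ⟨t, ht⟩ := bfs_prefix (G := G) (D := D) (x := x) hk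
  -- The right prefix length is the queue length after k vertices have been processed.
  refine ⟨(bfs G D x k).1.length, by rw [bfsOrder, ← ht]; simp, fun u => ?_⟩
  have h₁ : bfsPrefix G D x (bfs G D x k).1.length = (bfs G D x k).1.toFinset := by
    rw [bfsPrefix, bfsOrder, ← ht, List.take_left]
  rw [h₁, List.mem_toFinset, mem_bfs_iff hx, mem_bfs_marked_iff, take_bfs hk]
  simp [bfsPrefix]

/-- After k steps exactly the source and the neighbours of the first k vertices are marked, removed
ones included, and these k vertices are marked themselves. The rest of the marked set is the
boundary in all of G. -/
theorem card_nodeBoundary_bfsPrefix [DecidableRel G.Adj] {k : ℕ} (hk : 0 < k)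
    (hkl : k ≤ (bfsOrder G D x).length) :
    (nodeBoundary G (bfsPrefix G D x k)).card = (bfs G D x k).2.card - k := by
  have hkn := hkl.trans bfsOrder_length_le
  have hsub : bfsPrefix G D x k ⊆ (bfs G D x k).2 := by
    intro u hu
    rw [bfsPrefix, ← take_bfs hkn, List.mem_toFinset] at hu
    exact (bfs_nodup_subset k).2 u (List.mem_of_mem_take hu)
  have : nodeBoundary G (bfsPrefix G D x k) = (bfs G D x k).2 \ bfsPrefix G D x k := by
    ext u
    simp only [nodeBoundary, Finset.mem_filter, Finset.mem_univ, true_and, Finset.mem_sdiff,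
      mem_bfs_marked_iff, take_bfs hkn]
    constructor
    · rintro ⟨h₁, v, hv, h₂⟩
      exact ⟨Or.inr ⟨v, by simpa [bfsPrefix] using hv, h₂.symm⟩, h₁⟩
    · rintro ⟨rfl | ⟨v, hv, h₂⟩, h₁⟩
      · exact absurd (mem_bfsPrefix hk) h₁
      · exact ⟨h₁, v, by simpa [bfsPrefix] using hv, h₂.symm⟩
  rw [this, Finset.card_sdiff_of_subset hsub, card_bfsPrefix hkl]

end BreadthFirst

namespace RAM

variable {μ : ℝ} {W n : ℕ}

/-! ## Selecting prefixes of small expansion -/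

/-- The prefix of size `h + 1` exists, contains at most half of the vertices, and has boundary ratio
at most `B / S`. Here `ℓ` is the number of prefixes and `b h` is the boundary size. -/
abbrev GoodAt (n ℓ : ℕ) (b : ℕ → ℕ) (B S h : ℕ) : Prop :=
  h < ℓ ∧ 2 * (h + 1) ≤ n ∧ b h * S ≤ B * (h + 1)

/-- The number of prefixes of boundary ratio at most `B / S`. -/
abbrev goodCount (n ℓ : ℕ) (b : ℕ → ℕ) (B S : ℕ) : ℕ := Nat.count (GoodAt n ℓ b B S) n

/-- Condition: the prefix of size `reg r + 1` exists and has at most half of the vertices. -/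
def validTest (r : ℕ) : Expr :=
  .mul (.lt (.reg r) (.reg 9)) (.lt (.mul (.const 2) (.add (.reg r) (.const 1)))
    (.add (.reg 0) (.const 1)))

/-- Condition: the ratio at `reg 17` is at most the ratio at `reg 16`. -/
def ratioTest : Expr :=
  .lt (.mul (.get 6 (.reg 17)) (.add (.reg 16) (.const 1)))
    (.add (.mul (.get 6 (.reg 16)) (.add (.reg 17) (.const 1))) (.const 1))

/-- Count in register `18` the prefixes with ratio at most the one at `reg 16`. -/
def countProg : Prog :=
  .seq (.assign 18 (.const 0)) (forLoop 17 0 (.cond (.mul (validTest 17) ratioTest)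
    (.assign 18 (.add (.reg 18) (.const 1))) .skip))

/-- Condition: enough prefixes were counted, and the ratio at `reg 16` beats the best one so far. -/
def improveTest : Expr :=
  .mul (.lt (.reg 6) (.add (.reg 18) (.const 1)))
    (.lt (.mul (.get 6 (.reg 16)) (.reg 15)) (.mul (.reg 14) (.add (.reg 16) (.const 1))))

/-- Update the best ratio with the prefixes of the current search. -/
def selectProg : Prog :=
  forLoop 16 0 (.cond (validTest 16) (.seq countProg (.cond improveTest
    (.seq (.assign 13 (.reg 7)) (.seq (.assign 14 (.get 6 (.reg 16)))
      (.assign 15 (.add (.reg 16) (.const 1))))) .skip)) .skip)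

theorem eval_validTest {s : State} {r h ℓ : ℕ} (hr : s.reg r = h) (h9 : s.reg 9 = ℓ)
    (h0 : s.reg 0 = n) : (validTest r).eval μ s ≠ 0 ↔ h < ℓ ∧ 2 * (h + 1) ≤ n := by
  simp [validTest, Expr.eval, hr, h9, h0]
  omega

theorem countProg_runs {s : State} {h ℓ : ℕ} {b : ℕ → ℕ} (hW : n ≤ W) (h0 : s.reg 0 = n)
    (h9 : s.reg 9 = ℓ) (h16 : s.reg 16 = h) (hh : h < ℓ) (hb : ∀ i < ℓ, s.arr 6 i = b i) :
    Runs μ W countProg s (n * (40 + 8) + 8) (fun s' => s'.reg 18 = goodCount n ℓ b (b h) (h + 1)) := by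
  refine Runs.seq (T₁ := 2) (T₂ := n * (40 + 8) + 6) (Runs.assign (by simp [Expr.eval]) ?_
    (by simp [Expr.cost])) (by omega)
  refine Runs.forLoop (m := n) (fun k s' => s'.reg 18 = Nat.count (GoodAt n ℓ b (b h) (h + 1)) k)
    (by simpa using h0) hW (by simp) (by decide) (by decide) (by simp [Expr.eval]) ?_
    (fun s' _ _ h => h) le_rfl
  intro k hk s' hk' hf hI
  have h0' : s'.reg 0 = n := by rw [hf.1 0 (by decide)]; simpa using h0
  have h9' : s'.reg 9 = ℓ := by rw [hf.1 9 (by decide)]; simpa using h9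
  have h16' : s'.reg 16 = h := by rw [hf.1 16 (by decide)]; simpa using h16
  have h6' : s'.arr 6 = s.arr 6 := by rw [hf.2 6 (by decide)]; simp
  have htest : (Expr.mul (validTest 17) ratioTest).eval μ s' ≠ 0 ↔ GoodAt n ℓ b (b h) (h + 1) k := by
    rw [Expr.eval, mul_ne_zero_iff, eval_validTest hk' h9' h0', GoodAt, and_assoc]
    refine and_congr_right fun hkl => and_congr_right fun _ => ?_
    simp [ratioTest, Expr.eval, hk', h16', h6', hb k hkl, hb h hh]
  have hle : Nat.count (GoodAt n ℓ b (b h) (h + 1)) k ≤ k := Nat.count_le _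
  refine Runs.cond (T := 4) ?_ ?_ (by simp [validTest, ratioTest, Expr.cost])
  · intro hc
    refine Runs.assign (by simp [Expr.eval, hI]; omega) ?_ (by simp [Expr.cost])
    rw [Nat.count_succ, if_pos (htest.1 hc)]
    simp [Expr.eval, hI]
  · intro hc
    refine Runs.skip ?_ (by simp)
    rw [Nat.count_succ, if_neg (fun h' => htest.2 h' hc)]
    simp [hI]

/-- The registers `13`, `14`, `15` hold the number of a search, and numerator and denominator of the
least ratio that is attained at least `t` times, among the searches and prefixes in `P`. -/
def HoldsBest (n t : ℕ) (ℓ : ℕ → ℕ) (b : ℕ → ℕ → ℕ) (P : ℕ → ℕ → Prop) (s : State) : Prop :=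
  s.reg 14 ≤ n ∧ s.reg 15 ≤ n ∧ 0 < s.reg 15 ∧ s.reg 13 < 2 * n ∧
    ((s.reg 14 = n ∧ s.reg 15 = 1) ∨
      t ≤ goodCount n (ℓ (s.reg 13)) (b (s.reg 13)) (s.reg 14) (s.reg 15)) ∧
    ∀ c h, P c h → h < ℓ c → 2 * (h + 1) ≤ n → t ≤ goodCount n (ℓ c) (b c) (b c h) (h + 1) →
      s.reg 14 * (h + 1) ≤ b c h * s.reg 15

theorem HoldsBest.of_eq {t : ℕ} {ℓ : ℕ → ℕ} {b : ℕ → ℕ → ℕ} {P : ℕ → ℕ → Prop} {s s' : State}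
    (hs : HoldsBest n t ℓ b P s) (h₁ : s'.reg 13 = s.reg 13) (h₂ : s'.reg 14 = s.reg 14)
    (h₃ : s'.reg 15 = s.reg 15) : HoldsBest n t ℓ b P s' := by
  simpa [HoldsBest, h₁, h₂, h₃] using hs

theorem HoldsBest.mono {t : ℕ} {ℓ : ℕ → ℕ} {b : ℕ → ℕ → ℕ} {P P' : ℕ → ℕ → Prop} {s : State}
    (hs : HoldsBest n t ℓ b P s)
    (h : ∀ c h, P' c h → h < ℓ c → 2 * (h + 1) ≤ n →
      t ≤ goodCount n (ℓ c) (b c) (b c h) (h + 1) → P c h) : HoldsBest n t ℓ b P' s := by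
  obtain ⟨h₁, h₂, h₃, h₄, h₅, h₆⟩ := hs
  exact ⟨h₁, h₂, h₃, h₄, h₅, fun c i hc hi hi' ht => h₆ c i (h c i hc hi hi' ht) hi hi' ht⟩

theorem selectProg_runs {t c : ℕ} {ℓ : ℕ → ℕ} {b : ℕ → ℕ → ℕ} {s : State} (hW : 2 * n ≤ W)
    (hbn : ∀ h < ℓ c, b c h ≤ n) (hc : c < 2 * n) (h0 : s.reg 0 = n) (h7 : s.reg 7 = c)
    (h6 : s.reg 6 = t) (h9 : s.reg 9 = ℓ c) (hb : ∀ i < ℓ c, s.arr 6 i = b c i)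
    (hs : HoldsBest n t ℓ b (fun c' _ => c' < c) s) :
    Runs μ W selectProg s (n * (n * (40 + 8) + 68) + 6)
      (HoldsBest n t ℓ b (fun c' _ => c' < c + 1)) := by
  refine Runs.forLoop (m := n) (Tb := n * (40 + 8) + 60)
    (fun k => HoldsBest n t ℓ b (fun c' h => c' < c ∨ (c' = c ∧ h < k)))
    h0 (by omega) (by simp) (by decide) (by decide) ?_ ?_ ?_ le_rfl
  · exact (hs.of_eq (by simp) (by simp) (by simp)).mono (fun c' h hP _ _ _ => by omega)
  · intro k hk s' hk' hf hI
    have h0' : s'.reg 0 = n := by rw [hf.1 0 (by decide)]; simpa using h0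
    have h9' : s'.reg 9 = ℓ c := by rw [hf.1 9 (by decide)]; simpa using h9
    have h7' : s'.reg 7 = c := by rw [hf.1 7 (by decide)]; simpa using h7
    have h6' : s'.reg 6 = t := by rw [hf.1 6 (by decide)]; simpa using h6
    have hb' : ∀ i < ℓ c, s'.arr 6 i = b c i := by rw [hf.2 6 (by decide)]; simpa using hb
    refine Runs.cond (T := n * (40 + 8) + 40) ?_ ?_ (by simp [validTest, Expr.cost]; omega)
    · intro hv
      rw [eval_validTest hk' h9' h0'] at hv
      refine Runs.seq (T₁ := n * (40 + 8) + 8) (T₂ := 32) (Runs.of_frame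
        (countProg_runs (n := n) (by omega) h0' h9' hk' hv.1 hb') ?_) (by omega)
      · intro s'' hf' h18
        have h6'' := (hf'.1 6 (by decide)).trans h6'
        have h7'' := (hf'.1 7 (by decide)).trans h7'
        have h16'' := (hf'.1 16 (by decide)).trans hk'
        have hI' := hI.of_eq (hf'.1 13 (by decide)) (hf'.1 14 (by decide)) (hf'.1 15 (by decide))
        have ha : s''.arr 6 k = b c k := by
          rw [hf'.2 6 (by decide)]
          exact hb' k hv.1
        have htest : improveTest.eval μ s'' ≠ 0 ↔ t ≤ goodCount n (ℓ c) (b c) (b c k) (k + 1) ∧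
            b c k * s''.reg 15 < s''.reg 14 * (k + 1) := by
          simp only [improveTest, Expr.eval, h18, h6'', h16'', ha, mul_ne_zero_iff]
          refine and_congr ?_ ?_
          · simp
          · simp
        obtain ⟨e₁, e₂, e₃, e₄, e₅, e₆⟩ := hI'
        have hbk := hbn k hv.1
        refine Runs.cond (T := 10) ?_ ?_ (by simp [improveTest, Expr.cost])
        · intro hc'
          obtain ⟨ht, hlt⟩ := htest.1 hc'
          refine Runs.seq (T₁ := 2) (T₂ := 8) (Runs.assign (by simp [Expr.eval, h7'']; omega) ?_
            (by simp [Expr.cost])) (by omega)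
          refine Runs.seq (T₁ := 3) (T₂ := 4) (Runs.assign (by simp [Expr.eval, h16'', ha]; omega) ?_
            (by simp [Expr.cost])) (by omega)
          refine Runs.assign (by simp [Expr.eval, h16'']; omega) ?_ (by simp [Expr.cost])
          simp only [HoldsBest, State.setReg_reg, Expr.eval, h7'', h16'', State.setReg_arr]
          simp only [Nat.reduceEqDiff, if_true, if_false, ha]
          refine ⟨hbk, by omega, by omega, hc, Or.inr ht, ?_⟩
          intro c' h hP hh hh' ht'
          by_cases hck : c' = c ∧ h = k
          · obtain ⟨rfl, rfl⟩ := hck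
            exact le_rfl
          · have hle := e₆ c' h (by omega) hh hh' ht'
            -- Transitivity of the comparison of fractions in cross-multiplied form: multiply by the
            -- old denominator, which is positive, and cancel it.
            refine Nat.le_of_mul_le_mul_right (c := s''.reg 15) ?_ e₃
            calc b c k * (h + 1) * s''.reg 15 = (b c k * s''.reg 15) * (h + 1) := by ring
              _ ≤ (s''.reg 14 * (k + 1)) * (h + 1) := Nat.mul_le_mul_right _ hlt.le
              _ = (s''.reg 14 * (h + 1)) * (k + 1) := by ring
              _ ≤ (b c' h * s''.reg 15) * (k + 1) := Nat.mul_le_mul_right _ hle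
              _ = b c' h * (k + 1) * s''.reg 15 := by ring
        · intro hc'
          refine Runs.skip ?_ (by simp)
          refine HoldsBest.of_eq (s := s'') ⟨e₁, e₂, e₃, e₄, e₅, ?_⟩ (by simp) (by simp) (by simp)
          intro c' h hP hh hh' ht'
          by_cases hck : c' = c ∧ h = k
          · obtain ⟨rfl, rfl⟩ := hck
            by_contra hcon
            exact htest.2 ⟨ht', not_le.1 hcon⟩ hc'
          · exact e₆ c' h (by omega) hh hh' ht'
    · intro hv
      refine Runs.skip ((hI.of_eq (by simp) (by simp) (by simp)).mono ?_) (by omega)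
      intro c' h hP hh hh' _
      by_cases hck : c' = c ∧ h = k
      · obtain ⟨rfl, rfl⟩ := hck
        exact absurd hv ((eval_validTest hk' h9' h0').2 ⟨hh, hh'⟩)
      · omega
  · intro s' _ _ hI
    refine hI.mono ?_
    intro c' h hP hh hh' _
    omega

/-! ## Output -/

/-- Condition: the prefix at `reg 16` is one of the prefixes to put out. -/
def outTest : Expr :=
  .mul (validTest 16) (.lt (.mul (.get 6 (.reg 16)) (.reg 15))
    (.add (.mul (.reg 14) (.add (.reg 16) (.const 1))) (.const 1)))

/-- Write the characteristic vector of the prefix at `reg 16`. -/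
def writeProg : Prog :=
  forLoop 11 0 (.cond (.lt (.reg 11) (.add (.reg 16) (.const 1)))
    (.put 1 (.add (.mul (.reg 20) (.reg 0)) (.get 2 (.reg 11))) (.const 1)) .skip)

/-- Write all prefixes of ratio at most `reg 14 / reg 15`; count them in register `20`. -/
def outProg : Prog :=
  .seq (.assign 20 (.const 0)) (forLoop 16 0 (.cond outTest
    (.seq writeProg (.assign 20 (.add (.reg 20) (.const 1)))) .skip))

open Classical in
-- Row j of the output is still zero, so only the ones have to be written; clearing it is
-- unnecessary.
theorem writeProg_runs {F : List (Fin n)} {s : State} {h j : ℕ} (hW : n ^ 2 ≤ W) (h0 : s.reg 0 = n)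
    (hF : ∀ (i : ℕ) (u : Fin n), F[i]? = some u → s.arr 2 i = u) (h16 : s.reg 16 = h)
    (hh : h < F.length) (hhn : h < n) (h20 : s.reg 20 = j) (hj : j < n)
    (hz : ∀ i, j * n ≤ i → s.arr 1 i = 0) :
    Runs μ W writeProg s (n * (20 + 8) + 6) (fun s' =>
      (∀ i < j * n, s'.arr 1 i = s.arr 1 i) ∧ (∀ i, (j + 1) * n ≤ i → s'.arr 1 i = 0) ∧
      ∀ v : Fin n, s'.arr 1 (j * n + v) = if v ∈ F.take (h + 1) then 1 else 0) := by
  have hn : n ≤ n ^ 2 := Nat.le_self_pow (by simp) n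
  refine Runs.forLoop (m := n) (fun k s' =>
    (∀ i < j * n, s'.arr 1 i = s.arr 1 i) ∧ (∀ i, (j + 1) * n ≤ i → s'.arr 1 i = 0) ∧
      ∀ v : Fin n, s'.arr 1 (j * n + v) = if v ∈ F.take (min k (h + 1)) then 1 else 0)
    h0 (by omega) (by simp) (by decide) (by decide) ?_ ?_ ?_ le_rfl
  · refine ⟨by simp, ?_, ?_⟩
    · intro i hi
      simp only [State.setReg_arr]
      exact hz i (le_trans (Nat.mul_le_mul_right _ (by omega)) hi)
    · intro v
      simp [hz (j * n + v) (by omega)]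
  · rintro k hk s' hk' hf ⟨e₁, e₂, e₃⟩
    have h0' : s'.reg 0 = n := by rw [hf.1 0 (by decide)]; exact h0
    have h16' : s'.reg 16 = h := by rw [hf.1 16 (by decide)]; exact h16
    have h20' : s'.reg 20 = j := by rw [hf.1 20 (by decide)]; exact h20
    have h2' : s'.arr 2 = s.arr 2 := hf.2 2 (by decide)
    refine Runs.cond (T := 8) ?_ ?_ (by simp [Expr.cost])
    · intro hc
      simp [Expr.eval, hk', h16'] at hc
      have hget : F[k]? = some F[k] := by simp
      set w := F[k] with hw
      have ha : s'.arr 2 k = w := by rw [h2']; exact hF k w hget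
      have hwn := w.2
      have hjn : j * n + n ≤ n ^ 2 := by
        calc j * n + n = (j + 1) * n := by ring
          _ ≤ n * n := Nat.mul_le_mul_right _ hj
          _ = n ^ 2 := by ring
      refine Runs.put (by simp [Expr.eval, h20', h0', hk', ha]; omega)
        (by simp [Expr.eval]; omega) ?_ (by simp [Expr.cost])
      simp only [Expr.eval, h20', h0', hk', ha, State.setReg_arr, State.setArr_arr, if_true,
        Function.update_apply]
      refine ⟨?_, ?_, ?_⟩
      · intro i hi
        rw [if_neg (by omega), e₁ i hi]
      · intro i hi
        rw [if_neg (by rw [add_mul] at hi; omega), e₂ i hi]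
      · intro v
        have hmin : min (k + 1) (h + 1) = min k (h + 1) + 1 := by omega
        have hmin' : min k (h + 1) = k := by omega
        rw [e₃ v, hmin, hmin', List.take_add_one, hget]
        by_cases hvw : v = w
        · simp [hvw]
        · have : (v : ℕ) ≠ w := fun h => hvw (Fin.ext h)
          simp [this, hvw]
    · intro hc
      simp [Expr.eval, hk', h16'] at hc
      have hmin : min (k + 1) (h + 1) = min k (h + 1) := by omega
      refine Runs.skip ?_ (by simp)
      rw [hmin]
      exact ⟨e₁, e₂, e₃⟩
  · rintro s' - - ⟨e₁, e₂, e₃⟩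
    rw [min_eq_right (by omega : h + 1 ≤ n)] at e₃
    exact ⟨e₁, e₂, e₃⟩

open Classical in
-- The row given to a good prefix is its rank among the good prefixes, which `Nat.count` expresses.
theorem outProg_runs {F : List (Fin n)} {b : ℕ → ℕ} {B S : ℕ} {s : State} (hW : n ^ 2 ≤ W)
    (h0 : s.reg 0 = n) (hF : ∀ (i : ℕ) (u : Fin n), F[i]? = some u → s.arr 2 i = u)
    (h9 : s.reg 9 = F.length) (hb : ∀ i < F.length, s.arr 6 i = b i) (h14 : s.reg 14 = B)
    (h15 : s.reg 15 = S) (hz : ∀ i, s.arr 1 i = 0) :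
    Runs μ W outProg s (n * (n * (20 + 8) + 68) + 8) (fun s' =>
      s'.reg 20 = goodCount n F.length b B S ∧
      ∀ h < n, GoodAt n F.length b B S h → ∀ v : Fin n,
        s'.arr 1 (Nat.count (GoodAt n F.length b B S) h * n + v) =
          if v ∈ F.take (h + 1) then 1 else 0) := by
  have hn : n ≤ n ^ 2 := Nat.le_self_pow (by simp) n
  set p := GoodAt n F.length b B S with hp
  refine Runs.seq (T₁ := 2) (T₂ := n * (n * (20 + 8) + 68) + 6)
    (Runs.assign (by simp [Expr.eval]) ?_ (by simp [Expr.cost])) (by omega)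
  refine Runs.forLoop (m := n) (Tb := n * (20 + 8) + 60) (fun k s' => s'.reg 20 = Nat.count p k ∧
    (∀ i, Nat.count p k * n ≤ i → s'.arr 1 i = 0) ∧
    ∀ h < k, p h → ∀ v : Fin n, s'.arr 1 (Nat.count p h * n + v) =
      if v ∈ F.take (h + 1) then 1 else 0)
    (by simpa using h0) (by omega) (by simp) (by decide) (by decide) ?_ ?_ ?_ le_rfl
  · simp [Expr.eval, hz]
  · rintro k hk s' hk' hf ⟨e₁, e₂, e₃⟩
    have h0' : s'.reg 0 = n := by rw [hf.1 0 (by decide)]; simpa using h0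
    have h9' : s'.reg 9 = F.length := by rw [hf.1 9 (by decide)]; simpa using h9
    have h14' : s'.reg 14 = B := by rw [hf.1 14 (by decide)]; simpa using h14
    have h15' : s'.reg 15 = S := by rw [hf.1 15 (by decide)]; simpa using h15
    have h2' : s'.arr 2 = s.arr 2 := by rw [hf.2 2 (by decide)]; simp
    have h6' : s'.arr 6 = s.arr 6 := by rw [hf.2 6 (by decide)]; simp
    have hcount : Nat.count p k ≤ k := Nat.count_le _
    have htest : outTest.eval μ s' ≠ 0 ↔ p k := by
      rw [outTest, Expr.eval, mul_ne_zero_iff, eval_validTest hk' h9' h0', hp, and_assoc]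
      refine and_congr_right fun hkl => and_congr_right fun _ => ?_
      simp [Expr.eval, hk', h6', hb k hkl, h14', h15']
    refine Runs.cond (T := n * (20 + 8) + 10) ?_ ?_ (by simp [outTest, validTest, Expr.cost]; omega)
    · intro hc
      have hpk := htest.1 hc
      refine Runs.seq (T₁ := n * (20 + 8) + 6) (T₂ := 4) (Runs.of_frame (writeProg_runs (F := F)
        (h := k) (j := Nat.count p k) hW h0' (by rw [h2']; exact hF) hk' hpk.1 hk e₁ (by omega) e₂)
        ?_) (by omega)
      · rintro s'' hf' ⟨g₁, g₂, g₃⟩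
        have g₀ := (hf'.1 20 (by decide)).trans e₁
        refine Runs.assign (by simp [Expr.eval, g₀]; omega) ?_ (by simp [Expr.cost])
        rw [Nat.count_succ, if_pos hpk]
        refine ⟨by simp [Expr.eval, g₀], by simpa using g₂, ?_⟩
        intro h hh hph v
        simp only [State.setReg_arr]
        by_cases hhk : h = k
        · rw [hhk]; exact g₃ v
        · rw [g₁, e₃ h (by omega) hph v]
          have : Nat.count p h < Nat.count p k := Nat.count_strict_mono hph (by omega)
          calc Nat.count p h * n + v < Nat.count p h * n + n := by have := v.2; omega
            _ = (Nat.count p h + 1) * n := by ring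
            _ ≤ _ := Nat.mul_le_mul_right _ this
    · intro hc
      have hpk : ¬ p k := fun h => htest.2 h hc
      refine Runs.skip ?_ (by omega)
      rw [Nat.count_succ, if_neg hpk]
      refine ⟨by simpa using e₁, by simpa using e₂, ?_⟩
      intro h hh hph v
      have : h ≠ k := by rintro rfl; exact hpk hph
      exact e₃ h (by omega) hph v
  · rintro s' - - ⟨e₁, e₂, e₃⟩
    exact ⟨e₁, e₃⟩

end RAM

/-! ## The search family -/

/-- The vertices in the middle of almost shortest paths from `p` to `q`; `ρ` measures the slack. -/
noncomputable def removedSet {n : ℕ} (G : SimpleGraph (Fin n)) (p q : Fin n) (ρ : ℕ) : Finset (Fin n) :=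
  Finset.univ.filter fun u => G.dist p u + G.dist q u < G.dist p q + ρ ∧
    G.dist p q < 4 * G.dist p u ∧ G.dist p q < 4 * G.dist q u

/-- The source of the search with number `c`. -/
def familySource {n : ℕ} (p q : Fin n) (c : ℕ) : Fin n := if c % 2 = 0 then p else q

/-- The number of prefixes of the search with number `c`. -/
noncomputable def familyLength {n : ℕ} (G : SimpleGraph (Fin n)) (p q : Fin n) (c : ℕ) : ℕ :=
  (bfsOrder G (removedSet G p q (c / 2)) (familySource p q c)).length

/-- The prefixes of the search with number `c`. -/
noncomputable def familyPrefix {n : ℕ} (G : SimpleGraph (Fin n)) (p q : Fin n) (c k : ℕ) :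
    Finset (Fin n) :=
  bfsPrefix G (removedSet G p q (c / 2)) (familySource p q c) k

/-- The boundary size of the prefix of size `h + 1` of the search with number `c`. -/
noncomputable def familyBoundary {n : ℕ} (G : SimpleGraph (Fin n)) (p q : Fin n) (c h : ℕ) : ℕ :=
  (bfs G (removedSet G p q (c / 2)) (familySource p q c) (h + 1)).2.card - (h + 1)

theorem familySource_notMem {n : ℕ} (G : SimpleGraph (Fin n)) (p q : Fin n) (c ρ : ℕ) :
    familySource p q c ∉ removedSet G p q ρ := by
  unfold familySource
  split_ifs <;> simp [removedSet]

/-- The number of prefixes of a given search that the algorithm is asked to find. -/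
noncomputable def requiredCount (μ : ℝ) (Δ : ℕ) : ℕ := ⌈(Δ : ℝ) ^ μ⌉₊ / 88 + 1

/-! ### The whole algorithm and its correctness -/

namespace RAM

variable {μ : ℝ} {W n : ℕ} {G : SimpleGraph (Fin n)}

/-- The parity of register `7`. -/
def parityExpr : Expr := .sub (.reg 7) (.mul (.const 2) (.div (.reg 7) (.const 2)))

/-- Run the search whose number is in register `7`. -/
def familyProg : Prog :=
  .seq (.assign 5 (.div (.reg 7) (.const 2)))
    (.seq (.assign 3 (.add (.mul (.reg 1) (.sub (.const 1) parityExpr)) (.mul (.reg 2) parityExpr)))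
      bfsProg)

/-- The algorithm. -/
def mainProg : Prog :=
  .seq (distProg 4 1) (.seq (distProg 5 2)
  (.seq (.assign 4 (.sub (.get 4 (.reg 2)) (.const 1)))
  (.seq (.assign 6 (.add (.div (.pow (.reg 4)) (.const 88)) (.const 1)))
  (.seq (.assign 14 (.reg 0)) (.seq (.assign 15 (.const 1))
  (.seq (.assign 19 (.mul (.const 2) (.reg 0)))
  (.seq (forLoop 7 19 (.seq familyProg selectProg))
  (.seq (.assign 7 (.reg 13)) (.seq familyProg (.seq outProg (.assign 0 (.reg 20))))))))))))

/-- The state after the preprocessing phase. -/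
def HoldsSetup (G : SimpleGraph (Fin n)) (p q : Fin n) (t : ℕ) (s : State) : Prop :=
  HoldsGraph G s ∧ s.reg 1 = p ∧ s.reg 2 = q ∧ s.reg 4 = G.dist p q ∧ s.reg 6 = t ∧
    (∀ u : Fin n, s.arr 4 u = G.dist p u + 1) ∧ ∀ u : Fin n, s.arr 5 u = G.dist q u + 1

theorem HoldsSetup.of_frame {p q : Fin n} {t : ℕ} {s s' : State} {c : Prog}
    (h : HoldsSetup G p q t s) (hf : Frame c s s') (h0 : c.writesReg 0 = false := by decide)
    (h1 : c.writesReg 1 = false := by decide) (h2 : c.writesReg 2 = false := by decide)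
    (h4 : c.writesReg 4 = false := by decide) (h6 : c.writesReg 6 = false := by decide)
    (a0 : c.writesArr 0 = false := by decide) (a4 : c.writesArr 4 = false := by decide)
    (a5 : c.writesArr 5 = false := by decide) : HoldsSetup G p q t s' := by
  simpa [HoldsSetup, HoldsGraph, hf.1 0 h0, hf.1 1 h1, hf.1 2 h2, hf.1 4 h4, hf.1 6 h6,
    hf.2 0 a0, hf.2 4 a4, hf.2 5 a5] using h

/-- The state after the search with number `c`. -/
def HoldsSearch (G : SimpleGraph (Fin n)) (p q : Fin n) (c : ℕ) (s : State) : Prop :=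
  (∀ (i : ℕ) (u : Fin n), (bfsOrder G (removedSet G p q (c / 2)) (familySource p q c))[i]? = some u →
    s.arr 2 i = u) ∧
  s.reg 9 = familyLength G p q c ∧
  ∀ i < familyLength G p q c, s.arr 6 i = familyBoundary G p q c i

theorem familyProg_runs {p q : Fin n} {t c : ℕ} {s : State} (hW : 2 * n ≤ W)
    (hs : HoldsSetup G p q t s) (h7 : s.reg 7 = c) (hc : c < 2 * n) :
    Runs μ W familyProg s (200 * n ^ 2 + 60) (HoldsSearch G p q c) := by
  obtain ⟨hG, h1, h2, h4, h6, a4, a5⟩ := hs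
  have hp := p.2
  have hq := q.2
  have hsrc : s.reg 1 * (1 - (c - 2 * (c / 2))) + s.reg 2 * (c - 2 * (c / 2)) =
      familySource p q c := by
    have h : c - 2 * (c / 2) = c % 2 := by omega
    rw [h, h1, h2, familySource]
    rcases Nat.mod_two_eq_zero_or_one c with h' | h' <;> simp [h']
  refine Runs.seq (T₁ := 4) (T₂ := 200 * n ^ 2 + 50) (Runs.assign (by simp [Expr.eval, h7]; omega)
    ?_ (by simp [Expr.cost])) (by omega)
  refine Runs.seq (T₁ := 30) (T₂ := 200 * n ^ 2 + 20) (Runs.assign ?_ ?_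
    (by simp [Expr.cost, parityExpr])) (by omega)
  · have := (familySource p q c).2
    simp only [Expr.eval, parityExpr, State.setReg_reg, h7]
    simp only [Nat.reduceEqDiff, if_false]
    rw [hsrc]
    omega
  · refine (bfsProg_runs (G := G) (D := removedSet G p q (c / 2)) (x := familySource p q c)
      (by omega) (hG.of_eq (by simp) (by simp)) ?_ ?_).mono le_rfl ?_
    · intro u
      -- Arrays 4 and 5 hold distances plus one; this explains the summand 2 and the subtracted ones
      -- in `removedTest`.
      simp [removedSet, Expr.eval, h4, h7, a4, a5]
      omega
    · simp only [Expr.eval, parityExpr, State.setReg_reg, h7]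
      simp only [Nat.reduceEqDiff, if_false, if_true]
      exact hsrc
    · rintro s' ⟨⟨e₁, e₂, -⟩, e₃⟩
      refine ⟨e₁, e₂, ?_⟩
      intro i hi
      exact e₃ i (hi.trans_le bfsOrder_length_le) (lt_length_bfs hi)

theorem holdsGraph_input [DecidableRel G.Adj] (p q : Fin n) : HoldsGraph G (input G p q) := by
  refine ⟨by simp [input], fun u v => ?_⟩
  simp only [input, true_and, ne_eq, ite_eq_right_iff, one_ne_zero, imp_false, not_not]
  constructor
  · rintro ⟨u', v', h, hadj⟩
    have hn := u.pos
    have hu : (u : ℕ) = u' := by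
      have := congrArg (· / n) h
      simpa [Nat.mul_add_div, mul_comm _ n, Nat.mul_add_div hn, Nat.div_eq_of_lt] using this
    have hv : (v : ℕ) = v' := by rw [hu] at h; omega
    rwa [Fin.ext hu, Fin.ext hv]
  · intro h
    exact ⟨u, v, rfl, h⟩

end RAM

theorem exists_count_eq {P : ℕ → Prop} [DecidablePred P] {n j : ℕ} (hj : j < Nat.count P n) :
    ∃ h < n, P h ∧ Nat.count P h = j := by
  induction n with
  | zero => simp at hj
  | succ n ih =>
    by_cases h : j < Nat.count P n
    · obtain ⟨k, hk, h'⟩ := ih h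
      exact ⟨k, by omega, h'⟩
    · rw [Nat.count_succ] at hj
      split_ifs at hj with hp
      · exact ⟨n, by omega, hp, by omega⟩
      · omega

open Classical in
/-- The prefixes of the search with number `c` that contain at most half of the vertices and have
expansion at most `T`, given by their sizes minus one. -/
noncomputable def goodPrefixes {n : ℕ} (G : SimpleGraph (Fin n)) (p q : Fin n) (c : ℕ) (T : ℝ) :
    Finset ℕ :=
  (Finset.range n).filter fun h => h < familyLength G p q c ∧ 2 * (h + 1) ≤ n ∧
    (familyBoundary G p q c h : ℝ) ≤ T * ((h : ℝ) + 1)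

section

variable {n : ℕ} {G : SimpleGraph (Fin n)} {p q : Fin n}

theorem card_nodeBoundary_familyPrefix [DecidableRel G.Adj] {c h : ℕ}
    (hh : h < familyLength G p q c) :
    (nodeBoundary G (familyPrefix G p q c (h + 1))).card = familyBoundary G p q c h :=
  card_nodeBoundary_bfsPrefix (Nat.succ_pos h) hh

theorem card_familyPrefix {c k : ℕ} (hk : k ≤ familyLength G p q c) :
    (familyPrefix G p q c k).card = k := card_bfsPrefix hk

theorem familyLength_le (c : ℕ) : familyLength G p q c ≤ n := bfsOrder_length_le

theorem familyBoundary_lt {c h : ℕ} (hh : h < familyLength G p q c) :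
    familyBoundary G p q c h < n := by
  have h₁ := Finset.card_le_univ (bfs G (removedSet G p q (c / 2)) (familySource p q c) (h + 1)).2
  have h₂ := familyLength_le (G := G) (p := p) (q := q) c
  simp only [Fintype.card_fin] at h₁
  unfold familyBoundary
  omega

/-- If a search has `t` prefixes of expansion at most `T`, then one of its prefixes has this property
and an expansion that is attained at least `t` times. -/
theorem exists_le_goodCount {c t : ℕ} {T : ℝ} (ht : 0 < t)
    (hc : t ≤ (goodPrefixes G p q c T).card) :
    ∃ h, h < familyLength G p q c ∧ 2 * (h + 1) ≤ n ∧
      (familyBoundary G p q c h : ℝ) ≤ T * ((h : ℝ) + 1) ∧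
      t ≤ RAM.goodCount n (familyLength G p q c) (familyBoundary G p q c)
        (familyBoundary G p q c h) (h + 1) := by
  -- Take the good prefix of largest ratio: all the other good prefixes have at most this ratio, so
  -- they are all counted.
  obtain ⟨h, hh, hmax⟩ := Finset.exists_max_image (goodPrefixes G p q c T)
    (fun h => (familyBoundary G p q c h : ℝ) / ((h : ℝ) + 1)) (Finset.card_pos.1 (by omega))
  simp only [goodPrefixes, Finset.mem_filter, Finset.mem_range] at hh
  refine ⟨h, hh.2.1, hh.2.2.1, hh.2.2.2, hc.trans ?_⟩
  rw [RAM.goodCount, Nat.count_eq_card_filter_range]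
  refine Finset.card_le_card fun k hk => ?_
  have hk' := hk
  simp only [goodPrefixes, Finset.mem_filter, Finset.mem_range] at hk
  simp only [Finset.mem_filter, Finset.mem_range]
  refine ⟨hk.1, hk.2.1, hk.2.2.1, ?_⟩
  have := hmax k hk'
  rw [div_le_div_iff₀ (by positivity) (by positivity)] at this
  exact_mod_cast this

end

namespace RAM

variable {μ : ℝ} {W n : ℕ} {G : SimpleGraph (Fin n)}

/-- The state inside `HoldsBest` is artificial: it only carries the chosen search c and ratio B/S in
registers 13, 14 and 15, the only ones on which `HoldsBest` depends. The time is dominated by two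
distance computations and 2n searches of O(n²) steps. -/
theorem mainProg_runs [DecidableRel G.Adj] (hμ1 : μ < 1) (hn : 2 ≤ n)
    (hG : G.Connected) {p q : Fin n} (hpq : p ≠ q) :
    Runs μ (n ^ 3) mainProg (input G p q) (2000 * n ^ 3) (fun s =>
      ∃ c B S, HoldsBest n (requiredCount μ (G.dist p q)) (familyLength G p q)
        (familyBoundary G p q) (fun c' _ => c' < 2 * n)
        ⟨fun i => if i = 13 then c else if i = 14 then B else S, fun _ _ => 0⟩ ∧
      s.reg 0 = goodCount n (familyLength G p q c) (familyBoundary G p q c) B S ∧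
      ∀ h < n, GoodAt n (familyLength G p q c) (familyBoundary G p q c) B S h → ∀ v : Fin n,
        s.arr 1 (Nat.count (GoodAt n (familyLength G p q c) (familyBoundary G p q c) B S) h * n + v) =
          if v ∈ familyPrefix G p q c (h + 1) then 1 else 0) := by
  have hn2 : n ^ 2 ≤ n ^ 3 := Nat.pow_le_pow_right (by omega) (by omega)
  have hn3 : 2 * n ≤ n ^ 2 := by nlinarith
  have hn4 : 4 ≤ n ^ 2 := by nlinarith
  have hn5 : n ^ 3 = n ^ 2 * n := by ring
  have hn6 : 4 * n ≤ n ^ 3 := by nlinarith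
  have hp := p.2
  have hq := q.2
  set t := requiredCount μ (G.dist p q) with ht
  have hΔ : G.dist p q < n := dist_lt_of_connected hG p q
  have hΔ0 : 0 < G.dist p q := hG.pos_dist_of_ne hpq
  refine Runs.seq (T₁ := 100 * n ^ 3 + 9) (T₂ := 1870 * n ^ 3) (Runs.of_frame
    (distProg_runs (by simp) (by omega) hG p (holdsGraph_input p q) (by simp [input])
      (by simp [input])) ?_) (by omega)
  intro s₁ hf₁ h4
  have hG₁ : HoldsGraph G s₁ :=
    (holdsGraph_input p q).of_eq (hf₁.1 0 (by decide)) (hf₁.2 0 (by decide))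
  have r1 : s₁.reg 1 = p := (hf₁.1 1 (by decide)).trans (by simp [input])
  have r2 : s₁.reg 2 = q := (hf₁.1 2 (by decide)).trans (by simp [input])
  have r13 : s₁.reg 13 = 0 := (hf₁.1 13 (by decide)).trans (by simp [input])
  have a5 : ∀ j, s₁.arr 5 j = 0 := by
    rw [hf₁.2 5 (by decide)]; simp [input]
  have a1 : ∀ j, s₁.arr 1 j = 0 := by
    rw [hf₁.2 1 (by decide)]; simp [input]
  refine Runs.seq (T₁ := 100 * n ^ 3 + 9) (T₂ := 1760 * n ^ 3) (Runs.of_frame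
    (distProg_runs (by simp) (by omega) hG q hG₁ r2 a5) ?_) (by omega)
  intro s₂ hf₂ h5
  have hG₂ : HoldsGraph G s₂ := hG₁.of_eq (hf₂.1 0 (by decide)) (hf₂.2 0 (by decide))
  replace r1 : s₂.reg 1 = p := (hf₂.1 1 (by decide)).trans r1
  replace r2 : s₂.reg 2 = q := (hf₂.1 2 (by decide)).trans r2
  replace r13 : s₂.reg 13 = 0 := (hf₂.1 13 (by decide)).trans r13
  replace h4 : ∀ w : Fin n, s₂.arr 4 w = G.dist p w + 1 := by
    rwa [hf₂.2 4 (by decide)]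
  replace a1 : ∀ j, s₂.arr 1 j = 0 := by
    rwa [hf₂.2 1 (by decide)]
  have htn : t ≤ n := by
    have h₁ : ⌈((G.dist p q : ℕ) : ℝ) ^ μ⌉₊ ≤ G.dist p q := by
      refine Nat.ceil_le.2 ?_
      calc ((G.dist p q : ℕ) : ℝ) ^ μ ≤ ((G.dist p q : ℕ) : ℝ) ^ (1 : ℝ) :=
            Real.rpow_le_rpow_of_exponent_le (by exact_mod_cast hΔ0) hμ1.le
        _ = _ := Real.rpow_one _
    rw [ht, requiredCount]
    omega
  refine Runs.seq (T₁ := 5) (T₂ := 1759 * n ^ 3) (Runs.assign (by simp [Expr.eval, r2, h4]; omega)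
    ?_ (by simp [Expr.cost])) (by omega)
  refine Runs.seq (T₁ := 7) (T₂ := 1757 * n ^ 3) (Runs.assign (by
    simp [Expr.eval, r2, h4]
    rw [ht, requiredCount] at htn
    omega) ?_ (by simp [Expr.cost])) (by omega)
  refine Runs.seq (T₁ := 2) (T₂ := 1756 * n ^ 3) (Runs.assign (by simp [Expr.eval, hG₂.1]; omega)
    ?_ (by simp [Expr.cost])) (by omega)
  refine Runs.seq (T₁ := 2) (T₂ := 1755 * n ^ 3) (Runs.assign (by simp [Expr.eval]; omega)
    ?_ (by simp [Expr.cost])) (by omega)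
  refine Runs.seq (T₁ := 4) (T₂ := 1754 * n ^ 3) (Runs.assign (by simp [Expr.eval, hG₂.1]; omega)
    ?_ (by simp [Expr.cost])) (by omega)
  set s₃ := ((((s₂.setReg 4 (Expr.eval μ s₂ (Expr.sub (.get 4 (.reg 2)) (.const 1)))).setReg 6
    _).setReg 14 _).setReg 15 _).setReg 19 _ with hs₃
  have hsetup : HoldsSetup G p q t s₃ := by
    refine ⟨hG₂.of_eq (by simp [hs₃]) (by simp [hs₃]), by simp [hs₃, r1], by simp [hs₃, r2],
      by simp [hs₃, Expr.eval, r2, h4], ?_, by simpa [hs₃] using h4, by simpa [hs₃] using h5⟩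
    simp [hs₃, Expr.eval, r2, h4, ht, requiredCount]
  -- The initial ratio n/1 plays the role of infinity, since boundaries have fewer than n vertices.
  have hbest : HoldsBest n t (familyLength G p q) (familyBoundary G p q) (fun c' _ => c' < 0) s₃ := by
    simp [HoldsBest, hs₃, Expr.eval, hG₂.1, r13]
    omega
  have r19 : s₃.reg 19 = 2 * n := by simp [hs₃, Expr.eval, hG₂.1]
  have a1₃ : ∀ j, s₃.arr 1 j = 0 := by simpa [hs₃] using a1
  clear_value s₃
  refine Runs.seq (T₁ := (2 * n) * (((200 * n ^ 2 + 60) + (n * (n * (40 + 8) + 68) + 6)) + 8) + 6)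
    (T₂ := (200 * n ^ 2 + 60) + (n * (n * (20 + 8) + 68) + 8) + 4)
    (Runs.forLoop (m := 2 * n) (Tb := (200 * n ^ 2 + 60) + (n * (n * (40 + 8) + 68) + 6))
    (fun c s => HoldsBest n t (familyLength G p q) (familyBoundary G p q) (fun c' _ => c' < c) s)
    r19 (by omega) (by simp) (by decide) (by decide) ?_ ?_ ?_ le_rfl) ?_
  · exact hbest.of_eq (by simp) (by simp) (by simp)
  · intro c hc s hc7 hf hI
    have hset : HoldsSetup G p q t s := hsetup.of_frame hf
    refine Runs.seq (Runs.of_frame (familyProg_runs (by omega) hset hc7 hc) ?_) le_rfl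
    rintro s' hf' ⟨-, e₂, e₃⟩
    have hset' : HoldsSetup G p q t s' := hset.of_frame hf'
    refine (selectProg_runs (c := c) (by omega) (fun h hh => (familyBoundary_lt hh).le) hc hset'.1.1
      ((hf'.1 7 (by decide)).trans hc7) hset'.2.2.2.2.1 e₂ e₃
      (hI.of_eq (hf'.1 13 (by decide)) (hf'.1 14 (by decide)) (hf'.1 15 (by decide)))).mono le_rfl ?_
    intro s'' h
    exact h.of_eq (by simp) (by simp) (by simp)
  · intro s _ hf hI
    have hset : HoldsSetup G p q t s := hsetup.of_frame hf
    have a1s : ∀ j, s.arr 1 j = 0 := by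
      rwa [hf.2 1 (by decide)]
    have h13 : s.reg 13 < 2 * n := hI.2.2.2.1
    refine Runs.seq (T₁ := 2) (T₂ := (200 * n ^ 2 + 60) + (n * (n * (20 + 8) + 68) + 8) + 2)
      (Runs.assign (by simp [Expr.eval]; omega) ?_ (by simp [Expr.cost])) (by omega)
    have hset' : HoldsSetup G p q t (s.setReg 7 (Expr.eval μ s (.reg 13))) := by
      simpa [HoldsSetup, HoldsGraph] using hset
    refine Runs.seq (T₁ := 200 * n ^ 2 + 60) (T₂ := (n * (n * (20 + 8) + 68) + 8) + 2)
      (Runs.of_frame (familyProg_runs (c := s.reg 13) (by omega) hset'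
      (by simp [Expr.eval]) h13) ?_) (by omega)
    rintro s' hf' ⟨e₁, e₂, e₃⟩
    have hset'' : HoldsSetup G p q t s' := hset'.of_frame hf'
    refine Runs.seq (T₁ := n * (n * (20 + 8) + 68) + 8) (T₂ := 2) (Runs.mono
      (outProg_runs (B := s.reg 14) (S := s.reg 15) (by omega) hset''.1.1 e₁ e₂ e₃
        (by rw [hf'.1 14 (by decide)]; simp) (by rw [hf'.1 15 (by decide)]; simp)
        (by rw [hf'.2 1 (by decide)]; simpa using a1s)) le_rfl ?_) (by omega)
    rintro s'' ⟨g₁, g₂⟩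
    refine Runs.assign ?_ ?_ (by simp [Expr.cost])
    · simp only [Expr.eval, g₁]
      exact (Nat.count_le _).trans (by omega)
    · refine ⟨s.reg 13, s.reg 14, s.reg 15, hI.of_eq (by simp) (by simp) (by simp),
        by simpa [Expr.eval, familyLength] using g₁, ?_⟩
      intro h hh hg v
      refine (g₂ h hh hg v).trans ?_
      simp only [familyPrefix, bfsPrefix, List.mem_toFinset]
  · ring_nf
    have h₁ : n ≤ n ^ 3 := by omega
    have h₂ : 1 ≤ n ^ 3 := by omega
    nlinarith

/-- The algorithm finds at least the required number of nested prefixes of expansion at most `T`,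
if one of the searches has so many. -/
theorem exists_output [DecidableRel G.Adj] (hμ1 : μ < 1)
    (hG : G.Connected) {p q : Fin n} (hpq : p ≠ q) {T : ℝ}
    (hT : ∃ c < 2 * n, requiredCount μ (G.dist p q) ≤ (goodPrefixes G p q c T).card) :
    ∃ (t : ℕ) (S : Fin t → Finset (Fin n)), requiredCount μ (G.dist p q) ≤ t ∧ StrictMono S ∧
      (∀ j, (S j).Nonempty ∧ 2 * (S j).card ≤ n) ∧ (∀ j, nodeExpansion G (S j) ≤ T) ∧
      ((∀ j, p ∈ S j) ∨ (∀ j, q ∈ S j)) ∧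
      ∃ (final : State) (k : ℕ), Exec μ (n ^ 3) mainProg (input G p q) final k ∧
        Outputs final S ∧ k ≤ 2000 * n ^ 3 := by
  have hn : 2 ≤ n := by
    have hp := p.2
    have hq := q.2
    have : (p : ℕ) ≠ q := fun h => hpq (Fin.ext h)
    omega
  have ht0 : 0 < requiredCount μ (G.dist p q) := Nat.succ_pos _
  obtain ⟨final, k, hex, hk, c, B, S, ⟨b₁, b₂, b₃, b₄, b₅, b₆⟩, hreg, hout⟩ :=
    mainProg_runs hμ1 hn hG hpq
  obtain ⟨c₀, hc₀, hgood⟩ := hT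
  obtain ⟨h₀, e₁, e₂, e₃, e₄⟩ := exists_le_goodCount ht0 hgood
  have hbest := b₆ c₀ h₀ hc₀ e₁ e₂ e₄
  simp only [Nat.reduceEqDiff, if_true, if_false] at b₁ b₂ b₃ b₄ b₅ hbest
  -- The chosen ratio B/S is at most the ratio of h₀, which competed in the selection, and that is
  -- at most T.
  have hBS : (B : ℝ) ≤ T * S := by
    have h₁ : (B : ℝ) * (h₀ + 1) ≤ familyBoundary G p q c₀ h₀ * S := by exact_mod_cast hbest
    have hS : (0 : ℝ) ≤ S := Nat.cast_nonneg _
    have h₂ : (B : ℝ) * (h₀ + 1) ≤ (T * S) * (h₀ + 1) := by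
      nlinarith [mul_le_mul_of_nonneg_right e₃ hS]
    exact le_of_mul_le_mul_right h₂ (by positivity)
  have hreq : requiredCount μ (G.dist p q) ≤
      goodCount n (familyLength G p q c) (familyBoundary G p q c) B S := by
    -- The initial value n/1 cannot have survived, because the prefix h₀ + 1 has a smaller ratio.
    rcases b₅ with ⟨rfl, rfl⟩ | h
    · have := familyBoundary_lt e₁
      nlinarith
    · exact h
  set P := GoodAt n (familyLength G p q c) (familyBoundary G p q c) B S with hP
  choose f hf₁ hf₂ hf₃ using fun j : Fin (Nat.count P n) => exists_count_eq j.2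
  refine ⟨Nat.count P n, fun j => familyPrefix G p q c (f j + 1), hreq, ?_, ?_, ?_, ?_,
    final, k, hex, ⟨hreg, ?_⟩, hk⟩
  · intro i j hij
    have hfij : f i < f j := by
      by_contra hcon
      have := Nat.count_monotone P (not_lt.1 hcon)
      rw [hf₃, hf₃] at this
      exact absurd hij (not_lt.2 this)
    refine (Finset.ssubset_iff_subset_ne).2 ⟨bfsPrefix_mono (by omega), fun heq => ?_⟩
    have := congrArg Finset.card heq
    rw [card_familyPrefix (hf₂ i).1, card_familyPrefix (hf₂ j).1] at this
    omega
  · intro j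
    refine ⟨⟨_, mem_bfsPrefix (Nat.succ_pos _)⟩, ?_⟩
    rw [card_familyPrefix (hf₂ j).1]
    exact (hf₂ j).2.1
  · intro j
    have hcard : (((f j + 1 : ℕ)) : ℝ) = f j + 1 := by push_cast; ring
    rw [nodeExpansion, card_nodeBoundary_familyPrefix (hf₂ j).1, card_familyPrefix (hf₂ j).1, hcard,
      div_le_iff₀ (by positivity)]
    have h₁ : (familyBoundary G p q c (f j) : ℝ) * S ≤ B * (f j + 1) := by
      exact_mod_cast (hf₂ j).2.2
    have h₂ : (familyBoundary G p q c (f j) : ℝ) * S ≤ (T * (f j + 1)) * S := by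
      have : (0 : ℝ) ≤ f j + 1 := by positivity
      nlinarith [mul_le_mul_of_nonneg_right hBS this]
    exact le_of_mul_le_mul_right h₂ (by exact_mod_cast b₃)
  · have hsrc : ∀ j, familySource p q c ∈ familyPrefix G p q c (f j + 1) :=
      fun j => mem_bfsPrefix (Nat.succ_pos _)
    by_cases hc : c % 2 = 0
    · left; simpa [familySource, hc] using hsrc
    · right; simpa [familySource, hc] using hsrc
  · intro j v
    have := hout (f j) (hf₁ j) (hf₂ j) v
    rwa [hf₃ j] at this

end RAM

/-! ### Geometry of hyperbolic graphs: detours are exponentially long -/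

section Hyperbolic

variable {V : Type*} {G : SimpleGraph V} {δ : ℝ}

theorem mem_support_of_mem_take {u v x : V} (c : G.Walk u v) (k : ℕ) (h : x ∈ (c.take k).support) :
    x ∈ c.support := by
  rw [SimpleGraph.Walk.support_take] at h
  exact List.mem_of_mem_take h

theorem mem_support_of_mem_drop {u v x : V} (c : G.Walk u v) (k : ℕ) (h : x ∈ (c.drop k).support) :
    x ∈ c.support := by
  rw [SimpleGraph.Walk.drop_support_eq_support_drop_min] at h
  exact List.mem_of_mem_drop h

/-- `x` lies on a shortest path from `u` to `v`. -/
def SimpleGraph.Between (G : SimpleGraph V) (u x v : V) : Prop :=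
  G.dist u x + G.dist x v = G.dist u v

theorem between_of_mem_support (hG : G.Connected) {u v x : V} (P : G.Walk u v)
    (hP : P.length = G.dist u v) (hx : x ∈ P.support) : G.Between u x v := by
  classical
  have h₁ := SimpleGraph.dist_le (P.takeUntil x hx)
  have h₂ := SimpleGraph.dist_le (P.dropUntil x hx)
  have h₃ := congrArg SimpleGraph.Walk.length (P.take_spec hx)
  rw [SimpleGraph.Walk.length_append] at h₃
  have h₄ := hG.dist_triangle (u := u) (v := x) (w := v)
  unfold SimpleGraph.Between
  omega

/-- Thin triangles without naming paths: a shortest path through x is glued from two pieces, and the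
other two sides are arbitrary shortest paths. -/
theorem IsHyperbolic.exists_between (h : IsHyperbolic G δ) (hG : G.Connected) {u x v : V}
    (hx : G.Between u x v) (w : V) :
    ∃ y, (G.Between u y w ∨ G.Between v y w) ∧ (G.dist x y : ℝ) ≤ δ := by
  obtain ⟨P₁, h₁⟩ := hG.exists_walk_length_eq_dist u x
  obtain ⟨P₂, h₂⟩ := hG.exists_walk_length_eq_dist x v
  obtain ⟨Q, hQ⟩ := hG.exists_walk_length_eq_dist u w
  obtain ⟨R, hR⟩ := hG.exists_walk_length_eq_dist v w
  obtain ⟨y, hy, hxy⟩ := h u v w (P₁.append P₂) Q R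
    (by rw [SimpleGraph.Walk.length_append, h₁, h₂]; exact hx) hQ hR x (by simp)
  exact ⟨y, hy.imp (between_of_mem_support hG Q hQ) (between_of_mem_support hG R hR), hxy⟩

/-- In a hyperbolic graph, shortest paths stay logarithmically close to arbitrary walks. -/
theorem IsHyperbolic.exists_near_walk (h : IsHyperbolic G δ) (hG : G.Connected) {M : ℕ}
    (hM : (M : ℝ) ≤ 2 * δ) (N : ℕ) {u v : V} (c : G.Walk u v) (hc : c.length ≤ M * 2 ^ N) {x : V}
    (hx : G.Between u x v) : ∃ y ∈ c.support, (G.dist x y : ℝ) ≤ δ * (N + 1) := by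
  induction N generalizing u v x with
  | zero =>
    have h₁ : (G.dist u x : ℝ) + G.dist x v = G.dist u v := by exact_mod_cast hx
    have h₂ : (G.dist u v : ℝ) ≤ M := by
      exact_mod_cast (SimpleGraph.dist_le c).trans (by simpa using hc)
    -- The ends are at most M ≤ 2δ apart, so x is within δ of one of them.
    by_cases hu : (G.dist u x : ℝ) ≤ δ
    · exact ⟨u, c.start_mem_support, by rw [G.dist_comm]; simpa using hu⟩
    · exact ⟨v, c.end_mem_support, by simp; linarith⟩
  | succ N ih =>
    have hδ : (0 : ℝ) ≤ M := Nat.cast_nonneg M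
    -- The midpoint of the walk is the third corner of a triangle. At the price of δ, x moves to a
    -- side whose ends are joined by half of the walk.
    obtain ⟨y, hy, hxy⟩ := h.exists_between hG hx (c.getVert (c.length / 2))
    have key : ∃ z ∈ c.support, (G.dist y z : ℝ) ≤ δ * (N + 1) := by
      rw [pow_succ] at hc
      rcases hy with hy | hy
      · obtain ⟨z, hz, hyz⟩ := ih (c.take (c.length / 2))
          (by rw [SimpleGraph.Walk.take_length, ← mul_assoc] at *; omega) hy
        exact ⟨z, mem_support_of_mem_take c _ hz, hyz⟩
      · obtain ⟨z, hz, hyz⟩ := ih (c.drop (c.length / 2)).reverse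
          (by rw [SimpleGraph.Walk.length_reverse, SimpleGraph.Walk.drop_length, ← mul_assoc] at *; omega) hy
        rw [SimpleGraph.Walk.support_reverse, List.mem_reverse] at hz
        exact ⟨z, mem_support_of_mem_drop c _ hz, hyz⟩
    obtain ⟨z, hz, hyz⟩ := key
    refine ⟨z, hz, ?_⟩
    have : (G.dist x z : ℝ) ≤ G.dist x y + G.dist y z := by exact_mod_cast hG.dist_triangle
    push_cast
    linarith

theorem dist_triangle_real (hG : G.Connected) (u v w : V) :
    (G.dist u w : ℝ) ≤ G.dist u v + G.dist v w := by exact_mod_cast hG.dist_triangle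

/-- The difference of the distances to two vertices. -/
noncomputable def SimpleGraph.distDiff (G : SimpleGraph V) (p q u : V) : ℝ :=
  (G.dist p u : ℝ) - G.dist q u

/-- Two thin triangles: p, q, x and then q, x, y. If the point near w lay on the side from p to x,
or the next one on the side from q to y, the distance differences at x or y would contradict the
hypotheses. The second point has cost 2δ, hence the asymmetric margins 2δ and 4δ. -/
theorem IsHyperbolic.exists_between_near (h : IsHyperbolic G δ) (hG : G.Connected) {p q w x y : V}
    (hw : G.Between p w q) (hx : G.distDiff p q x < G.distDiff p q w - 2 * δ)
    (hy : G.distDiff p q w + 4 * δ < G.distDiff p q y) :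
    ∃ v, G.Between x v y ∧ (G.dist w v : ℝ) ≤ 2 * δ := by
  unfold SimpleGraph.distDiff at hx hy
  obtain ⟨v, hv | hv, hwv⟩ := h.exists_between hG hw x
  · have h₁ : (G.dist p v : ℝ) + G.dist v x = G.dist p x := by exact_mod_cast hv
    have h₂ := dist_triangle_real hG q v x
    have h₃ := dist_triangle_real hG p v w
    have h₄ := dist_triangle_real hG q w v
    rw [G.dist_comm (u := v) (v := w)] at h₃
    linarith
  · obtain ⟨v', hv' | hv', hvv'⟩ := h.exists_between hG hv y
    · have h₁ : (G.dist q v' : ℝ) + G.dist v' y = G.dist q y := by exact_mod_cast hv'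
      have h₂ := dist_triangle_real hG p v' y
      have h₃ := dist_triangle_real hG w v v'
      have h₄ := dist_triangle_real hG p w v'
      have h₅ := dist_triangle_real hG q v' w
      rw [G.dist_comm (u := v') (v := w)] at h₅
      linarith
    · exact ⟨v', hv', by have := dist_triangle_real hG w v v'; linarith⟩

theorem exists_between_dist_eq (hG : G.Connected) (p q : V) {j : ℕ} (hj : j ≤ G.dist p q) :
    ∃ w, G.dist p w = j ∧ G.dist w q = G.dist p q - j := by
  obtain ⟨c, hc⟩ := hG.exists_walk_length_eq_dist p q
  refine ⟨c.getVert j, ?_⟩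
  have h₁ := SimpleGraph.dist_le (c.take j)
  have h₂ := SimpleGraph.dist_le (c.drop j)
  rw [SimpleGraph.Walk.take_length] at h₁
  rw [SimpleGraph.Walk.drop_length] at h₂
  have h₃ := hG.dist_triangle (u := p) (v := c.getVert j) (w := q)
  omega

/-- A walk that keeps away from the middle of the shortest paths from `p` to `q` makes slow
progress. -/
theorem IsHyperbolic.distDiff_le (h : IsHyperbolic G δ) (hG : G.Connected) (hδ : 0 ≤ δ) {p q : V}
    {M N : ℕ} (hM : (M : ℝ) ≤ 2 * δ) (c : G.Walk p q)
    (hc : ∀ u ∈ c.support, ∀ w, G.Between p w q → |G.distDiff p q w| ≤ G.dist p q / 4 →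
      δ * (N + 3) < G.dist w u) (k : ℕ) (hk : (k : ℝ) * (6 * δ + 2) ≤ G.dist p q / 2) (i : ℕ)
    (hi : i ≤ k * (M * 2 ^ N)) :
    G.distDiff p q (c.getVert i) ≤ -(G.dist p q / 4) + k * (6 * δ + 2) := by
  induction k generalizing i with
  | zero =>
    have : i = 0 := by simpa using hi
    subst this
    have h0 : (0 : ℝ) ≤ G.dist p q := Nat.cast_nonneg _
    simp [SimpleGraph.distDiff, G.dist_comm (u := q) (v := p)]
    linarith
  | succ k ih =>
    push_cast at hk ⊢
    have hk' : (k : ℝ) * (6 * δ + 2) ≤ G.dist p q / 2 := by linarith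
    by_cases hik : i ≤ k * (M * 2 ^ N)
    · have := ih hk' i hik
      linarith
    by_contra! hcon
    set a := k * (M * 2 ^ N) with ha
    have hFa := ih hk' a le_rfl
    set b : ℝ := -(G.dist p q / 4) + k * (6 * δ + 2) with hb
    have hk0 : (0 : ℝ) ≤ k * (6 * δ + 2) := by positivity
    have hΔ0 : (0 : ℝ) ≤ G.dist p q := Nat.cast_nonneg _
    have hz0 : 0 ≤ (b + 2 * δ + G.dist p q) / 2 := by
      have : 0 ≤ b + G.dist p q := by rw [hb]; linarith
      linarith
    -- Choose w on a shortest path with distance difference 2j − dist(p,q) in the interval from b +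
    -- 2δ to b + 2δ + 2. The walk is at most b at step a and above b + 6δ + 2 at step i, so both
    -- margins of `exists_between_near` hold.
    set j := ⌊(b + 2 * δ + G.dist p q) / 2⌋₊ + 1 with hj
    have hj₁ : (j : ℝ) ≤ (b + 2 * δ + G.dist p q) / 2 + 1 := by
      rw [hj]; push_cast
      linarith [Nat.floor_le hz0]
    have hj₂ : (b + 2 * δ + G.dist p q) / 2 < j := by
      rw [hj]; push_cast
      exact Nat.lt_floor_add_one _
    have hbb : b + (6 * δ + 2) ≤ G.dist p q / 4 := by rw [hb]; linarith
    have hjΔ : j ≤ G.dist p q := by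
      have : (j : ℝ) ≤ G.dist p q := by linarith
      exact_mod_cast this
    obtain ⟨w, hw₁, hw₂⟩ := exists_between_dist_eq hG p q hjΔ
    have hw : G.Between p w q := by unfold SimpleGraph.Between; omega
    have hfw : G.distDiff p q w = 2 * j - G.dist p q := by
      rw [SimpleGraph.distDiff, hw₁, G.dist_comm (u := q), hw₂, Nat.cast_sub hjΔ]
      ring
    obtain ⟨v, hv, hwv⟩ := h.exists_between_near hG hw (x := c.getVert a) (y := c.getVert i)
      (by rw [hfw]; linarith) (by rw [hfw]; linarith)
    obtain ⟨e, rfl⟩ : ∃ e, i = a + e := ⟨i - a, by omega⟩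
    rw [← SimpleGraph.Walk.drop_getVert] at hv
    -- The segment from step a to step i has at most M·2^N edges, so it passes within δ(N+1) of v,
    -- hence within δ(N+3) of w: too close.
    obtain ⟨z, hz, hvz⟩ := h.exists_near_walk hG hM N ((c.drop a).take e)
      (by rw [SimpleGraph.Walk.take_length]; rw [add_mul, one_mul, ← ha] at hi; omega) hv
    have hz' : z ∈ c.support := mem_support_of_mem_drop c _ (mem_support_of_mem_take _ _ hz)
    have h₁ := hc z hz' w hw (by
      rw [hfw, abs_le]
      constructor <;> [(rw [hb] at hj₂; linarith); linarith])
    have h₂ := dist_triangle_real hG w v z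
    linarith

/-- A walk that keeps away from the middle of the shortest paths from `p` to `q` is long. -/
theorem IsHyperbolic.lt_length (h : IsHyperbolic G δ) (hG : G.Connected) (hδ : 1 / 2 ≤ δ) {p q : V}
    {N : ℕ} (hΔ : 40 * δ ≤ G.dist p q) (c : G.Walk p q)
    (hc : ∀ u ∈ c.support, ∀ w, G.Between p w q → |G.distDiff p q w| ≤ G.dist p q / 4 →
      δ * (N + 3) < G.dist w u) : (G.dist p q : ℝ) * 2 ^ N / 40 < c.length := by
  have hδ0 : 0 < δ := by linarith
  -- As 2δ ≥ 1, rounding down loses at most half: δ ≤ M ≤ 2δ.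
  set M := ⌊2 * δ⌋₊ with hM
  have hM₁ : (M : ℝ) ≤ 2 * δ := Nat.floor_le (by linarith)
  have hM₂ : δ ≤ M := by
    have h₁ : 1 ≤ M := Nat.le_floor (by push_cast; linarith)
    have h₂ := Nat.lt_floor_add_one (2 * δ)
    have h₃ : (1 : ℝ) ≤ M := by exact_mod_cast h₁
    rw [← hM] at h₂
    linarith
  -- Since 6δ + 2 ≤ 10δ, k blocks of M·2^N steps advance the difference by at most Δ/2, to at most
  -- Δ/4. At q it is Δ, so the walk is longer than k·M·2^N.
  set k := ⌊(G.dist p q : ℝ) / (20 * δ)⌋₊ with hk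
  have hk₁ : (k : ℝ) ≤ G.dist p q / (20 * δ) := Nat.floor_le (by positivity)
  have hk₂ : (G.dist p q : ℝ) / (40 * δ) ≤ k := by
    have h₀ : 2 ≤ (G.dist p q : ℝ) / (20 * δ) := by
      rw [le_div_iff₀ (by positivity)]; linarith
    have h₁ := Nat.lt_floor_add_one ((G.dist p q : ℝ) / (20 * δ))
    have h₂ : (G.dist p q : ℝ) / (40 * δ) = G.dist p q / (20 * δ) / 2 := by
      field_simp; ring
    rw [h₂]
    rw [← hk] at h₁
    linarith
  rw [le_div_iff₀ (by positivity)] at hk₁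
  rw [div_le_iff₀ (by positivity)] at hk₂
  have hkey : k * (M * 2 ^ N) < c.length := by
    by_contra hcon
    have hk₀ : (0 : ℝ) ≤ k := Nat.cast_nonneg _
    have hk₃ : (k : ℝ) * (6 * δ + 2) ≤ G.dist p q / 2 := by nlinarith
    have := h.distDiff_le hG hδ0.le hM₁ c hc k hk₃ c.length (not_lt.1 hcon)
    rw [SimpleGraph.Walk.getVert_length] at this
    simp only [SimpleGraph.distDiff, SimpleGraph.dist_self, Nat.cast_zero] at this
    nlinarith
  have hkey' : (k : ℝ) * (M * 2 ^ N) < c.length := by exact_mod_cast hkey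
  have h2 : (0 : ℝ) < 2 ^ N := by positivity
  have hk₀ : (0 : ℝ) ≤ k := Nat.cast_nonneg _
  have h₄ : (G.dist p q : ℝ) ≤ 40 * (k * M) := by nlinarith
  nlinarith

/-- A vertex with small Gromov product with respect to `p` and `q` is close to every shortest path
from `p` to `q`. -/
theorem IsHyperbolic.dist_le_of_dist_add_dist_le (h : IsHyperbolic G δ) (hG : G.Connected)
    (hδ : 0 ≤ δ) {p q u : V} (w : ℕ → V) (hw₁ : ∀ j ≤ G.dist p q, G.dist p (w j) = j)
    (hw₂ : ∀ j ≤ G.dist p q, G.dist (w j) q = G.dist p q - j)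
    (hw₃ : ∀ j < G.dist p q, G.dist (w j) (w (j + 1)) ≤ 1) :
    ∃ j ≤ G.dist p q, 2 * (G.dist (w j) u : ℝ) ≤
      G.dist p u + G.dist q u - G.dist p q + 4 * δ + 2 := by
  classical
  set Δ := G.dist p q with hΔ
  let A : ℕ → Prop := fun j => ∃ y, G.Between p y u ∧ (G.dist (w j) y : ℝ) ≤ δ
  let B : ℕ → Prop := fun j => ∃ y, G.Between q y u ∧ (G.dist (w j) y : ℝ) ≤ δ
  have hAB : ∀ j ≤ Δ, A j ∨ B j := by
    intro j hj
    have hb : G.Between p (w j) q := by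
      have := hw₁ j hj
      have := hw₂ j hj
      unfold SimpleGraph.Between
      omega
    obtain ⟨y, hy | hy, hwy⟩ := h.exists_between hG hb u
    · exact Or.inl ⟨y, hy, hwy⟩
    · exact Or.inr ⟨y, hy, hwy⟩
  have hw0 : w 0 = p := ((hG.dist_eq_zero_iff).1 (hw₁ 0 (Nat.zero_le _))).symm
  have hwΔ : w Δ = q := by
    have := hw₂ Δ le_rfl
    rw [Nat.sub_self] at this
    exact (hG.dist_eq_zero_iff).1 this
  have hA0 : A 0 := ⟨p, by simp [SimpleGraph.Between], by rw [hw0]; simpa using hδ⟩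
  have hBΔ : B Δ := ⟨q, by simp [SimpleGraph.Between], by rw [hwΔ]; simpa using hδ⟩
  -- Discrete continuity: the path starts near the side from p to u and ends near the side from q to
  -- u, and each of its points is near one of them. So the change occurs at one point or between two
  -- neighbours.
  have hex : ∃ j ≤ Δ, ∃ j' ≤ Δ, A j ∧ B j' ∧ G.dist (w j) (w j') ≤ 1 := by
    by_cases hall : ∀ j ≤ Δ, A j
    · exact ⟨Δ, le_rfl, Δ, le_rfl, hall Δ le_rfl, hBΔ, by simp⟩
    · push Not at hall
      have hfind := Nat.find_spec hall
      set j₁ := Nat.find hall with hj₁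
      obtain ⟨j, hj⟩ : ∃ j, j₁ = j + 1 := by
        refine ⟨j₁ - 1, ?_⟩
        have : j₁ ≠ 0 := fun h0 => hfind.2 (h0 ▸ hA0)
        omega
      have hAj : A j := by
        by_contra hcon
        have := Nat.find_min hall (m := j) (by omega)
        exact this ⟨by omega, hcon⟩
      refine ⟨j, by omega, j + 1, by omega, hAj, ?_, hw₃ j (by omega)⟩
      rw [← hj]
      exact (hAB j₁ hfind.1).resolve_left hfind.2
  obtain ⟨j, hj, j', hj', ⟨y, hy, hwy⟩, ⟨y', hy', hwy'⟩, hjj⟩ := hex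
  refine ⟨j, hj, ?_⟩
  have e₁ : (G.dist p y : ℝ) + G.dist y u = G.dist p u := by exact_mod_cast hy
  have e₂ : (G.dist q y' : ℝ) + G.dist y' u = G.dist q u := by exact_mod_cast hy'
  have e₃ : (G.dist (w j) (w j') : ℝ) ≤ 1 := by exact_mod_cast hjj
  have e₄ : (Δ : ℝ) ≤ G.dist p (w j) + G.dist (w j) q := dist_triangle_real hG _ _ _
  have t₁ := dist_triangle_real hG p y (w j)
  have t₂ := dist_triangle_real hG (w j) y u
  have t₃ := dist_triangle_real hG (w j') y' u
  have t₄ := dist_triangle_real hG q y' (w j')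
  have t₅ := dist_triangle_real hG (w j) (w j') u
  have t₆ := dist_triangle_real hG q (w j') (w j)
  rw [G.dist_comm (u := y)] at t₁
  rw [G.dist_comm (u := y')] at t₄
  rw [G.dist_comm (u := w j') (v := w j), G.dist_comm (u := q) (v := w j)] at t₆
  linarith

end Hyperbolic

/-- Walks from `p` to `q` outside of the removed set are long. -/
theorem lt_length_of_notMem_removedSet {n : ℕ} {G : SimpleGraph (Fin n)} {δ : ℝ} (h : IsHyperbolic G δ) (hG : G.Connected)
    (hδ : 1 / 2 ≤ δ) {p q : Fin n} {N ρ : ℕ} (hρ : 2 * δ * (N + 3) < ρ)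
    (hΔ : 8 * δ * (N + 3) < G.dist p q) (hN : 2 ≤ N) (c : G.Walk p q)
    (hc : ∀ u ∈ c.support, u ∉ removedSet G p q ρ) :
    (G.dist p q : ℝ) * 2 ^ N / 40 < c.length := by
  have hN' : (2 : ℝ) ≤ N := by exact_mod_cast hN
  refine h.lt_length hG hδ (by nlinarith) c ?_
  intro u hu w hw hfw
  by_contra! hcon
  refine hc u hu ?_
  have e₁ : (G.dist p w : ℝ) + G.dist w q = G.dist p q := by exact_mod_cast hw
  have t₁ := dist_triangle_real hG p w u
  have t₂ := dist_triangle_real hG q w u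
  have t₃ := dist_triangle_real hG p u w
  have t₄ := dist_triangle_real hG q u w
  rw [G.dist_comm (u := u) (v := w)] at t₃ t₄
  rw [G.dist_comm (u := q) (v := w)] at t₂ t₄
  rw [abs_le, SimpleGraph.distDiff, G.dist_comm (u := q) (v := w)] at hfw
  simp only [removedSet, Finset.mem_filter, Finset.mem_univ, true_and]
  -- Here w is at distance at least 3Δ/8 from p and from q, and u is within δ(N+3) < Δ/8 of w.
  refine ⟨?_, ?_, ?_⟩
  · have : (G.dist p u : ℝ) + G.dist q u < G.dist p q + ρ := by linarith
    exact_mod_cast this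
  · have : (G.dist p q : ℝ) < 4 * G.dist p u := by linarith [hfw.1]
    exact_mod_cast this
  · have : (G.dist p q : ℝ) < 4 * G.dist q u := by linarith [hfw.2]
    exact_mod_cast this

/-! ### The size of balls and of the removed set -/

section Balls

variable {n : ℕ} {G : SimpleGraph (Fin n)} [DecidableRel G.Adj]

/-- The strict inequality carries the induction, since 1 + d·(d^(k+1) − 1) < d^(k+2). -/
theorem card_ball_lt (hG : G.Connected) {d : ℕ} (hd : 2 ≤ d) (hdeg : ∀ v, G.degree v ≤ d) (w : Fin n)
    (k : ℕ) : (Finset.univ.filter fun u => G.dist w u ≤ k).card < d ^ (k + 1) := by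
  induction k with
  | zero =>
    have : (Finset.univ.filter fun u => G.dist w u ≤ 0) = {w} := by
      ext u
      simp [hG.dist_eq_zero_iff, eq_comm]
    rw [this, Finset.card_singleton, zero_add, pow_one]
    omega
  | succ k ih =>
    have hsub : (Finset.univ.filter fun u => G.dist w u ≤ k + 1) ⊆
        insert w ((Finset.univ.filter fun u => G.dist w u ≤ k).biUnion fun v => G.neighborFinset v) := by
      intro u hu
      simp only [Finset.mem_filter, Finset.mem_univ, true_and] at hu
      simp only [Finset.mem_insert, Finset.mem_biUnion, Finset.mem_filter, Finset.mem_univ, true_and,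
        SimpleGraph.mem_neighborFinset]
      rcases h : G.dist w u with _ | r
      · left; exact ((hG.dist_eq_zero_iff).1 h).symm
      · right
        obtain ⟨v, hv, hr⟩ := RAM.exists_adj_of_dist_eq_succ hG h
        exact ⟨v, by omega, hv⟩
    have h₁ := Finset.card_le_card hsub
    have h₂ := Finset.card_insert_le w
      ((Finset.univ.filter fun u => G.dist w u ≤ k).biUnion fun v => G.neighborFinset v)
    have h₃ := Finset.card_biUnion_le_card_mul (Finset.univ.filter fun u => G.dist w u ≤ k)
      (fun v => G.neighborFinset v) d (fun v _ => hdeg v)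
    have h₄ : d ^ (k + 1 + 1) = d ^ (k + 1) * d := pow_succ _ _
    nlinarith

/-- Every removed vertex is within k of one of the dist(p,q) + 1 vertices of a fixed shortest path.
-/
theorem card_removedSet_le {δ : ℝ} (h : IsHyperbolic G δ) (hG : G.Connected) (hδ : 0 ≤ δ) {d : ℕ}
    (hd : 2 ≤ d) (hdeg : ∀ v, G.degree v ≤ d) (p q : Fin n) {ρ k : ℕ}
    (hk : (ρ : ℝ) + 4 * δ + 2 ≤ 2 * k) :
    (removedSet G p q ρ).card ≤ (G.dist p q + 1) * d ^ (k + 1) := by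
  obtain ⟨c, hc⟩ := hG.exists_walk_length_eq_dist p q
  have h₁ : ∀ j ≤ G.dist p q, G.dist p (c.getVert j) = j ∧
      G.dist (c.getVert j) q = G.dist p q - j := by
    intro j hj
    have h₁ := SimpleGraph.dist_le (c.take j)
    have h₂ := SimpleGraph.dist_le (c.drop j)
    rw [SimpleGraph.Walk.take_length] at h₁
    rw [SimpleGraph.Walk.drop_length] at h₂
    have h₃ := hG.dist_triangle (u := p) (v := c.getVert j) (w := q)
    omega
  have hsub : removedSet G p q ρ ⊆ (Finset.range (G.dist p q + 1)).biUnion fun j =>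
      Finset.univ.filter fun u => G.dist (c.getVert j) u ≤ k := by
    intro u hu
    simp only [removedSet, Finset.mem_filter, Finset.mem_univ, true_and] at hu
    obtain ⟨j, hj, hju⟩ := h.dist_le_of_dist_add_dist_le hG hδ (u := u) c.getVert
      (fun j hj => (h₁ j hj).1) (fun j hj => (h₁ j hj).2)
      (fun j hj => ((SimpleGraph.dist_eq_one_iff_adj).2 (c.adj_getVert_succ (by omega))).le)
    simp only [Finset.mem_biUnion, Finset.mem_range, Finset.mem_filter, Finset.mem_univ, true_and]
    refine ⟨j, by omega, ?_⟩
    have h₂ : (G.dist p u : ℝ) + G.dist q u < G.dist p q + ρ := by exact_mod_cast hu.1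
    have h₃ : (G.dist (c.getVert j) u : ℝ) ≤ k := by linarith
    exact_mod_cast h₃
  refine (Finset.card_le_card hsub).trans ?_
  have := Finset.card_biUnion_le_card_mul (Finset.range (G.dist p q + 1))
    (fun j => Finset.univ.filter fun u => G.dist (c.getVert j) u ≤ k) (d ^ (k + 1))
    (fun j _ => (card_ball_lt hG hd hdeg _ k).le)
  simpa using this

end Balls

/-! ### Growth of balls outside a removed set -/

section Growth

/-- Steps in `P` multiply by 1 + β; at the other steps monotonicity suffices. -/
theorem pow_card_mul_le {f : ℕ → ℝ} (hf : Monotone f) {β : ℝ} (hβ : 0 ≤ β)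
    (P : ℕ → Prop) [DecidablePred P] {a b : ℕ} (hab : a ≤ b)
    (h : ∀ r, a ≤ r → r < b → P r → (1 + β) * f r ≤ f (r + 1)) :
    (1 + β) ^ ((Finset.Ico a b).filter P).card * f a ≤ f b := by
  induction b, hab using Nat.le_induction with
  | base => simp
  | succ b hab ih =>
    have ih' := ih fun r h₁ h₂ => h r h₁ (by omega)
    rw [Nat.Ico_succ_right_eq_insert_Ico hab, Finset.filter_insert]
    split_ifs with hP
    · rw [Finset.card_insert_of_notMem (by simp), pow_succ]
      calc _ = (1 + β) * ((1 + β) ^ ((Finset.Ico a b).filter P).card * f a) := by ring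
        _ ≤ (1 + β) * f b := by gcongr
        _ ≤ _ := h b hab (by omega) hP
    · exact ih'.trans (hf (Nat.le_succ b))

variable {n : ℕ} {G : SimpleGraph (Fin n)} {D : Finset (Fin n)} {x : Fin n}

open Classical in
/-- The vertices that can be reached from `x` in at most `r` steps in `G` outside `D`. -/
noncomputable def avoidBall (G : SimpleGraph (Fin n)) (D : Finset (Fin n)) (x : Fin n) :
    ℕ → Finset (Fin n)
  | 0 => {x}
  | r + 1 => Finset.univ.filter fun u => (u = x ∨ ∃ v ∈ avoidBall G D x r, G.Adj v u) ∧ u ∉ D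

theorem mem_avoidBall_succ {r : ℕ} {u : Fin n} : u ∈ avoidBall G D x (r + 1) ↔
    (u = x ∨ ∃ v ∈ avoidBall G D x r, G.Adj v u) ∧ u ∉ D := by
  simp [avoidBall]

theorem avoidBall_mono (hx : x ∉ D) : Monotone (avoidBall G D x) := by
  refine monotone_nat_of_le_succ fun r => ?_
  induction r with
  | zero =>
    intro u hu
    simp only [avoidBall, Finset.mem_singleton] at hu
    exact mem_avoidBall_succ.2 ⟨Or.inl hu, hu ▸ hx⟩
  | succ r ih =>
    intro u hu
    rw [mem_avoidBall_succ] at hu ⊢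
    exact ⟨hu.1.imp_right fun ⟨v, hv, h⟩ => ⟨v, ih hv, h⟩, hu.2⟩

theorem mem_avoidBall_self (hx : x ∉ D) (r : ℕ) : x ∈ avoidBall G D x r :=
  avoidBall_mono hx (Nat.zero_le r) (by simp [avoidBall])

theorem card_avoidBall_pos (hx : x ∉ D) (r : ℕ) : 0 < (avoidBall G D x r).card :=
  Finset.card_pos.2 ⟨x, mem_avoidBall_self hx r⟩

/-- By induction on r: the next ball is the source with the neighbours of the present ball, without
D, and this operation maps prefixes to prefixes. -/
theorem avoidBall_eq_bfsPrefix (hx : x ∉ D) (r : ℕ) :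
    (avoidBall G D x r).card ≤ (bfsOrder G D x).length ∧
      avoidBall G D x r = bfsPrefix G D x (avoidBall G D x r).card := by
  have key : ∃ l ≤ (bfsOrder G D x).length, avoidBall G D x r = bfsPrefix G D x l := by
    induction r with
    | zero =>
      obtain ⟨t, ht⟩ := head_bfsOrder (G := G) (D := D) (x := x)
      exact ⟨1, by simp [ht], by rw [bfsPrefix_one]; rfl⟩
    | succ r ih =>
      obtain ⟨k, hk, hr⟩ := ih
      obtain ⟨l, hl, h⟩ := exists_bfsPrefix_eq_neighbors (G := G) hx (hk.trans bfsOrder_length_le)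
      refine ⟨l, hl, ?_⟩
      ext u
      rw [h, mem_avoidBall_succ, hr]
  obtain ⟨l, hl, h⟩ := key
  have hc : (avoidBall G D x r).card = l := by rw [h, card_bfsPrefix hl]
  exact ⟨hc ▸ hl, by rw [hc]; exact h⟩

theorem exists_walk_of_mem_avoidBall (hx : x ∉ D) {r : ℕ} {u : Fin n} (hu : u ∈ avoidBall G D x r) :
    ∃ c : G.Walk x u, c.length ≤ r ∧ ∀ v ∈ c.support, v ∉ D := by
  induction r generalizing u with
  | zero =>
    simp only [avoidBall, Finset.mem_singleton] at hu
    subst hu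
    exact ⟨.nil, by simp, by simpa using hx⟩
  | succ r ih =>
    rw [mem_avoidBall_succ] at hu
    obtain ⟨rfl | ⟨v, hv, hadj⟩, huD⟩ := hu
    · exact ⟨.nil, by simp, by simpa using hx⟩
    · obtain ⟨c, hc, hcD⟩ := ih hv
      refine ⟨c.concat hadj, by simpa using hc, ?_⟩
      intro w hw
      rw [SimpleGraph.Walk.support_concat, List.mem_append, List.mem_singleton] at hw
      rcases hw with hw | rfl
      · exact hcD w hw
      · exact huD

theorem dist_le_of_mem_avoidBall (hx : x ∉ D) {r : ℕ} {u : Fin n} (hu : u ∈ avoidBall G D x r) :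
    G.dist x u ≤ r := by
  obtain ⟨c, hc, -⟩ := exists_walk_of_mem_avoidBall hx hu
  exact (SimpleGraph.dist_le c).trans hc

theorem disjoint_avoidBall {p q : Fin n} (hp : p ∉ D) (hq : q ∉ D) {L : ℕ}
    (h : ∀ c : G.Walk p q, (∀ u ∈ c.support, u ∉ D) → 2 * L < c.length) :
    Disjoint (avoidBall G D p L) (avoidBall G D q L) := by
  rw [Finset.disjoint_left]
  intro u hu hu'
  obtain ⟨c, hc, hcD⟩ := exists_walk_of_mem_avoidBall hp hu
  obtain ⟨c', hc', hcD'⟩ := exists_walk_of_mem_avoidBall hq hu'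
  have := h (c.append c'.reverse) (by
    intro v hv
    rw [SimpleGraph.Walk.mem_support_append_iff, SimpleGraph.Walk.support_reverse,
      List.mem_reverse] at hv
    exact hv.elim (hcD v) (hcD' v))
  rw [SimpleGraph.Walk.length_append, SimpleGraph.Walk.length_reverse] at this
  omega

variable [DecidableRel G.Adj]

theorem mem_nodeBoundary {S : Finset (Fin n)} {u : Fin n} :
    u ∈ nodeBoundary G S ↔ u ∉ S ∧ ∃ v ∈ S, G.Adj u v := by
  simp [nodeBoundary]

theorem nodeBoundary_nonempty (hG : G.Connected) {S : Finset (Fin n)} (hS : S.Nonempty)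
    (hS' : 2 * S.card ≤ n) : (nodeBoundary G S).Nonempty := by
  obtain ⟨x, hx⟩ := hS
  have hlt : S.card < (Finset.univ : Finset (Fin n)).card := by
    have := Finset.card_pos.2 ⟨x, hx⟩
    rw [Finset.card_univ, Fintype.card_fin]
    omega
  obtain ⟨y, -, hy⟩ := Finset.exists_mem_notMem_of_card_lt_card hlt
  obtain ⟨c⟩ := hG.preconnected x y
  obtain ⟨d, -, h₁, h₂⟩ := c.exists_boundary_dart (S : Set (Fin n)) (by simpa using hx) (by simpa using hy)
  exact ⟨d.snd, mem_nodeBoundary.2 ⟨by simpa using h₂, d.fst, by simpa using h₁, d.adj.symm⟩⟩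

theorem nodeBoundary_sdiff_subset (r : ℕ) :
    nodeBoundary G (avoidBall G D x r) \ D ⊆ avoidBall G D x (r + 1) := by
  intro u hu
  rw [Finset.mem_sdiff, mem_nodeBoundary] at hu
  obtain ⟨⟨-, v, hv, h⟩, huD⟩ := hu
  exact mem_avoidBall_succ.2 ⟨Or.inr ⟨v, hv, h.symm⟩, huD⟩

theorem card_add_card_le_avoidBall (hx : x ∉ D) (r : ℕ) :
    (avoidBall G D x r).card + (nodeBoundary G (avoidBall G D x r) \ D).card ≤
      (avoidBall G D x (r + 1)).card := by
  rw [← Finset.card_union_of_disjoint]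
  · exact Finset.card_le_card (Finset.union_subset (avoidBall_mono hx (Nat.le_succ r))
      (nodeBoundary_sdiff_subset r))
  · rw [Finset.disjoint_left]
    intro u hu hu'
    rw [Finset.mem_sdiff, mem_nodeBoundary] at hu'
    exact hu'.1.1 hu

/-- Boundary vertices outside D enter the next ball, so at most |D| of them are lost. -/
theorem card_add_card_boundary_le_avoidBall (hx : x ∉ D) (r : ℕ) :
    (avoidBall G D x r).card + (nodeBoundary G (avoidBall G D x r)).card ≤
      (avoidBall G D x (r + 1)).card + D.card := by
  have h₁ := card_add_card_le_avoidBall (G := G) hx r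
  have h₂ := Finset.le_card_sdiff D (nodeBoundary G (avoidBall G D x r))
  omega

/-- Below the minimal distance of the removed set, boundary vertices belong to the next ball. -/
theorem nodeBoundary_sdiff_eq (hG : G.Connected) (hx : x ∉ D) {r : ℕ}
    (hr : ∀ u ∈ D, r + 1 < G.dist x u) :
    nodeBoundary G (avoidBall G D x r) \ D = nodeBoundary G (avoidBall G D x r) := by
  rw [Finset.sdiff_eq_self_iff_disjoint, Finset.disjoint_left]
  intro u hu huD
  obtain ⟨-, v, hv, h⟩ := mem_nodeBoundary.1 hu
  have h₁ := dist_le_of_mem_avoidBall hx hv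
  have h₂ := hG.dist_triangle (u := x) (v := v) (w := u)
  rw [(SimpleGraph.dist_eq_one_iff_adj).2 h.symm] at h₂
  have := hr u huD
  omega

end Growth

/-! ### Searches with many prefixes of small expansion -/

section Families

variable {n : ℕ} {G : SimpleGraph (Fin n)} {p q : Fin n} {c : ℕ} {T : ℝ}

/-- The balls of the search with number `c`. -/
noncomputable def familyBall (G : SimpleGraph (Fin n)) (p q : Fin n) (c r : ℕ) : Finset (Fin n) :=
  avoidBall G (removedSet G p q (c / 2)) (familySource p q c) r

theorem familyBall_eq_familyPrefix (r : ℕ) :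
    (familyBall G p q c r).card ≤ familyLength G p q c ∧
      familyBall G p q c r = familyPrefix G p q c (familyBall G p q c r).card :=
  avoidBall_eq_bfsPrefix (familySource_notMem G p q c _) r

theorem card_familyBall_pos (r : ℕ) : 0 < (familyBall G p q c r).card :=
  card_avoidBall_pos (familySource_notMem G p q c _) r

theorem removedSet_zero (hG : G.Connected) : removedSet G p q 0 = ∅ := by
  ext u
  simp only [removedSet, Finset.mem_filter, Finset.mem_univ, true_and, Finset.notMem_empty,
    iff_false, not_and]
  intro h
  have := hG.dist_triangle (u := p) (v := u) (w := q)
  rw [G.dist_comm (u := u)] at this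
  omega

/-- The search without removed vertices reaches all vertices. -/
theorem familyLength_eq (hG : G.Connected) (hc : c < 2) : familyLength G p q c = n := by
  refine le_antisymm (familyLength_le c) ?_
  have hD : removedSet G p q (c / 2) = ∅ := by
    rw [Nat.div_eq_of_lt hc, removedSet_zero hG]
  have hall : ∀ r u, G.dist (familySource p q c) u ≤ r → u ∈ familyBall G p q c r := by
    intro r
    induction r with
    | zero =>
      intro u hu
      have := (hG.dist_eq_zero_iff).1 (Nat.le_zero.1 hu)
      simp [familyBall, avoidBall, this]
    | succ r ih =>
      intro u hu
      refine mem_avoidBall_succ.2 ⟨?_, by simp [hD]⟩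
      rcases h : G.dist (familySource p q c) u with _ | k
      · left; exact ((hG.dist_eq_zero_iff).1 h).symm
      · obtain ⟨v, hv, hr⟩ := RAM.exists_adj_of_dist_eq_succ hG h
        exact Or.inr ⟨v, ih v (by omega), hv⟩
  have huniv : familyBall G p q c n = Finset.univ :=
    Finset.eq_univ_of_forall fun u => hall n u (RAM.dist_lt_of_connected hG _ u).le
  have := (familyBall_eq_familyPrefix (G := G) (p := p) (q := q) (c := c) n).1
  rwa [huniv, Finset.card_univ, Fintype.card_fin] at this

/-- One of the two searches with the same slack stays below half of the vertices. -/
theorem exists_familyBall_card_le {ρ L : ℕ}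
    (h : ∀ w : G.Walk p q, (∀ u ∈ w.support, u ∉ removedSet G p q ρ) → 2 * L < w.length) :
    ∃ c, c / 2 = ρ ∧ 2 * (familyBall G p q c L).card ≤ n := by
  have hdisj : Disjoint (avoidBall G (removedSet G p q ρ) p L) (avoidBall G (removedSet G p q ρ) q L) :=
    disjoint_avoidBall (familySource_notMem G p q 0 ρ) (familySource_notMem G p q 1 ρ) h
  have hcard : (avoidBall G (removedSet G p q ρ) p L).card +
      (avoidBall G (removedSet G p q ρ) q L).card ≤ n := by
    rw [← Finset.card_union_of_disjoint hdisj]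
    simpa using Finset.card_le_univ (avoidBall G (removedSet G p q ρ) p L ∪ avoidBall G (removedSet G p q ρ) q L)
  have hp : familyBall G p q (2 * ρ) L = avoidBall G (removedSet G p q ρ) p L := by
    have h₁ : 2 * ρ / 2 = ρ := by omega
    simp [familyBall, familySource, h₁]
  have hq : familyBall G p q (2 * ρ + 1) L = avoidBall G (removedSet G p q ρ) q L := by
    have h₁ : (2 * ρ + 1) / 2 = ρ := by omega
    have h₂ : (2 * ρ + 1) % 2 = 1 := by omega
    simp [familyBall, familySource, h₁, h₂]
  by_cases hle : 2 * (avoidBall G (removedSet G p q ρ) p L).card ≤ n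
  · exact ⟨2 * ρ, by omega, by rwa [hp]⟩
  · exact ⟨2 * ρ + 1, by omega, by rw [hq]; omega⟩

theorem familyBall_card_le {r L : ℕ} (hr : r ≤ L) (h : 2 * (familyBall G p q c L).card ≤ n) :
    2 * (familyBall G p q c r).card ≤ n := by
  have := Finset.card_le_card (avoidBall_mono (G := G) (familySource_notMem G p q c (c / 2)) hr)
  unfold familyBall at *
  omega

variable [DecidableRel G.Adj]

theorem mem_goodPrefixes {s : ℕ} (hs₀ : 0 < s) (hs : s ≤ familyLength G p q c) (hsn : 2 * s ≤ n)
    (hT : ((nodeBoundary G (familyPrefix G p q c s)).card : ℝ) ≤ T * s) :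
    s - 1 ∈ goodPrefixes G p q c T := by
  obtain ⟨h, rfl⟩ : ∃ h, s = h + 1 := ⟨s - 1, by omega⟩
  rw [card_nodeBoundary_familyPrefix hs] at hT
  simp only [goodPrefixes, Finset.mem_filter, Finset.mem_range, Nat.add_sub_cancel]
  exact ⟨by omega, hs, hsn, by exact_mod_cast hT⟩

/-- Either many balls have small expansion, or the balls grow fast. -/
theorem pow_mul_card_familyBall_le {a b t : ℕ} (hab : a ≤ b) {β : ℝ} (hβ : 0 ≤ β)
    (hn : ∀ r, a ≤ r → r < b → 2 * (familyBall G p q c r).card ≤ n)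
    (hlt : ∀ r, a ≤ r → r < b → (familyBall G p q c r).card < (familyBall G p q c (r + 1)).card)
    (hbad : ∀ r, a ≤ r → r < b → T * (familyBall G p q c r).card <
      (nodeBoundary G (familyBall G p q c r)).card →
      (1 + β) * (familyBall G p q c r).card ≤ (familyBall G p q c (r + 1)).card)
    (ht : (goodPrefixes G p q c T).card < t) :
    (1 + β) ^ (b - a - t) * (familyBall G p q c a).card ≤ (familyBall G p q c b).card := by
  classical
  set P : ℕ → Prop := fun r => T * (familyBall G p q c r).card <
      (nodeBoundary G (familyBall G p q c r)).card with hP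
  have hmono : Monotone fun r => ((familyBall G p q c r).card : ℝ) := fun r r' h => by
    change ((familyBall G p q c r).card : ℝ) ≤ (familyBall G p q c r').card
    exact_mod_cast Finset.card_le_card (avoidBall_mono (G := G) (familySource_notMem G p q c (c / 2)) h)
  have key := pow_card_mul_le hmono hβ P hab (fun r h₁ h₂ h₃ => hbad r h₁ h₂ h₃)
  -- Balls grow strictly, so distinct radii of small expansion give prefixes of distinct sizes:
  -- there are fewer than t such radii.
  have hgood : ((Finset.Ico a b).filter fun r => ¬ P r).card ≤ (goodPrefixes G p q c T).card := by
    refine Finset.card_le_card_of_injOn (fun r => (familyBall G p q c r).card - 1) ?_ ?_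
    · intro r hr
      simp only [Finset.coe_filter, Finset.mem_Ico, Set.mem_ofPred_eq, hP, not_lt] at hr
      obtain ⟨h₁, h₂⟩ := familyBall_eq_familyPrefix (G := G) (p := p) (q := q) (c := c) r
      refine mem_goodPrefixes (card_familyBall_pos r) h₁ (hn r hr.1.1 hr.1.2) ?_
      rw [← h₂]
      exact hr.2
    · have hstrict : ∀ r s, a ≤ r → s < b → r < s →
          (familyBall G p q c r).card < (familyBall G p q c s).card := by
        intro r s h₁ h₂ h₃
        refine (hlt r h₁ (by omega)).trans_le ?_
        exact Finset.card_le_card (avoidBall_mono (familySource_notMem G p q c _) h₃)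
      intro r hr s hs hrs
      simp only [Finset.coe_filter, Finset.mem_Ico, Set.mem_ofPred_eq] at hr hs hrs
      have h₁ := card_familyBall_pos (G := G) (p := p) (q := q) (c := c) r
      have h₂ := card_familyBall_pos (G := G) (p := p) (q := q) (c := c) s
      rcases lt_trichotomy r s with h | h | h
      · have := hstrict r s hr.1.1 hs.1.2 h
        omega
      · exact h
      · have := hstrict s r hs.1.1 hr.1.2 h
        omega
  have hsum : ((Finset.Ico a b).filter P).card + ((Finset.Ico a b).filter fun r => ¬ P r).card =
      b - a := by
    rw [Finset.card_filter_add_card_filter_not, Nat.card_Ico]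
  refine le_trans ?_ key
  gcongr
  · linarith
  · omega

theorem card_nodeBoundary_add_card_le (S : Finset (Fin n)) : (nodeBoundary G S).card + S.card ≤ n := by
  rw [← Finset.card_union_of_disjoint]
  · simpa using Finset.card_le_univ (nodeBoundary G S ∪ S)
  · rw [Finset.disjoint_left]
    intro u hu
    exact (mem_nodeBoundary.1 hu).1

/-- Sets of nearly half of the vertices have expansion at most `2`. -/
theorem card_goodPrefixes_of_two_le (hG : G.Connected) {t : ℕ} (hT : 2 ≤ T)
    (ht : 6 * t + 3 ≤ n) : t ≤ (goodPrefixes G p q 0 T).card := by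
  -- These prefixes have between n/3 and n/2 vertices, so fewer than twice as many, or as many, are
  -- left outside.
  have hsub : Finset.Ico (n / 2 - t) (n / 2) ⊆ goodPrefixes G p q 0 T := by
    intro h hh
    rw [Finset.mem_Ico] at hh
    have hlen := familyLength_eq (p := p) (q := q) (c := 0) hG (by omega)
    refine mem_goodPrefixes (s := h + 1) (by omega) (by omega) (by omega) ?_
    have h₁ := card_nodeBoundary_add_card_le (G := G) (familyPrefix G p q 0 (h + 1))
    rw [card_familyPrefix (by omega)] at h₁
    have h₂ : (nodeBoundary G (familyPrefix G p q 0 (h + 1))).card ≤ 2 * (h + 1) := by omega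
    have h₃ : ((nodeBoundary G (familyPrefix G p q 0 (h + 1))).card : ℝ) ≤ 2 * ((h + 1 : ℕ) : ℝ) := by
      exact_mod_cast h₂
    have h₄ : (0 : ℝ) ≤ ((h + 1 : ℕ) : ℝ) := Nat.cast_nonneg _
    nlinarith
  have := Finset.card_le_card hsub
  rw [Nat.card_Ico] at this
  omega

/-- Growth of the balls of a search where they do not meet the removed set. -/
theorem pow_le_card_familyBall (hG : G.Connected) {R t : ℕ} (hT : 0 ≤ T)
    (hD : ∀ u ∈ removedSet G p q (c / 2), R < G.dist (familySource p q c) u)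
    (hn : 2 * (familyBall G p q c R).card ≤ n) (ht : (goodPrefixes G p q c T).card < t) :
    (1 + T) ^ (R - t) ≤ (familyBall G p q c R).card := by
  have hx := familySource_notMem G p q c (c / 2)
  have hstep : ∀ r < R, (familyBall G p q c r).card +
      (nodeBoundary G (familyBall G p q c r)).card ≤ (familyBall G p q c (r + 1)).card := by
    intro r hr
    have h₁ := card_add_card_le_avoidBall (G := G) hx r
    rwa [nodeBoundary_sdiff_eq hG hx fun u hu => by have := hD u hu; omega] at h₁
  have := pow_mul_card_familyBall_le (G := G) (p := p) (q := q) (c := c) (T := T) (a := 0) (b := R)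
    (t := t) (Nat.zero_le R) hT (fun r _ hr => familyBall_card_le hr.le hn) ?_ ?_ ht
  · simpa [familyBall, avoidBall] using this
  · intro r _ hr
    have h₁ := hstep r hr
    have h₂ := Finset.card_pos.2 (nodeBoundary_nonempty hG
      (Finset.card_pos.1 (card_familyBall_pos (G := G) (p := p) (q := q) (c := c) r))
      (familyBall_card_le hr.le hn))
    omega
  · intro r _ hr hbad
    have h₁ : ((familyBall G p q c r).card : ℝ) + (nodeBoundary G (familyBall G p q c r)).card ≤
        (familyBall G p q c (r + 1)).card := by exact_mod_cast hstep r hr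
    linarith

/-- If removing few vertices separates `p` and `q` far enough, then one of the searches has many
prefixes of small expansion. -/
theorem exists_goodPrefixes_of_removedSet (hG : G.Connected) {ρ L t : ℕ} (hT : 0 < T) (hT2 : T ≤ 2)
    (hw : ∀ w : G.Walk p q, (∀ u ∈ w.support, u ∉ removedSet G p q ρ) → 2 * L < w.length)
    (hRL : G.dist p q / 4 ≤ L)
    (hD : ((removedSet G p q ρ).card + t : ℝ) ≤ T / 4 * (1 + T) ^ (G.dist p q / 4 - t))
    (hL : Real.log n < T / 4 * (L - G.dist p q / 4 - t : ℕ)) :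
    ∃ c, c / 2 = ρ ∧ t ≤ (goodPrefixes G p q c T).card := by
  obtain ⟨c, rfl, hcn⟩ := exists_familyBall_card_le hw
  refine ⟨c, rfl, ?_⟩
  by_contra! hlt
  set R := G.dist p q / 4 with hR
  have hx := familySource_notMem G p q c (c / 2)
  have hnR : 2 * (familyBall G p q c R).card ≤ n := familyBall_card_le hRL hcn
  have hM := pow_le_card_familyBall (R := R) hG hT.le (by
    intro u hu
    simp only [removedSet, Finset.mem_filter, Finset.mem_univ, true_and] at hu
    unfold familySource
    split_ifs <;> omega) hnR hlt
  set M : ℝ := ((familyBall G p q c R).card : ℝ) with hMdef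
  have hDM : ((removedSet G p q (c / 2)).card + t : ℝ) ≤ T / 4 * M :=
    hD.trans (mul_le_mul_of_nonneg_left hM (by linarith))
  have hD0 : (0 : ℝ) ≤ (removedSet G p q (c / 2)).card := Nat.cast_nonneg _
  have ht0 : (0 : ℝ) ≤ t := Nat.cast_nonneg _
  have hM1 : 1 ≤ M := by
    rw [hMdef]
    exact_mod_cast card_familyBall_pos (G := G) (p := p) (q := q) (c := c) R
  have hMr : ∀ r, R ≤ r → M ≤ (familyBall G p q c r).card := fun r hr => by
    rw [hMdef]
    exact_mod_cast Finset.card_le_card (avoidBall_mono (G := G) hx hr)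
  by_cases hstall : ∃ r, R ≤ r ∧ r < L ∧ (familyBall G p q c (r + 1)).card ≤ (familyBall G p q c r).card
  · obtain ⟨r, hr₁, hr₂, hr₃⟩ := hstall
    have hbd : nodeBoundary G (familyBall G p q c r) ⊆ removedSet G p q (c / 2) := by
      have h₁ := card_add_card_le_avoidBall (G := G) hx r
      have h₂ : (nodeBoundary G (familyBall G p q c r) \ removedSet G p q (c / 2)).card = 0 := by
        unfold familyBall at *
        omega
      rwa [Finset.card_eq_zero, Finset.sdiff_eq_empty_iff_subset] at h₂
    obtain ⟨g₁, g₂⟩ := familyBall_eq_familyPrefix (G := G) (p := p) (q := q) (c := c) r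
    have g₃ := familyBall_card_le hr₂.le hcn
    have g₄ := hMr r hr₁
    set s₀ := (familyBall G p q c r).card with hs₀
    -- From t ≤ (T/4)·M with T ≤ 2 and M ≤ s₀: dropping up to t vertices keeps at least half of the
    -- ball.
    have hts : (2 : ℝ) * t ≤ s₀ := by nlinarith
    have hts' : 2 * t ≤ s₀ := by exact_mod_cast hts
    have hs₀pos : 0 < s₀ := card_familyBall_pos r
    -- The stalled ball has its boundary in D. A prefix missing fewer than t of its vertices has at
    -- most |D| + t ≤ (T/4)·s₀ boundary vertices, and its size is at least s₀/2.
    have hsub : Finset.Ico (s₀ - t) s₀ ⊆ goodPrefixes G p q c T := by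
      intro h hh
      rw [Finset.mem_Ico] at hh
      refine mem_goodPrefixes (s := h + 1) (by omega) (by omega) (by omega) ?_
      have hb : nodeBoundary G (familyPrefix G p q c (h + 1)) ⊆ removedSet G p q (c / 2) ∪
          (familyBall G p q c r \ familyPrefix G p q c (h + 1)) := by
        intro u hu
        obtain ⟨hu₁, v, hv, huv⟩ := mem_nodeBoundary.1 hu
        rw [Finset.mem_union, Finset.mem_sdiff]
        by_cases hur : u ∈ familyBall G p q c r
        · exact Or.inr ⟨hur, hu₁⟩
        · refine Or.inl (hbd (mem_nodeBoundary.2 ⟨hur, v, ?_, huv⟩))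
          rw [g₂]
          exact bfsPrefix_mono (by omega) hv
      have h₁ := (Finset.card_le_card hb).trans (Finset.card_union_le _ _)
      have hss : familyPrefix G p q c (h + 1) ⊆ familyBall G p q c r := by
        rw [g₂]
        exact bfsPrefix_mono (by omega)
      rw [Finset.card_sdiff_of_subset hss, card_familyPrefix (by omega), ← hs₀] at h₁
      have h₂ : (nodeBoundary G (familyPrefix G p q c (h + 1))).card ≤
          (removedSet G p q (c / 2)).card + t := by omega
      have h₃ : ((nodeBoundary G (familyPrefix G p q c (h + 1))).card : ℝ) ≤
          (removedSet G p q (c / 2)).card + t := by exact_mod_cast h₂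
      have h₄ : (s₀ : ℝ) ≤ 2 * ((h + 1 : ℕ) : ℝ) := by
        have : s₀ ≤ 2 * (h + 1) := by omega
        exact_mod_cast this
      nlinarith
    have := Finset.card_le_card hsub
    rw [Nat.card_Ico] at this
    omega
  · push Not at hstall
    have key := pow_mul_card_familyBall_le (G := G) (p := p) (q := q) (c := c) (T := T) (a := R)
      (b := L) (t := t) (β := T / 2) hRL (by linarith)
      (fun r _ hr => familyBall_card_le hr.le hcn) hstall ?_ hlt
    · have h₁ : ((familyBall G p q c L).card : ℝ) ≤ n := by
        have : (familyBall G p q c L).card ≤ n := by omega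
        exact_mod_cast this
      have h₂ : (1 + T / 2) ^ (L - R - t) ≤ (n : ℝ) := by
        refine le_trans ?_ (key.trans h₁)
        exact le_mul_of_one_le_right (by positivity) hM1
      -- With y = T/4 ≤ 1/2: exp y ≤ 1/(1 − y) ≤ 1 + 2y.
      have h₃ : Real.exp (T / 4) ≤ 1 + T / 2 := by
        have := Real.exp_bound_div_one_sub_of_interval (x := T / 4) (by linarith) (by linarith)
        refine this.trans ?_
        rw [div_le_iff₀ (by linarith)]
        nlinarith
      have h₄ : Real.exp (T / 4 * (L - R - t : ℕ)) ≤ n := by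
        rw [mul_comm, Real.exp_nat_mul]
        exact (pow_le_pow_left₀ (Real.exp_pos _).le h₃ _).trans h₂
      have hn0 : (0 : ℝ) < n := (Real.exp_pos _).trans_le h₄
      have := (Real.le_log_iff_exp_le hn0).2 h₄
      linarith
    -- Of the more than T·|B| boundary vertices of a bad ball B, at most |D| ≤ (T/4)·|B| are lost,
    -- which leaves growth by a factor of at least 1 + T/2.
    · intro r hr₁ hr₂ hbad
      have h₁ := card_add_card_boundary_le_avoidBall (G := G) hx r
      have h₂ : ((familyBall G p q c r).card : ℝ) + (nodeBoundary G (familyBall G p q c r)).card ≤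
          (familyBall G p q c (r + 1)).card + (removedSet G p q (c / 2)).card := by
        exact_mod_cast h₁
      have h₃ := hMr r hr₁
      nlinarith

/-- Balls around `p` or `q` have expansion `O(log n / dist p q)`. -/
theorem exists_goodPrefixes_of_log_le (hG : G.Connected) {t : ℕ} (hT : 0 < T) (hT2 : T ≤ 2)
    (hpq : 0 < G.dist p q) (hL : Real.log (n / 2) < T / 2 * ((G.dist p q - 1) / 2 - t : ℕ)) :
    ∃ c, c / 2 = 0 ∧ t ≤ (goodPrefixes G p q c T).card := by
  obtain ⟨c, hc, hcn⟩ := exists_familyBall_card_le (G := G) (p := p) (q := q) (ρ := 0)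
    (L := (G.dist p q - 1) / 2) (fun w _ => by have := SimpleGraph.dist_le w; omega)
  refine ⟨c, hc, ?_⟩
  by_contra! hlt
  have h₁ := pow_le_card_familyBall hG hT.le (by simp [hc, removedSet_zero hG]) hcn hlt
  have h₂ : ((familyBall G p q c ((G.dist p q - 1) / 2)).card : ℝ) ≤ n / 2 := by
    have : (2 : ℝ) * (familyBall G p q c ((G.dist p q - 1) / 2)).card ≤ n := by exact_mod_cast hcn
    linarith
  -- Convexity on [0, 1] gives exp(T/2) ≤ 1 + (T/2)(e − 1), and e < 3.
  have h₃ : Real.exp (T / 2) ≤ 1 + T := by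
    have := convexOn_exp.2 (Set.mem_univ (0 : ℝ)) (Set.mem_univ (1 : ℝ))
      (show 0 ≤ 1 - T / 2 by linarith) (show 0 ≤ T / 2 by linarith) (by ring)
    simp at this
    have h3 := Real.exp_one_lt_three
    nlinarith
  have h₄ : Real.exp (T / 2 * ((G.dist p q - 1) / 2 - t : ℕ)) ≤ n / 2 := by
    rw [mul_comm, Real.exp_nat_mul]
    exact (pow_le_pow_left₀ (Real.exp_pos _).le h₃ _).trans (h₁.trans h₂)
  have hn0 : (0 : ℝ) < n / 2 := (Real.exp_pos _).trans_le h₄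
  have := (Real.le_log_iff_exp_le hn0).2 h₄
  linarith

end Families

/-! ### Choice of constants and the main theorem -/

section Main

/-- Used to absorb polynomial factors in Δ once Δ is large; the threshold depends only on μ and b.
-/
theorem exists_forall_mul_sq_le_rpow {μ b : ℝ} (hμ : 0 < μ) (hb : 0 < b) :
    ∃ Δ₀ : ℕ, ∀ Δ : ℕ, Δ₀ ≤ Δ → 12 * (Δ : ℝ) ^ 2 ≤ (2 : ℝ) ^ (b * (Δ : ℝ) ^ μ) := by
  have h₁ := (isLittleO_rpow_exp_pos_mul_atTop (2 / μ) (mul_pos hb (Real.log_pos one_lt_two))).bound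
    (show (0 : ℝ) < 1 / 12 by norm_num)
  have h₂ : Filter.Tendsto (fun Δ : ℕ => (Δ : ℝ) ^ μ) Filter.atTop Filter.atTop :=
    (tendsto_rpow_atTop hμ).comp tendsto_natCast_atTop_atTop
  obtain ⟨Δ₀, h⟩ := Filter.eventually_atTop.1 (h₂.eventually h₁)
  refine ⟨Δ₀, fun Δ hΔ => ?_⟩
  have h₃ := h Δ hΔ
  have h₄ : ((Δ : ℝ) ^ μ) ^ (2 / μ) = (Δ : ℝ) ^ 2 := by
    rw [← Real.rpow_mul (Nat.cast_nonneg _), mul_div_cancel₀ _ hμ.ne']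
    exact Real.rpow_two _
  rw [h₄, Real.norm_of_nonneg (by positivity), Real.norm_of_nonneg (Real.exp_pos _).le] at h₃
  rw [Real.rpow_def_of_pos two_pos]
  have h₅ : Real.log 2 * (b * (Δ : ℝ) ^ μ) = b * Real.log 2 * (Δ : ℝ) ^ μ := by ring
  rw [h₅]
  linarith

theorem requiredCount_le {μ : ℝ} (hμ1 : μ < 1) {Δ : ℕ} (hΔ : 0 < Δ) :
    requiredCount μ Δ ≤ Δ / 88 + 1 := by
  have h₁ : ⌈(Δ : ℝ) ^ μ⌉₊ ≤ Δ := by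
    refine Nat.ceil_le.2 ?_
    calc (Δ : ℝ) ^ μ ≤ (Δ : ℝ) ^ (1 : ℝ) :=
          Real.rpow_le_rpow_of_exponent_le (by exact_mod_cast hΔ) hμ1.le
      _ = _ := Real.rpow_one _
  rw [requiredCount]
  omega

theorem le_requiredCount {μ : ℝ} {d : ℕ} (hd : 2 < d) (Δ : ℕ) :
    max ((Δ : ℝ) ^ μ / (56 * Real.logb 2 d)) 1 ≤ requiredCount μ Δ := by
  -- Since 2^11 ≤ 3^7. The constant 88 = 56·11/7 of `requiredCount` comes from here: it replaces
  -- 56·log d by a number independent of d.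
  have hd' : (11 : ℝ) / 7 ≤ Real.logb 2 d := by
    have h3 : (3 : ℝ) ≤ d := by exact_mod_cast hd
    refine le_trans ?_ (Real.logb_le_logb_of_le (by norm_num) (by norm_num) h3)
    rw [Real.le_logb_iff_rpow_le (by norm_num) (by norm_num)]
    refine (Real.rpow_le_rpow_iff (by positivity) (by norm_num) (show (0 : ℝ) < 7 by norm_num)).1 ?_
    rw [← Real.rpow_mul (by norm_num)]
    norm_num
  have hY : (0 : ℝ) ≤ (Δ : ℝ) ^ μ := by positivity
  have h₁ : (⌈(Δ : ℝ) ^ μ⌉₊ : ℝ) ≤ 88 * requiredCount μ Δ := by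
    have : ⌈(Δ : ℝ) ^ μ⌉₊ ≤ 88 * requiredCount μ Δ := by rw [requiredCount]; omega
    exact_mod_cast this
  have h₂ : (1 : ℝ) ≤ requiredCount μ Δ := by
    have : 1 ≤ requiredCount μ Δ := by rw [requiredCount]; omega
    exact_mod_cast this
  refine max_le ?_ h₂
  rw [div_le_iff₀ (by linarith)]
  have := Nat.le_ceil ((Δ : ℝ) ^ μ)
  nlinarith

variable {n : ℕ} {G : SimpleGraph (Fin n)} [DecidableRel G.Adj] {p q : Fin n}

set_option maxHeartbeats 1000000 in
/-- The case in which the removed set is used. -/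
theorem exists_goodPrefixes_of_isHyperbolic {δ Y X T : ℝ} {d Δ₀ t : ℕ} (hG : G.Connected) (hd : 2 < d)
    (hdeg : ∀ v, G.degree v ≤ d) (hδ : 1 / 2 ≤ δ) (hhyp : IsHyperbolic G δ)
    (hX : X = Y / (28 * δ * Real.logb 2 (2 * (d : ℝ)))) (hXlog : 32 ≤ (2 : ℝ) ^ X)
    (hYΔ : Y ≤ G.dist p q)
    (hΔ₀ : Δ₀ ≤ G.dist p q → 12 * (G.dist p q : ℝ) ^ 2 ≤ (2 : ℝ) ^ (0.09 * Y))
    (hnΔ₀ : 12 * (Δ₀ : ℝ) ^ 2 ≤ 500 * Real.log n) (ht : t ≤ G.dist p q / 88 + 1) (hT2 : T ≤ 2)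
    (hTY : Y / G.dist p q ≤ T) (hTX : 500 * Real.log n / (G.dist p q * (2 : ℝ) ^ X) ≤ T) :
    ∃ c < 2 * n, t ≤ (goodPrefixes G p q c T).card := by
  set Δ := G.dist p q with hΔdef
  set l := Real.logb 2 (2 * (d : ℝ)) with hl
  have hl₁ : (5 : ℝ) / 2 ≤ l := by
    have h3 : (6 : ℝ) ≤ 2 * d := by
      have : (3 : ℝ) ≤ d := by exact_mod_cast hd
      linarith
    refine le_trans ?_ (Real.logb_le_logb_of_le (by norm_num) (by norm_num) h3)
    rw [Real.le_logb_iff_rpow_le (by norm_num) (by norm_num)]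
    refine (Real.rpow_le_rpow_iff (by positivity) (by norm_num) (show (0 : ℝ) < 2 by norm_num)).1 ?_
    rw [← Real.rpow_mul (by norm_num)]
    norm_num
  have hX5 : 5 ≤ X := by
    have : (2 : ℝ) ^ (5 : ℝ) ≤ (2 : ℝ) ^ X := by norm_num; exact hXlog
    exact (Real.rpow_le_rpow_left_iff one_lt_two).1 this
  have hYX : Y = 28 * (δ * l * X) := by
    rw [hX]
    field_simp
  have hδl : 5 / 4 ≤ δ * l := by nlinarith
  have hδX : 5 / 2 ≤ δ * X := by nlinarith
  have hY₁ : 70 * (δ * X) ≤ Y := by rw [hYX]; nlinarith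
  have hY₂ : 70 * l ≤ Y := by rw [hYX]; nlinarith
  have hY₃ : 35 * X ≤ Y := by rw [hYX]; nlinarith
  have hY₄ : 350 * δ ≤ Y := by nlinarith
  have hY175 : 175 ≤ Y := by linarith
  have hΔ175 : 175 ≤ Δ := by
    have : (175 : ℝ) ≤ Δ := by linarith
    exact_mod_cast this
  have hΔr : (175 : ℝ) ≤ Δ := by exact_mod_cast hΔ175
  have hΔn : Δ < n := RAM.dist_lt_of_connected hG p q
  have hT0 : 0 < T := lt_of_lt_of_le (by positivity) hTY
  -- The summand 1 makes 2^N at least 2·2^X, so that L below is about Δ·2^X/40 or more.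
  set N := ⌈X⌉₊ + 1 with hN
  have hN₁ : X + 1 ≤ N := by rw [hN]; push_cast; linarith [Nat.le_ceil X]
  have hN₂ : (N : ℝ) ≤ X + 2 := by
    rw [hN]; push_cast; linarith [Nat.ceil_lt_add_one (show 0 ≤ X by linarith)]
  have hN2 : 2 ≤ N := by
    have : (2 : ℝ) ≤ N := by linarith
    exact_mod_cast this
  set ρ := ⌊2 * δ * (N + 3)⌋₊ + 1 with hρ
  have hδN : 2 * δ * (N + 3) ≤ 2 * δ * X + 10 * δ := by nlinarith
  have hρ₁ : 2 * δ * (N + 3) < ρ := by rw [hρ]; push_cast; exact Nat.lt_floor_add_one _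
  have hρ₂ : (ρ : ℝ) ≤ 2 * δ * X + 10 * δ + 1 := by
    rw [hρ]; push_cast
    linarith [Nat.floor_le (show 0 ≤ 2 * δ * ((N : ℝ) + 3) by positivity)]
  -- Needed for the search with slack ρ to be among the 2n that are tried.
  have hρn : ρ < n := by
    have h₁ : (ρ : ℝ) < Δ := by linarith
    have h₂ : ρ < Δ := by exact_mod_cast h₁
    omega
  set k := ⌈((ρ : ℝ) + 4 * δ + 2) / 2⌉₊ with hk
  have hk₁ : (ρ : ℝ) + 4 * δ + 2 ≤ 2 * k := by
    linarith [Nat.le_ceil (((ρ : ℝ) + 4 * δ + 2) / 2)]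
  have hk₂ : (k : ℝ) ≤ δ * X + 7 * δ + 5 / 2 := by
    have := Nat.ceil_lt_add_one (show 0 ≤ ((ρ : ℝ) + 4 * δ + 2) / 2 by positivity)
    rw [← hk] at this
    linarith
  have hcard := card_removedSet_le hhyp hG (by linarith) hd.le hdeg p q hk₁
  rw [← hΔdef] at hcard
  have hcard' : ((removedSet G p q ρ).card : ℝ) ≤ (Δ + 1) * (d : ℝ) ^ (k + 1) := by
    exact_mod_cast hcard
  -- Here δlX = Y/28, 7δl ≤ 1.4·δlX because X ≥ 5, and 3.5·l ≤ Y/20; the sum is below 0.136·Y.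
  have hdpow : (d : ℝ) ^ (k + 1) ≤ (2 : ℝ) ^ (0.136 * Y) := by
    have hd0 : (0 : ℝ) < d := by exact_mod_cast (by omega : 0 < d)
    have h₁ : (d : ℝ) ≤ (2 : ℝ) ^ l := by
      rw [hl, Real.rpow_logb (by norm_num) (by norm_num) (by positivity)]
      linarith
    calc (d : ℝ) ^ (k + 1) ≤ ((2 : ℝ) ^ l) ^ (k + 1) := pow_le_pow_left₀ hd0.le h₁ _
      _ = (2 : ℝ) ^ (l * (k + 1)) := by
        rw [← Real.rpow_natCast, ← Real.rpow_mul (by norm_num)]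
        push_cast
        rfl
      _ ≤ (2 : ℝ) ^ (0.136 * Y) := by
        refine Real.rpow_le_rpow_of_exponent_le one_le_two ?_
        have hl0 : 0 ≤ l := by linarith
        have h₂ : l * (k + 1) ≤ l * (δ * X + 7 * δ + 7 / 2) := by
          refine mul_le_mul_of_nonneg_left ?_ hl0
          linarith
        have h₃ : δ * l * 5 ≤ δ * l * X := mul_le_mul_of_nonneg_left hX5 (by linarith)
        have h₄ : l * (δ * X + 7 * δ + 7 / 2) = δ * l * X + 7 * (δ * l) + 7 / 2 * l := by ring
        norm_num
        linarith
  have htΔ : (t : ℝ) ≤ Δ := by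
    have : t ≤ Δ := by omega
    exact_mod_cast this
  -- The quarter loses 1/88 to t, and the rounding terms are small because Δ ≥ 175.
  have hRt : (0.228 : ℝ) * Δ ≤ (Δ / 4 - t : ℕ) := by
    have h₁ : 228 * Δ ≤ 1000 * (Δ / 4 - t) := by omega
    have h₂ : (228 : ℝ) * Δ ≤ 1000 * (Δ / 4 - t : ℕ) := by exact_mod_cast h₁
    norm_num
    linarith
  -- Bernoulli's inequality for the exponent Y/Δ ≤ 1 gives 2^(Y/Δ) ≤ 1 + Y/Δ ≤ 1 + T.
  have hpowT : (2 : ℝ) ^ (0.228 * Y) ≤ (1 + T) ^ (Δ / 4 - t) := by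
    have hB0 : 0 ≤ Y / Δ := by positivity
    have hB1 : Y / Δ ≤ 1 := by rw [div_le_one (by linarith)]; exact hYΔ
    have h₁ : (2 : ℝ) ^ (Y / Δ) ≤ 1 + T := by
      have := rpow_one_add_le_one_add_mul_self (s := 1) (by norm_num) hB0 hB1
      norm_num at this
      linarith
    calc (2 : ℝ) ^ (0.228 * Y) ≤ (2 : ℝ) ^ (Y / Δ * (Δ / 4 - t : ℕ)) := by
          refine Real.rpow_le_rpow_of_exponent_le one_le_two ?_
          have := mul_le_mul_of_nonneg_left hRt hB0
          have h₂ : Y / Δ * (0.228 * Δ) = 0.228 * Y := by field_simp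
          linarith
      _ = ((2 : ℝ) ^ (Y / Δ)) ^ (Δ / 4 - t) := by
        rw [Real.rpow_mul (by norm_num), Real.rpow_natCast]
      _ ≤ _ := pow_le_pow_left₀ (by positivity) h₁ _
  -- The margin 0.092 = 0.228 − 0.136 pays for the factor 12Δ/T. For Δ ≥ Δ₀ this uses T ≥ 1/Δ; for
  -- smaller Δ it uses the logarithmic lower bound on T, with 500 ln n ≥ 12·Δ₀². This is where n
  -- must be large in terms of μ.
  have hTΔ : 12 * (Δ : ℝ) ≤ T * (2 : ℝ) ^ (0.092 * Y) := by
    have hΔ0 : (0 : ℝ) < Δ := by linarith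
    have hpow0 : (0 : ℝ) < (2 : ℝ) ^ (0.092 * Y) := by positivity
    by_cases hbig : Δ₀ ≤ Δ
    · have h₁ := hΔ₀ hbig
      have h₂ : (2 : ℝ) ^ (0.09 * Y) ≤ (2 : ℝ) ^ (0.092 * Y) :=
        Real.rpow_le_rpow_of_exponent_le one_le_two (by norm_num; linarith)
      have h₃ : 1 / (Δ : ℝ) ≤ T := le_trans (by gcongr; linarith) hTY
      calc 12 * (Δ : ℝ) = 1 / Δ * (12 * (Δ : ℝ) ^ 2) := by field_simp
        _ ≤ T * (2 : ℝ) ^ (0.092 * Y) := by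
          refine mul_le_mul h₃ (h₁.trans h₂) (by positivity) hT0.le
    · have h₁ : (Δ : ℝ) ^ 2 ≤ (Δ₀ : ℝ) ^ 2 := by
        have : (Δ : ℝ) ≤ Δ₀ := by exact_mod_cast (not_le.1 hbig).le
        gcongr
      have h₂ : (2 : ℝ) ^ X ≤ (2 : ℝ) ^ (0.092 * Y) :=
        Real.rpow_le_rpow_of_exponent_le one_le_two (by norm_num; linarith)
      have hX0 : (0 : ℝ) < (2 : ℝ) ^ X := by positivity
      calc 12 * (Δ : ℝ) = 12 * (Δ : ℝ) ^ 2 / (Δ * (2 : ℝ) ^ X) * (2 : ℝ) ^ X := by field_simp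
        _ ≤ 500 * Real.log n / (Δ * (2 : ℝ) ^ X) * (2 : ℝ) ^ X := by
          refine mul_le_mul_of_nonneg_right (div_le_div_of_nonneg_right ?_ (by positivity)) hX0.le
          linarith
        _ ≤ T * (2 : ℝ) ^ (0.092 * Y) := mul_le_mul hTX h₂ hX0.le hT0.le
  set L := ⌊(Δ : ℝ) * 2 ^ N / 80⌋₊ with hL
  have hL₁ : (L : ℝ) ≤ (Δ : ℝ) * 2 ^ N / 80 := Nat.floor_le (by positivity)
  have hL₂ : (Δ : ℝ) * (2 : ℝ) ^ X / 40 - 1 ≤ L := by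
    have h₁ : (2 : ℝ) ^ (X + 1) ≤ (2 : ℝ) ^ N := by
      rw [← Real.rpow_natCast]
      exact Real.rpow_le_rpow_of_exponent_le one_le_two hN₁
    rw [Real.rpow_add two_pos, Real.rpow_one] at h₁
    have h₂ := Nat.lt_floor_add_one ((Δ : ℝ) * 2 ^ N / 80)
    rw [← hL] at h₂
    have h₃ : (Δ : ℝ) * ((2 : ℝ) ^ X * 2) ≤ Δ * 2 ^ N :=
      mul_le_mul_of_nonneg_left h₁ (Nat.cast_nonneg _)
    linarith
  have hΔX : (32 : ℝ) * Δ ≤ Δ * (2 : ℝ) ^ X := by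
    rw [mul_comm (32 : ℝ)]
    exact mul_le_mul_of_nonneg_left hXlog (Nat.cast_nonneg _)
  have hRtr : ((Δ / 4 + t : ℕ) : ℝ) ≤ 0.262 * Δ + 1 := by
    have h₁ : 1000 * (Δ / 4 + t) ≤ 262 * Δ + 1000 := by omega
    have h₂ : (1000 : ℝ) * (Δ / 4 + t : ℕ) ≤ 262 * Δ + 1000 := by exact_mod_cast h₁
    norm_num at h₂ ⊢
    linarith
  have hRL : Δ / 4 + t ≤ L := by
    have : ((Δ / 4 + t : ℕ) : ℝ) ≤ L := by
      norm_num at hRtr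
      push_cast
      linarith
    exact_mod_cast this
  have hwalk : ∀ w : G.Walk p q, (∀ u ∈ w.support, u ∉ removedSet G p q ρ) → 2 * L < w.length := by
    intro w hw
    have h₁ := lt_length_of_notMem_removedSet hhyp hG hδ hρ₁ (by linarith) hN2 w hw
    have h₂ : (2 : ℝ) * L < w.length := by linarith
    exact_mod_cast h₂
  have hD : ((removedSet G p q ρ).card + t : ℝ) ≤ T / 4 * (1 + T) ^ (Δ / 4 - t) := by
    have h₁ : (1 : ℝ) ≤ (2 : ℝ) ^ (0.136 * Y) := Real.one_le_rpow one_le_two (by positivity)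
    have h₂ : (2 : ℝ) ^ (0.228 * Y) = (2 : ℝ) ^ (0.092 * Y) * (2 : ℝ) ^ (0.136 * Y) := by
      rw [← Real.rpow_add two_pos]
      congr 1
      ring
    have h₄ : ((removedSet G p q ρ).card : ℝ) ≤ (Δ + 1) * (2 : ℝ) ^ (0.136 * Y) :=
      hcard'.trans (by gcongr)
    calc ((removedSet G p q ρ).card : ℝ) + t ≤ (Δ + 1) * (2 : ℝ) ^ (0.136 * Y) + Δ * (2 : ℝ) ^ (0.136 * Y) := by
          exact add_le_add h₄ (htΔ.trans (le_mul_of_one_le_right (Nat.cast_nonneg _) h₁))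
      _ ≤ 3 * Δ * (2 : ℝ) ^ (0.136 * Y) := by
        have := mul_le_mul_of_nonneg_right (show (1 : ℝ) ≤ Δ by linarith)
          (show (0 : ℝ) ≤ (2 : ℝ) ^ (0.136 * Y) by linarith)
        linarith only [this]
      _ = 12 * Δ / 4 * (2 : ℝ) ^ (0.136 * Y) := by ring
      _ ≤ T * (2 : ℝ) ^ (0.092 * Y) / 4 * (2 : ℝ) ^ (0.136 * Y) := by gcongr
      _ = T / 4 * (2 : ℝ) ^ (0.228 * Y) := by rw [h₂]; ring
      _ ≤ _ := by gcongr
  -- Since Δ ≤ Δ·2^X/32, the number of remaining radii exceeds 4·Δ·2^X/500, which is what T ≥ 500 ln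
  -- n/(Δ·2^X) requires.
  have hlogL : Real.log n < T / 4 * (L - Δ / 4 - t : ℕ) := by
    have h₀ : ((L - Δ / 4 - t : ℕ) : ℝ) = L - (Δ / 4 + t : ℕ) := by
      rw [Nat.sub_sub, Nat.cast_sub hRL]
    have h₁ : (Δ : ℝ) * (2 : ℝ) ^ X * 4 / 500 < (L - Δ / 4 - t : ℕ) := by
      rw [h₀]
      norm_num at hRtr
      push_cast
      linarith
    have h₂ : (0 : ℝ) < Δ * (2 : ℝ) ^ X := by positivity
    rw [div_le_iff₀ h₂] at hTX
    have h₃ := mul_lt_mul_of_pos_left h₁ (show 0 < T / 4 by linarith)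
    have h₄ : T / 4 * (Δ * (2 : ℝ) ^ X * 4 / 500) = T * (Δ * (2 : ℝ) ^ X) / 500 := by ring
    linarith only [hTX, h₃, h₄]
  obtain ⟨c, hc, hgood⟩ := exists_goodPrefixes_of_removedSet hG hT0 hT2 hwalk (by omega) hD hlogL
  exact ⟨c, by omega, hgood⟩

theorem exists_goodPrefixes {μ : ℝ} (hμ0 : 0 < μ) (hμ1 : μ < 1) : ∃ N : ℕ, ∀ n : ℕ, N ≤ n →
    ∀ (G : SimpleGraph (Fin n)) [DecidableRel G.Adj] (d : ℕ) (δ : ℝ) (p q : Fin n),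
      G.Connected → 2 < d → (∀ v, G.degree v ≤ d) → 1 / 2 ≤ δ → IsHyperbolic G δ → p ≠ q →
      ∃ c < 2 * n, requiredCount μ (G.dist p q) ≤ (goodPrefixes G p q c
        (min (8 * Real.log ((n : ℝ) / 2) / (G.dist p q : ℝ))
              (max ((1 / (G.dist p q : ℝ)) ^ (1 - μ))
                (500 * Real.log n /
                  ((G.dist p q : ℝ) *
                    (2 : ℝ) ^ ((G.dist p q : ℝ) ^ μ / (28 * δ * Real.logb 2 (2 * (d : ℝ))))))))).card := by
  obtain ⟨Δ₀, hΔ₀⟩ := exists_forall_mul_sq_le_rpow (b := 0.09) hμ0 (by norm_num)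
  obtain ⟨N, hN⟩ := Filter.eventually_atTop.1
    ((Real.tendsto_log_atTop.comp tendsto_natCast_atTop_atTop).eventually_ge_atTop
      (12 * (Δ₀ : ℝ) ^ 2 + 20))
  refine ⟨max N 20, ?_⟩
  intro n hn G _ d δ p q hG hd hdeg hδ hhyp hpq
  have hlogn : 12 * (Δ₀ : ℝ) ^ 2 + 20 ≤ Real.log n := hN n (le_trans (le_max_left _ _) hn)
  have hn20 : 20 ≤ n := le_trans (le_max_right _ _) hn
  have hn0 : (0 : ℝ) < n := by exact_mod_cast (by omega : 0 < n)
  have hΔpos : 0 < G.dist p q := hG.pos_dist_of_ne hpq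
  have hΔn : G.dist p q < n := RAM.dist_lt_of_connected hG p q
  have ht := requiredCount_le hμ1 hΔpos
  have hlog2 : Real.log ((n : ℝ) / 2) = Real.log n - Real.log 2 := Real.log_div hn0.ne' two_ne_zero
  have hl2 : Real.log 2 < 1 := by linarith [Real.log_two_lt_d9]
  have hl2' : 0 < Real.log 2 := Real.log_pos one_lt_two
  have hsq : (0 : ℝ) ≤ (Δ₀ : ℝ) ^ 2 := sq_nonneg _
  set t := requiredCount μ (G.dist p q)
  set Δ := G.dist p q with hΔ
  set Y : ℝ := (Δ : ℝ) ^ μ with hY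
  set X : ℝ := Y / (28 * δ * Real.logb 2 (2 * (d : ℝ))) with hX
  set A : ℝ := 8 * Real.log ((n : ℝ) / 2) / (Δ : ℝ) with hA
  set C : ℝ := 500 * Real.log n / ((Δ : ℝ) * (2 : ℝ) ^ X) with hC
  have hΔr : (1 : ℝ) ≤ Δ := by exact_mod_cast hΔpos
  have hΔ0 : (0 : ℝ) < Δ := by linarith
  have hB : (1 / (Δ : ℝ)) ^ (1 - μ) = Y / Δ := by
    rw [one_div, Real.inv_rpow hΔ0.le, Real.rpow_sub hΔ0, Real.rpow_one, ← hY, inv_div]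
  have hYΔ : Y ≤ Δ := by
    calc (Δ : ℝ) ^ μ ≤ (Δ : ℝ) ^ (1 : ℝ) := Real.rpow_le_rpow_of_exponent_le hΔr hμ1.le
      _ = _ := Real.rpow_one _
  rw [hB]
  set T := min A (max (Y / Δ) C) with hT
  have hA0 : 0 < A := by
    rw [hA, hlog2]
    apply div_pos _ hΔ0
    linarith
  have hT0 : 0 < T := lt_min hA0 (lt_max_of_lt_left (by positivity))
  by_cases hT2 : 2 ≤ T
  · exact ⟨0, by omega, card_goodPrefixes_of_two_le hG hT2 (by omega)⟩
  rw [not_le] at hT2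
  rcases le_or_gt A (max (Y / Δ) C) with hAle | hAgt
  · have hTA : T = A := min_eq_left hAle
    -- T < 2 forces Δ > 4 ln(n/2). Then (Δ − 1)/2 − t exceeds Δ/4 despite rounding, which the factor
    -- 8 in the bound turns into enough growth.
    have hΔ40 : 40 < Δ := by
      rw [hTA, hA, div_lt_iff₀ hΔ0, hlog2] at hT2
      have : (40 : ℝ) < Δ := by linarith
      exact_mod_cast this
    obtain ⟨c, hc, hgood⟩ := exists_goodPrefixes_of_log_le (p := p) (q := q) (t := t) hG hT0 hT2.le
      hΔpos (by
        rw [hTA, hA, ← hΔ]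
        have h₁ : Δ < 4 * ((Δ - 1) / 2 - t) := by omega
        have h₂ : (Δ : ℝ) < 4 * ((Δ - 1) / 2 - t : ℕ) := by exact_mod_cast h₁
        have h₃ : 0 < Real.log ((n : ℝ) / 2) := by rw [hlog2]; linarith
        rw [div_div, div_mul_eq_mul_div, lt_div_iff₀ (by positivity)]
        nlinarith)
    exact ⟨c, by omega, hgood⟩
  · have hTA : T = max (Y / Δ) C := min_eq_right hAgt.le
    have hCA : C < A := lt_of_le_of_lt (le_max_right _ _) hAgt
    have h2X : (0 : ℝ) < (2 : ℝ) ^ X := by positivity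
    -- C < A means 500 ln n < 8 ln(n/2)·2^X, so 2^X is even above 62.
    have h32 : 32 ≤ (2 : ℝ) ^ X := by
      rw [hC, hA, div_lt_div_iff₀ (by positivity) hΔ0, hlog2] at hCA
      by_contra! hcon
      have h₁ : (8 * (Real.log n - Real.log 2)) * (Δ * (2 : ℝ) ^ X) ≤ (8 * Real.log n) * (Δ * 32) := by
        gcongr
        linarith
      nlinarith
    refine exists_goodPrefixes_of_isHyperbolic (Δ₀ := Δ₀) hG hd hdeg hδ hhyp hX h32 hYΔ
      (hΔ₀ Δ) (by linarith) ht hT2.le ?_ ?_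
    · rw [hTA]; exact le_max_left _ _
    · rw [hTA]; exact le_max_right _ _

end Main

theorem theorem1 (μ : ℝ) (hμ0 : 0 < μ) (hμ1 : μ < 1) :
    ∃ (prog : RAM.Prog) (K N : ℕ) (C : ℝ),
      ∀ (n : ℕ), N ≤ n →
      ∀ (G : SimpleGraph (Fin n)) [DecidableRel G.Adj] (d : ℕ) (δ : ℝ) (p q : Fin n),
        G.Connected → 2 < d → (∀ v, G.degree v ≤ d) → 1 / 2 ≤ δ → IsHyperbolic G δ → p ≠ q →
        ∃ (t : ℕ) (S : Fin t → Finset (Fin n)),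
          max ((G.dist p q : ℝ) ^ μ / (56 * Real.logb 2 d)) 1 ≤ (t : ℝ) ∧
          StrictMono S ∧
          (∀ j, (S j).Nonempty ∧ ((S j).card : ℝ) ≤ (n : ℝ) / 2) ∧
          (∀ j, nodeExpansion G (S j) ≤
            min (8 * Real.log ((n : ℝ) / 2) / (G.dist p q : ℝ))
              (max ((1 / (G.dist p q : ℝ)) ^ (1 - μ))
                (500 * Real.log n /
                  ((G.dist p q : ℝ) *
                    (2 : ℝ) ^ ((G.dist p q : ℝ) ^ μ / (28 * δ * Real.logb 2 (2 * (d : ℝ)))))))) ∧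
          ((∀ j, p ∈ S j) ∨ (∀ j, q ∈ S j)) ∧
          ∃ (final : RAM.State) (k : ℕ),
            RAM.Exec μ (n ^ K) prog (RAM.input G p q) final k ∧
            RAM.Outputs final S ∧
            (k : ℝ) ≤ C * ((n : ℝ) ^ 3 * Real.logb 2 n + (G.edgeFinset.card : ℝ) * (n : ℝ) ^ 2) := by
  obtain ⟨N, hN⟩ := exists_goodPrefixes hμ0 hμ1
  refine ⟨RAM.mainProg, 3, max N 2, 2000, ?_⟩
  intro n hn G _ d δ p q hG hd hdeg hδ hhyp hpq
  obtain ⟨t, S, ht, hmono, hcard, hexp, hside, final, k, hrun, hout, hk⟩ :=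
    RAM.exists_output hμ1 hG hpq (hN n (le_trans (le_max_left _ _) hn) G d δ p q hG hd hdeg hδ hhyp hpq)
  refine ⟨t, S, (le_requiredCount hd _).trans (by exact_mod_cast ht), hmono, ?_, hexp, hside,
    final, k, hrun, hout, ?_⟩
  · intro j
    refine ⟨(hcard j).1, ?_⟩
    have : (2 : ℝ) * (S j).card ≤ n := by exact_mod_cast (hcard j).2
    linarith
  · have hn2 : (2 : ℝ) ≤ n := by exact_mod_cast le_trans (le_max_right N 2) hn
    have h₁ : 1 ≤ Real.logb 2 n := by
      rw [Real.le_logb_iff_rpow_le (by norm_num) (by linarith), Real.rpow_one]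
      exact hn2
    have h₂ : (k : ℝ) ≤ 2000 * (n : ℝ) ^ 3 := by exact_mod_cast hk
    have h₃ : (n : ℝ) ^ 3 ≤ (n : ℝ) ^ 3 * Real.logb 2 n := le_mul_of_one_le_right (by positivity) h₁
    have h₄ : (0 : ℝ) ≤ (G.edgeFinset.card : ℝ) * (n : ℝ) ^ 2 := by positivity
    linarith
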